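/- Let $0\le d\le n$ and let $A\in\mathbb{Z}^{d\times n}$ be a matrix of full rank $d$ all of whose maximal minors lie in $\{-1,0,1\}$. Let $Z=A\cdot[0,1]^n\subseteq\mathbb{R}^d$ be the associated (unimodular) zonotope, and let $M$ be the matroid of $A$, i.e. the matroid on $[n]$ whose independent sets are the index sets of linearly independent columns of $A$. Write $r$ for its rank function and $$T_M(x,y)=\sum_{S\subseteq[n]}(x-1)^{r([n])-r(S)}(y-1)^{|S|-r(S)}$$ for its Tutte polynomial, and put $[k]_q=\frac{1-q^k}{1-q}$. For a finite set $\mathcal{Z}\subseteq\mathbb{Z}^d\subseteq\mathbb{C}^d$ let $\operatorname{gr} I(\mathcal{Z})\subseteq\mathbb{C}[x_1,\dots,x_d]$ be the ideal generated by the top degree homogeneous components of all polynomials vanishing on $\mathcal{Z}$, let $\operatorname{Orb}(\mathcal{Z})=\mathbb{C}[x_1,\dots,x_d]/\operatorname{gr} I(\mathcal{Z})$, graded by degree, and let $\operatorname{Hilb}(\operatorname{Orb}(\mathcal{Z});q)=\sum_{j\ge0}\dim_{\mathbb{C}}\operatorname{Orb}(\mathcal{Z})_j\,q^j$. For an integer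 $m\ge1$ define $$i_Z(m;q)=\operatorname{Hilb}(\operatorname{Orb}(mZ\cap\mathbb{Z}^d);q),\qquad \widetilde{i}_Z(m;q)=\operatorname{Hilb}(\operatorname{Orb}(\operatorname{int}(mZ)\cap\mathbb{Z}^d);q).$$ Then, for every integer $m\ge1$, $i_Z(m;q)$ and $\widetilde{i}_Z(m;q)$ are polynomials in $\mathbb{Z}[q]$, and in $\mathbb{Q}(q)$ $$i_Z(m;q)=q^{(n-d)m}[m]_q^d\,T_M\!\left(\frac{[m+1]_q}{[m]_q},q^{-m}\right),\qquad \widetilde{i}_Z(m;q)=q^{(n-d)m}[m]_q^d\,T_M\!\left(\frac{[m-1]_q}{[m]_q},q^{-m}\right).$$ At $q=1$ this specializes to Stanley's formula: $$i_Z(m;1)=|mZ\cap\mathbb{Z}^d|=m^d\,T_M\!\left(\frac{m+1}{m},1\right),\qquad \widetilde{i}_Z(m;1)=|\operatorname{int}(mZ)\cap\mathbb{Z}^d|=m^d\,T_M\!\left(\frac{m-1}{m},1\right).$$ -/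

import Mathlib

open scoped Pointwise

namespace GradedEhrhart

/-- The matroid of the columns of a matrix `A` over a field: its ground set is the set of all
column indices, and a set of column indices is independent when the corresponding columns
are linearly independent. -/
def columnMatroid {K m n : Type*} [Field K] [Finite n] (A : Matrix m n K) : Matroid n :=
  (IndepMatroid.ofFinite (E := Set.univ) Set.finite_univ
    (fun I => LinearIndepOn K A.col I)
    (linearIndepOn_empty K A.col)
    (fun _ _ hJ hIJ => hJ.mono hIJ)
    (by
      intro I J hI hJ hlt
      by_contra! hcon
      have hle : Submodule.span K (A.col '' J) ≤ Submodule.span K (A.col '' I) := by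
        rw [Submodule.span_le]
        rintro _ ⟨e, he, rfl⟩
        by_cases heI : e ∈ I
        · exact Submodule.subset_span ⟨e, heI, rfl⟩
        · by_contra hns
          exact hcon e he heI ((linearIndepOn_insert heI).2 ⟨hI, hns⟩)
      have : Finite (A.col '' I) := (Set.toFinite I).image _
      have hfin : FiniteDimensional K (Submodule.span K (A.col '' I)) :=
        FiniteDimensional.span_of_finite K ((Set.toFinite I).image _)
      have hdim : ∀ {S : Set n}, LinearIndepOn K A.col S →
          Module.finrank K (Submodule.span K (A.col '' S)) = S.ncard := by
        intro S hS
        have : Fintype S := Fintype.ofFinite S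
        have h := finrank_span_eq_card hS
        rw [← Nat.card_eq_fintype_card, Nat.card_coe_set_eq] at h
        rw [← h, Set.image_eq_range]
      have := Submodule.finrank_mono hle
      rw [hdim hI, hdim hJ] at this
      omega)
    (fun _ _ => Set.subset_univ _)).matroid

/-- The rank of a set in a matroid on a finite type, as a natural number. -/
noncomputable def rk {α : Type*} (M : Matroid α) (S : Set α) : ℕ := (M.eRk S).toNat

open Classical in
/-- The Tutte polynomial `T_M(x, y)` of a matroid on a finite type, with `x = X 0`, `y = X 1`:
the corank-nullity sum of `(x - 1) ^ (r(E) - r(S)) * (y - 1) ^ (|S| - r(S))` over `S ⊆ E`.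
Both natural number subtractions are exact, since `r(S) ≤ r(E)` and `r(S) ≤ |S|`. -/
noncomputable def tuttePoly {α : Type*} [Fintype α] (M : Matroid α) : MvPolynomial (Fin 2) ℤ :=
  ∑ S ∈ Finset.univ.filter (fun S : Finset α => (S : Set α) ⊆ M.E),
    (MvPolynomial.X 0 - 1) ^ (rk M M.E - rk M (S : Set α)) *
      (MvPolynomial.X 1 - 1) ^ (S.card - rk M (S : Set α))

/-- The value `T_M(x, y)` of the Tutte polynomial at two elements of a commutative ring. -/
noncomputable def tutteEval {α R : Type*} [Fintype α] [CommRing R] (M : Matroid α) (x y : R) : R :=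
  MvPolynomial.aeval ![x, y] (tuttePoly M)

/-- `gr I(𝒵)`: the ideal generated by the top degree homogeneous components of all polynomials
vanishing on `𝒵`. -/
noncomputable def grIdeal {d : ℕ} (𝒵 : Set (Fin d → ℂ)) : Ideal (MvPolynomial (Fin d) ℂ) :=
  Ideal.span {g | ∃ f : MvPolynomial (Fin d) ℂ, (∀ z ∈ 𝒵, MvPolynomial.eval z f = 0) ∧
    g = MvPolynomial.homogeneousComponent f.totalDegree f}

/-- The orbit harmonics ring `ℂ[x₁, …, x_d] / gr I(𝒵)`. -/
abbrev Orb {d : ℕ} (𝒵 : Set (Fin d → ℂ)) : Type := MvPolynomial (Fin d) ℂ ⧸ grIdeal 𝒵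

/-- The degree `j` piece of the orbit harmonics ring: the image of the homogeneous polynomials
of degree `j`. -/
noncomputable def orbPiece {d : ℕ} (𝒵 : Set (Fin d → ℂ)) (j : ℕ) : Submodule ℂ (Orb 𝒵) :=
  (MvPolynomial.homogeneousSubmodule (Fin d) ℂ j).map
    (Ideal.Quotient.mkₐ ℂ (grIdeal 𝒵)).toLinearMap

/-- The Hilbert series `∑ⱼ dim_ℂ (Orb(𝒵)_j) q^j`. -/
noncomputable def orbHilb {d : ℕ} (𝒵 : Set (Fin d → ℂ)) : PowerSeries ℤ :=
  PowerSeries.mk fun j => (Module.finrank ℂ (orbPiece 𝒵 j) : ℤ)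

/-- The lattice points `P ∩ ℤ^d` of a subset `P` of `ℝ^d`. -/
def latticePoints {d : ℕ} (P : Set (Fin d → ℝ)) : Set (Fin d → ℤ) :=
  {z | (fun i => (z i : ℝ)) ∈ P}

/-- A set of lattice points viewed as a point locus in `ℂ^d`. -/
def toComplex {d : ℕ} (S : Set (Fin d → ℤ)) : Set (Fin d → ℂ) :=
  (fun z i => (z i : ℂ)) '' S

/-- The graded lattice point count `i_P(m; q)`, the Hilbert series of `Orb(mP ∩ ℤ^d)`. -/
noncomputable def gradedCount {d : ℕ} (P : Set (Fin d → ℝ)) (m : ℕ) : PowerSeries ℤ :=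
  orbHilb (toComplex (latticePoints ((m : ℝ) • P)))

/-- The graded interior lattice point count, the Hilbert series of `Orb(int(mP) ∩ ℤ^d)`. -/
noncomputable def gradedInteriorCount {d : ℕ} (P : Set (Fin d → ℝ)) (m : ℕ) : PowerSeries ℤ :=
  orbHilb (toComplex (latticePoints (interior ((m : ℝ) • P))))

/-- The real matrix underlying an integer matrix. -/
def realMatrix {d n : ℕ} (A : Matrix (Fin d) (Fin n) ℤ) : Matrix (Fin d) (Fin n) ℝ :=
  A.map (fun a : ℤ => (a : ℝ))

/-- The zonotope `A · [0,1]^n` in `ℝ^d`. -/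
def zonotope {d n : ℕ} (A : Matrix (Fin d) (Fin n) ℤ) : Set (Fin d → ℝ) :=
  (fun t => (realMatrix A).mulVec t) '' Set.Icc (0 : Fin n → ℝ) 1

/-- A `d × n` integer matrix of full rank `d` all of whose maximal minors lie in `{-1, 0, 1}`. -/
def IsUnimodular {d n : ℕ} (A : Matrix (Fin d) (Fin n) ℤ) : Prop :=
  (realMatrix A).rank = d ∧
    ∀ c : Fin d ↪o Fin n, (A.submatrix id c).det ∈ ({-1, 0, 1} : Set ℤ)

/-- The variable `q` in the field of rational functions `ℚ(q)`. -/
noncomputable def q : RatFunc ℚ := RatFunc.X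

/-- The `q`-integer `[k]_q = (1 - q^k) / (1 - q)` in `ℚ(q)`. -/
noncomputable def qInt (k : ℤ) : RatFunc ℚ := (1 - q ^ k) / (1 - q)

end GradedEhrhart

open GradedEhrhart

/-!
The graded Ehrhart counts are computed by squeezing: in both cases the Hilbert function of the
orbit harmonics ring is compared with an explicit polynomial coefficient by coefficient, the
lattice points are compared in the opposite direction with the value of that polynomial at `1`,
and since `Orb(𝒵)` has total dimension `|𝒵|`, both comparisons are equalities.

*Orbit harmonics and least spaces.* The degree `j` piece of `Orb(𝒵)` has the same dimension as the
space `leastSpace 𝒵 j` of degree `j` initial terms of the exponential sums `∑ c_y e^{ℓ(y)}` with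
frequencies `y ∈ 𝒵` that vanish to order `j` (`finrank_leastSpace`). This dual description can be
bounded from both sides. Write `a_1, …, a_n` for the columns of the matrix and `ℓ(a)` for the linear
form of a vector `a`.

*All lattice points, lower bound.* For `k_i ≤ m` the function `∏ (e^{ℓ(a_i)} - 1)^{k_i}` is an
exponential sum with frequencies in the `m`-th dilate of the zonotope, and its initial term is
`∏ ℓ(a_i)^{k_i}` (`prodSpace_le_leastSpace`). Deletion and contraction of a column show that the
products of degree `j` span a space of dimension at least the coefficient of `q^j` in the
corank-nullity sum `extPoly` (`coeff_extPoly_le_finrank_prodSpace`). Conversely the number of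
lattice points is at most `extPoly(1)` (`ncard_closedBoxSum_le`), again by deletion and
contraction: adding a segment `[0, a]` to a convex set adds at most one lattice point on each line
in direction `a`.

*Interior lattice points, upper bound.* By unimodularity there are many functionals `η` with values
in `{0, 1, -1}` on the columns. Such an `η` takes integer values strictly between its extremes on
the interior lattice points, so at most `k` values, where `k + 1` is `m` times the number of columns
with `η(a_i) ≠ 0`. Hence `η` satisfies an equation of degree `k` there, and the `k`-th power of the
derivation defined by `η` kills the least space (`leastSpace_le_powKer`): it lies in the inverse
system of a power ideal. Deletion and contraction bound the dimensions of this inverse system by the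
coefficients of a polynomial `g` with `q^d g = intPoly` (`exists_finrank_powKer_le`), while the
number of interior lattice points is at least `g(1)` (`le_ncard_openBoxSum`).

The contraction of a vector `a` is modelled inside the same space by the projection
`x ↦ x - φ(x) a` with `φ(a) = 1`, and unimodularity is used in the form `IsUnimodularConfig`, the
existence of separating functionals with values in `{0, 1, -1}`, which contraction inherits. The
corank-nullity sums are matched with the Tutte polynomial over any field in which `q` and `[m]_q`
are nonzero; `ℚ(q)` gives the graded formulas and `q = 1` in `ℚ` gives the numerical ones.
-/

/-! ### Linear algebra -/

namespace GradedEhrhart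

section LinearAlgebra

variable {K V W : Type*} [Field K] [AddCommGroup V] [Module K V] [AddCommGroup W] [Module K W]

/-- Rank-nullity for the restriction of a linear map to a subspace. -/
theorem finrank_map_add_finrank_inf_ker (f : V →ₗ[K] W) (S : Submodule K V)
    [FiniteDimensional K S] :
    Module.finrank K (S.map f) + Module.finrank K (S ⊓ LinearMap.ker f : Submodule K V) =
      Module.finrank K S := by
  have h := LinearMap.finrank_range_add_finrank_ker (f.domRestrict S)
  rw [LinearMap.range_domRestrict, LinearMap.ker_domRestrict] at h
  rw [← h]
  congr 1
  rw [← Submodule.finrank_map_subtype_eq S ((LinearMap.ker f).comap S.subtype)]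
  rw [Submodule.map_comap_subtype]

end LinearAlgebra

/-! ### The orbit harmonics ring and evaluation of polynomials -/

open MvPolynomial

variable {d : ℕ}

/-- The polynomials of degree less than `k`. -/
noncomputable def lowDegree (d k : ℕ) : Submodule ℂ (MvPolynomial (Fin d) ℂ) :=
  ⨅ i, ⨅ (_ : k ≤ i), LinearMap.ker (homogeneousComponent (R := ℂ) (σ := Fin d) i)

theorem mem_lowDegree {k : ℕ} {f : MvPolynomial (Fin d) ℂ} :
    f ∈ lowDegree d k ↔ ∀ i, k ≤ i → homogeneousComponent i f = 0 := by
  simp [lowDegree]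

theorem mem_lowDegree_iff_totalDegree {k : ℕ} {f : MvPolynomial (Fin d) ℂ} :
    f ∈ lowDegree d (k + 1) ↔ f.totalDegree ≤ k := by
  rw [mem_lowDegree]
  refine ⟨fun h => ?_, fun h i hi => homogeneousComponent_eq_zero _ _ (by omega)⟩
  rw [← sum_homogeneousComponent f]
  refine totalDegree_finsetSum_le fun i _ => ?_
  by_cases hi : k + 1 ≤ i
  · simp [h i hi]
  · exact (homogeneousComponent_isHomogeneous i f).totalDegree_le.trans (by omega)

theorem lowDegree_zero : lowDegree d 0 = ⊥ := by
  rw [eq_bot_iff]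
  intro f hf
  rw [mem_lowDegree] at hf
  rw [Submodule.mem_bot, ← sum_homogeneousComponent f]
  exact Finset.sum_eq_zero fun i _ => hf i (Nat.zero_le _)

theorem lowDegree_mono : Monotone (lowDegree d) := by
  intro k l h f hf
  rw [mem_lowDegree] at *
  exact fun i hi => hf i (h.trans hi)

theorem homogeneousSubmodule_le_lowDegree {j k : ℕ} (h : j < k) :
    homogeneousSubmodule (Fin d) ℂ j ≤ lowDegree d k := by
  intro f hf
  rw [mem_lowDegree]
  intro i hi
  rw [homogeneousComponent_of_mem hf, if_neg (by omega)]

theorem lowDegree_succ (k : ℕ) :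
    lowDegree d (k + 1) = homogeneousSubmodule (Fin d) ℂ k ⊔ lowDegree d k := by
  apply le_antisymm
  · intro f hf
    rw [mem_lowDegree] at hf
    rw [← add_sub_cancel (homogeneousComponent k f) f]
    refine Submodule.add_mem_sup (homogeneousComponent_mem _ _) ?_
    rw [mem_lowDegree]
    intro i hi
    rw [map_sub, homogeneousComponent_of_mem (homogeneousComponent_mem k f)]
    rcases hi.eq_or_lt with rfl | hlt
    · simp
    · rw [if_neg (by omega), hf i hlt, sub_zero]
  · exact sup_le (homogeneousSubmodule_le_lowDegree (Nat.lt_succ_self k))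
      (lowDegree_mono (Nat.le_succ k))

instance finiteDimensional_lowDegree (k : ℕ) : FiniteDimensional ℂ (lowDegree d k) := by
  have h : lowDegree d k ≤ restrictTotalDegree (Fin d) ℂ k := by
    intro f hf
    rw [mem_restrictTotalDegree]
    exact mem_lowDegree_iff_totalDegree.1 (lowDegree_mono (Nat.le_succ k) hf)
  exact Submodule.finiteDimensional_of_le h

instance finiteDimensional_homogeneousSubmodule (k : ℕ) :
    FiniteDimensional ℂ (homogeneousSubmodule (Fin d) ℂ k) :=
  Submodule.finiteDimensional_of_le (homogeneousSubmodule_le_lowDegree (Nat.lt_succ_self k))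

theorem mul_mem_lowDegree {i k : ℕ} {r f : MvPolynomial (Fin d) ℂ}
    (hr : r ∈ homogeneousSubmodule (Fin d) ℂ i) (hf : f ∈ lowDegree d k) :
    r * f ∈ lowDegree d (i + k) := by
  rw [← sum_homogeneousComponent f, Finset.mul_sum]
  refine Submodule.sum_mem _ fun l _ => ?_
  by_cases hl : k ≤ l
  · rw [mem_lowDegree.1 hf l hl, mul_zero]; exact zero_mem _
  · refine homogeneousSubmodule_le_lowDegree (j := i + l) (by omega) ?_
    exact IsHomogeneous.mul hr (homogeneousComponent_isHomogeneous l f)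

/-- Restriction of polynomials to functions on the point set `Y`. -/
noncomputable def evalOn (Y : Set (Fin d → ℂ)) : MvPolynomial (Fin d) ℂ →ₗ[ℂ] (Y → ℂ) :=
  LinearMap.pi fun y => (aeval (R := ℂ) (y : Fin d → ℂ)).toLinearMap

@[simp] theorem evalOn_apply (Y : Set (Fin d → ℂ)) (f : MvPolynomial (Fin d) ℂ) (y : Y) :
    evalOn Y f y = eval (y : Fin d → ℂ) f := by
  simp [evalOn, aeval_eq_eval]

/-- The functions on `Y` given by polynomials of degree less than `k`. -/
noncomputable def lowFun (Y : Set (Fin d → ℂ)) (k : ℕ) : Submodule ℂ (Y → ℂ) :=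
  (lowDegree d k).map (evalOn Y)

theorem lowFun_mono (Y : Set (Fin d → ℂ)) : Monotone (lowFun Y) :=
  fun _ _ h => Submodule.map_mono (lowDegree_mono h)

theorem evalOn_mul_mem_lowFun {Y : Set (Fin d → ℂ)} {i k : ℕ} {r f : MvPolynomial (Fin d) ℂ}
    (hr : r ∈ homogeneousSubmodule (Fin d) ℂ i) (hf : evalOn Y f ∈ lowFun Y k) :
    evalOn Y (r * f) ∈ lowFun Y (i + k) := by
  obtain ⟨h, hh, he⟩ := hf
  refine ⟨r * h, mul_mem_lowDegree hr hh, ?_⟩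
  ext y
  have := congrFun he y
  simp only [evalOn_apply, map_mul] at this ⊢
  rw [this]

/-- The homogeneous components of an element of `gr I(Y)` agree on `Y` with polynomials of
smaller degree. -/
theorem evalOn_homogeneousComponent_mem {Y : Set (Fin d → ℂ)} {p : MvPolynomial (Fin d) ℂ}
    (hp : p ∈ grIdeal Y) (j : ℕ) : evalOn Y (homogeneousComponent j p) ∈ lowFun Y j := by
  induction hp using Submodule.span_induction generalizing j with
  | mem p hp =>
    obtain ⟨f, hf, rfl⟩ := hp
    rw [homogeneousComponent_of_mem (homogeneousComponent_mem _ f)]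
    split_ifs with h
    · subst h
      refine ⟨homogeneousComponent f.totalDegree f - f, ?_, ?_⟩
      · refine mem_lowDegree.2 fun i hi => ?_
        rw [map_sub, homogeneousComponent_of_mem (homogeneousComponent_mem _ f)]
        rcases hi.eq_or_lt with rfl | hlt
        · simp
        · rw [if_neg (by omega), homogeneousComponent_eq_zero _ _ hlt, sub_zero]
      · ext y
        simp [hf y y.2]
    · simp
  | zero => simp
  | add p p' _ _ h h' => rw [map_add, map_add]; exact add_mem (h j) (h' j)
  | smul r p _ h =>
    have key : ∀ i k : ℕ, evalOn Y (homogeneousComponent j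
        (homogeneousComponent i r * homogeneousComponent k p)) ∈ lowFun Y j := by
      intro i k
      have hm : homogeneousComponent i r * homogeneousComponent k p ∈
          homogeneousSubmodule (Fin d) ℂ (i + k) :=
        (homogeneousComponent_isHomogeneous i r).mul (homogeneousComponent_isHomogeneous k p)
      rw [homogeneousComponent_of_mem hm]
      split_ifs with hj
      · subst hj
        exact evalOn_mul_mem_lowFun (homogeneousComponent_mem _ _) (h k)
      · simp
    rw [smul_eq_mul, ← sum_homogeneousComponent r, ← sum_homogeneousComponent p,
      Finset.sum_mul_sum, map_sum, map_sum]
    refine Submodule.sum_mem _ fun i _ => ?_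
    rw [map_sum, map_sum]
    exact Submodule.sum_mem _ fun k _ => key i k

/-- Converse of `evalOn_homogeneousComponent_mem` for homogeneous polynomials: if `g` is a
polynomial of smaller degree that agrees with `p` on `Y`, then `p` is the top component of
`p - g`. -/
theorem mem_grIdeal_of_evalOn_mem {Y : Set (Fin d → ℂ)} {j : ℕ} {p : MvPolynomial (Fin d) ℂ}
    (hp : p ∈ homogeneousSubmodule (Fin d) ℂ j) (h : evalOn Y p ∈ lowFun Y j) :
    p ∈ grIdeal Y := by
  obtain ⟨g, hg, he⟩ := h
  by_cases hp0 : p = 0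
  · rw [hp0]; exact zero_mem _
  have hcomp : homogeneousComponent j (p - g) = p := by
    rw [map_sub, homogeneousComponent_of_mem hp, if_pos rfl, mem_lowDegree.1 hg j le_rfl, sub_zero]
  have hlow : p - g ∈ lowDegree d (j + 1) :=
    sub_mem (homogeneousSubmodule_le_lowDegree (Nat.lt_succ_self j) hp)
      (lowDegree_mono (Nat.le_succ j) hg)
  have hdeg : (p - g).totalDegree = j := by
    refine le_antisymm (mem_lowDegree_iff_totalDegree.1 hlow) ?_
    by_contra! hlt
    exact hp0 (hcomp ▸ homogeneousComponent_eq_zero j _ hlt)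
  refine Ideal.subset_span ⟨p - g, fun z hz => ?_, by rw [hdeg, hcomp]⟩
  have := congrFun he ⟨z, hz⟩
  simp only [evalOn_apply] at this
  rw [map_sub, this, sub_self]

/-- The graded pieces of the orbit harmonics ring measure the growth of the spaces of functions
on `Y` of bounded degree. -/
theorem finrank_orbPiece_add (Y : Set (Fin d → ℂ)) [Finite Y] (j : ℕ) :
    Module.finrank ℂ (orbPiece Y j) + Module.finrank ℂ (lowFun Y j) =
      Module.finrank ℂ (lowFun Y (j + 1)) := by
  set H := homogeneousSubmodule (Fin d) ℂ j
  have h1 := finrank_map_add_finrank_inf_ker (Ideal.Quotient.mkₐ ℂ (grIdeal Y)).toLinearMap H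
  have h2 := finrank_map_add_finrank_inf_ker ((lowFun Y j).mkQ ∘ₗ evalOn Y) H
  have hker : H ⊓ LinearMap.ker (Ideal.Quotient.mkₐ ℂ (grIdeal Y)).toLinearMap =
      H ⊓ LinearMap.ker ((lowFun Y j).mkQ ∘ₗ evalOn Y) := by
    ext p
    simp only [Submodule.mem_inf, LinearMap.mem_ker, LinearMap.comp_apply, Submodule.mkQ_apply,
      Submodule.Quotient.mk_eq_zero, AlgHom.toLinearMap_apply, Ideal.Quotient.mkₐ_eq_mk,
      Ideal.Quotient.eq_zero_iff_mem]
    refine and_congr_right fun hp => ⟨fun h => ?_, mem_grIdeal_of_evalOn_mem hp⟩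
    have := evalOn_homogeneousComponent_mem h j
    rwa [homogeneousComponent_of_mem hp, if_pos rfl] at this
  have h3 := finrank_map_add_finrank_inf_ker (lowFun Y j).mkQ (lowFun Y (j + 1))
  rw [Submodule.ker_mkQ, inf_eq_right.2 (lowFun_mono Y (Nat.le_succ j))] at h3
  have h4 : (lowFun Y (j + 1)).map (lowFun Y j).mkQ = H.map ((lowFun Y j).mkQ ∘ₗ evalOn Y) := by
    rw [Submodule.map_comp]
    rw [show lowFun Y (j + 1) = H.map (evalOn Y) ⊔ lowFun Y j by
      rw [lowFun, lowDegree_succ, Submodule.map_sup]; rfl, Submodule.map_sup, sup_eq_left]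
    rintro _ ⟨f, hf, rfl⟩
    rw [show (lowFun Y j).mkQ f = 0 from (Submodule.Quotient.mk_eq_zero _).2 hf]
    exact zero_mem _
  have h5 : orbPiece Y j = H.map (Ideal.Quotient.mkₐ ℂ (grIdeal Y)).toLinearMap := rfl
  rw [h4] at h3
  rw [hker] at h1
  rw [h5]
  linarith

theorem sum_finrank_orbPiece (Y : Set (Fin d → ℂ)) [Finite Y] (J : ℕ) :
    ∑ j ∈ Finset.range J, Module.finrank ℂ (orbPiece Y j) = Module.finrank ℂ (lowFun Y J) := by
  induction J with
  | zero => rw [lowFun, lowDegree_zero, Submodule.map_bot]; simp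
  | succ J ih => rw [Finset.sum_range_succ, ih, add_comm, finrank_orbPiece_add]

theorem sum_finrank_orbPiece_le (Y : Set (Fin d → ℂ)) [Finite Y] (J : ℕ) :
    ∑ j ∈ Finset.range J, Module.finrank ℂ (orbPiece Y j) ≤ Y.ncard := by
  have := Fintype.ofFinite Y
  rw [sum_finrank_orbPiece]
  refine (Submodule.finrank_le _).trans ?_
  rw [Module.finrank_fintype_fun_eq_card, ← Nat.card_eq_fintype_card, Nat.card_coe_set_eq]

/-- Every function on a finite set of points is the restriction of a polynomial. -/
theorem evalOn_surjective (Y : Set (Fin d → ℂ)) [Finite Y] : Function.Surjective (evalOn Y) := by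
  classical
  have := Fintype.ofFinite Y
  have hsep : ∀ y z : Y, y ≠ z → ∃ f : MvPolynomial (Fin d) ℂ,
      eval (y : Fin d → ℂ) f = 1 ∧ eval (z : Fin d → ℂ) f = 0 := by
    intro y z hyz
    obtain ⟨s, hs⟩ : ∃ s, (y : Fin d → ℂ) s ≠ (z : Fin d → ℂ) s := by
      by_contra! h
      exact hyz (Subtype.ext (funext h))
    refine ⟨C ((y : Fin d → ℂ) s - (z : Fin d → ℂ) s)⁻¹ * (X s - C ((z : Fin d → ℂ) s)), ?_, ?_⟩
    · simp [sub_ne_zero.2 hs]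
    · simp
  choose! f hf1 hf0 using hsep
  intro c
  refine ⟨∑ y, C (c y) * ∏ z ∈ Finset.univ.erase y, f y z, ?_⟩
  ext w
  rw [evalOn_apply, map_sum, Finset.sum_eq_single w]
  · rw [map_mul, eval_C, map_prod, Finset.prod_eq_one, mul_one]
    intro z hz
    exact hf1 w z (Finset.ne_of_mem_erase hz).symm
  · intro y _ hyw
    rw [map_mul, map_prod,
      Finset.prod_eq_zero (Finset.mem_erase.2 ⟨hyw.symm, Finset.mem_univ w⟩) (hf0 y w hyw),
      mul_zero]
  · simp

theorem exists_sum_finrank_orbPiece_eq (Y : Set (Fin d → ℂ)) [Finite Y] :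
    ∃ J₀, ∀ J, J₀ ≤ J →
      ∑ j ∈ Finset.range J, Module.finrank ℂ (orbPiece Y j) = Y.ncard := by
  classical
  have := Fintype.ofFinite Y
  choose g hg using fun y : Y => evalOn_surjective Y (Pi.single y 1)
  refine ⟨Finset.univ.sup (fun y => (g y).totalDegree) + 1, fun J hJ => ?_⟩
  have htop : lowFun Y J = ⊤ := by
    rw [eq_top_iff]
    intro c _
    have : c = ∑ y, c y • evalOn Y (g y) := by
      ext z
      simp [hg, Pi.single_apply]
    rw [this]
    refine Submodule.sum_mem _ fun y _ => Submodule.smul_mem _ _ ⟨g y, ?_, rfl⟩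
    exact lowDegree_mono hJ (mem_lowDegree_iff_totalDegree.2
      (Finset.le_sup (f := fun y => (g y).totalDegree) (Finset.mem_univ y)))
  rw [sum_finrank_orbPiece, htop, finrank_top, Module.finrank_fintype_fun_eq_card,
    ← Nat.card_eq_fintype_card, Nat.card_coe_set_eq]

end GradedEhrhart

namespace GradedEhrhart

open MvPolynomial

variable {d : ℕ}

/-! ### Linear forms, directional derivatives and least spaces -/

/-- The linear form `∑ v_s x_s` attached to a vector `v`. -/
noncomputable def linForm (d : ℕ) : (Fin d → ℂ) →ₗ[ℂ] MvPolynomial (Fin d) ℂ :=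
  ∑ s, (LinearMap.proj (R := ℂ) (φ := fun _ : Fin d => ℂ) s).smulRight (X s)

theorem linForm_apply (v : Fin d → ℂ) : linForm d v = ∑ s, v s • X s := by
  simp [linForm]

theorem linForm_single (s : Fin d) : linForm d (Pi.single s 1) = X s := by
  rw [linForm_apply, Finset.sum_eq_single s] <;> simp +contextual

theorem linForm_mem (v : Fin d → ℂ) : linForm d v ∈ homogeneousSubmodule (Fin d) ℂ 1 := by
  rw [linForm_apply]
  exact Submodule.sum_mem _ fun s _ => Submodule.smul_mem _ _ (isHomogeneous_X ℂ s)

theorem eval_linForm_comm (x v : Fin d → ℂ) : eval x (linForm d v) = eval v (linForm d x) := by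
  simp [linForm_apply, smul_eval, mul_comm]

theorem linForm_injective : Function.Injective (linForm d) := by
  intro v w h
  funext s
  have h' := eval_linForm_comm (Pi.single s 1) v
  have h'' := eval_linForm_comm (Pi.single s 1) w
  rw [linForm_single, eval_X] at h' h''
  rw [← h', ← h'', h]

/-- The derivation of the polynomial ring, viewed as the symmetric algebra of `ℂ^d`, that extends
the linear functional `η`. -/
noncomputable def dirDeriv (η : Module.Dual ℂ (Fin d → ℂ)) :
    Derivation ℂ (MvPolynomial (Fin d) ℂ) (MvPolynomial (Fin d) ℂ) :=
  mkDerivation ℂ fun s => C (η (Pi.single s 1))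

theorem dirDeriv_linForm (η : Module.Dual ℂ (Fin d → ℂ)) (v : Fin d → ℂ) :
    dirDeriv η (linForm d v) = C (η v) := by
  have hv : η v = ∑ s, v s * η (Pi.single s 1) := by
    conv_lhs => rw [pi_eq_sum_univ' v]
    simp
  rw [linForm_apply, map_sum, hv, map_sum]
  refine Finset.sum_congr rfl fun s _ => ?_
  rw [Derivation.map_smul, dirDeriv, mkDerivation_X, C_mul, C_mul']

/-- The divided power `ℓ(y)^n / n!` of a linear form. -/
noncomputable def divPow (y : Fin d → ℂ) (n : ℕ) : MvPolynomial (Fin d) ℂ :=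
  ((n.factorial : ℂ)⁻¹) • linForm d y ^ n

theorem divPow_zero (y : Fin d → ℂ) : divPow y 0 = 1 := by simp [divPow]

theorem divPow_mem (y : Fin d → ℂ) (n : ℕ) : divPow y n ∈ homogeneousSubmodule (Fin d) ℂ n := by
  refine Submodule.smul_mem _ _ ?_
  simpa using (IsHomogeneous.pow (linForm_mem y) n)

theorem dirDeriv_divPow_succ (η : Module.Dual ℂ (Fin d → ℂ)) (y : Fin d → ℂ) (n : ℕ) :
    dirDeriv η (divPow y (n + 1)) = η y • divPow y n := by
  rw [divPow, Derivation.map_smul, Derivation.leibniz_pow, dirDeriv_linForm, divPow,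
    Nat.add_sub_cancel, smul_eq_mul, mul_comm (linForm d y ^ n), ← smul_eq_C_mul,
    ← Nat.cast_smul_eq_nsmul ℂ, smul_smul, smul_smul, smul_smul]
  congr 1
  have h1 : ((n + 1 : ℕ) : ℂ) ≠ 0 := by exact_mod_cast Nat.succ_ne_zero n
  have h2 : (n.factorial : ℂ) ≠ 0 := by exact_mod_cast Nat.factorial_ne_zero n
  rw [Nat.factorial_succ, Nat.cast_mul]
  field_simp

section LeastSpace

variable (Y : Set (Fin d → ℂ)) [Fintype Y]

/-- The degree `n` term `∑ c_y ℓ(y)^n / n!` of the exponential sum `∑ c_y e^{ℓ(y)}`. -/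
noncomputable def expTerm (n : ℕ) : (Y → ℂ) →ₗ[ℂ] MvPolynomial (Fin d) ℂ :=
  ∑ y : Y, (LinearMap.proj (R := ℂ) (φ := fun _ : Y => ℂ) y).smulRight (divPow (y : Fin d → ℂ) n)

theorem expTerm_apply (n : ℕ) (c : Y → ℂ) :
    expTerm Y n c = ∑ y, c y • divPow (y : Fin d → ℂ) n := by
  simp [expTerm]

/-- The coefficient vectors whose exponential sum vanishes to order `j`. -/
noncomputable def vanishing (j : ℕ) : Submodule ℂ (Y → ℂ) :=
  ⨅ i, ⨅ (_ : i < j), LinearMap.ker (expTerm Y i)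

/-- The degree `j` part of the least space of exponentials with frequencies in `Y`: the
degree `j` initial terms of the exponential sums that vanish to order `j`. -/
noncomputable def leastSpace (j : ℕ) : Submodule ℂ (MvPolynomial (Fin d) ℂ) :=
  (vanishing Y j).map (expTerm Y j)

variable {Y}

theorem mem_vanishing {j : ℕ} {c : Y → ℂ} :
    c ∈ vanishing Y j ↔ ∀ i < j, ∑ y, c y • divPow (y : Fin d → ℂ) i = 0 := by
  simp [vanishing, expTerm_apply]

theorem vanishing_succ (j : ℕ) :
    vanishing Y (j + 1) = vanishing Y j ⊓ LinearMap.ker (expTerm Y j) := by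
  ext c
  rw [Submodule.mem_inf, mem_vanishing, mem_vanishing, LinearMap.mem_ker, expTerm_apply]
  refine ⟨fun h => ⟨fun i hi => h i (by omega), h j (by omega)⟩, fun h i hi => ?_⟩
  rcases Nat.lt_succ_iff_lt_or_eq.1 hi with hi | rfl
  exacts [h.1 i hi, h.2]

theorem leastSpace_le (j : ℕ) : leastSpace Y j ≤ homogeneousSubmodule (Fin d) ℂ j := by
  rintro _ ⟨c, -, rfl⟩
  rw [expTerm_apply]
  exact Submodule.sum_mem _ fun y _ => Submodule.smul_mem _ _ (divPow_mem _ _)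

/-- Applying a derivative to an exponential sum inserts a factor into its coefficients. -/
theorem sum_smul_divPow_eq_zero_of_succ (η : Module.Dual ℂ (Fin d → ℂ)) {c : Y → ℂ} {n : ℕ}
    (h : ∑ y, c y • divPow (y : Fin d → ℂ) (n + 1) = 0) :
    ∑ y, (c y * η y) • divPow (y : Fin d → ℂ) n = 0 := by
  have := congrArg (dirDeriv η) h
  rw [map_zero, map_sum] at this
  rw [← this]
  refine Finset.sum_congr rfl fun y _ => ?_
  rw [Derivation.map_smul, dirDeriv_divPow_succ, smul_smul]

theorem sum_monomial_smul_divPow_eq_zero {j : ℕ} {c : Y → ℂ} (hc : c ∈ vanishing Y j) (k : ℕ) :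
    ∀ (α : Fin d →₀ ℕ) (n : ℕ), α.degree = k → k + n < j →
      ∑ y : Y, (c y * eval (y : Fin d → ℂ) (monomial α 1)) • divPow (y : Fin d → ℂ) n = 0 := by
  induction k with
  | zero =>
    intro α n hα hn
    obtain rfl := (Finsupp.degree_eq_zero_iff α).1 hα
    simpa using mem_vanishing.1 hc n (by omega)
  | succ k ih =>
    intro α n hα hn
    have hα0 : α ≠ 0 := by rintro rfl; simp at hα
    obtain ⟨s, hs⟩ := Finsupp.ne_iff.1 hα0
    obtain ⟨β, rfl⟩ : ∃ β, α = β + Finsupp.single s 1 :=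
      ⟨α - Finsupp.single s 1, (tsub_add_cancel_of_le (by
        rw [Finsupp.single_le_iff]; exact Nat.one_le_iff_ne_zero.2 hs)).symm⟩
    rw [map_add, Finsupp.degree_single] at hα
    have := sum_smul_divPow_eq_zero_of_succ (LinearMap.proj s) (ih β (n + 1) (by omega) (by omega))
    rw [← this]
    refine Finset.sum_congr rfl fun y _ => ?_
    rw [monomial_add_single, map_mul, pow_one, eval_X, LinearMap.proj_apply, mul_assoc]

/-- An exponential sum vanishes to order `j` exactly when its coefficients are orthogonal to the
polynomials of degree less than `j`. -/
theorem mem_vanishing_iff {j : ℕ} {c : Y → ℂ} :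
    c ∈ vanishing Y j ↔ ∀ f ∈ lowDegree d j, ∑ y : Y, c y * eval (y : Fin d → ℂ) f = 0 := by
  constructor
  · intro hc f hf
    rw [show (fun y : Y => c y * eval (y : Fin d → ℂ) f) = fun y : Y =>
        ∑ α ∈ f.support, f.coeff α * (c y * eval (y : Fin d → ℂ) (monomial α 1)) from ?_,
      Finset.sum_comm]
    · refine Finset.sum_eq_zero fun α hα => ?_
      rw [← Finset.mul_sum]
      have hdeg : α.degree < j := by
        by_contra! hle
        have h0 := congrArg (coeff α) (mem_lowDegree.1 hf _ hle)
        rw [coeff_homogeneousComponent, if_pos rfl, coeff_zero] at h0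
        exact mem_support_iff.1 hα h0
      have := congrArg (eval 0) (sum_monomial_smul_divPow_eq_zero hc _ α 0 rfl (by omega))
      simp only [divPow_zero, map_sum, smul_eval, map_one, mul_one, map_zero] at this
      rw [this, mul_zero]
    · funext y
      conv_lhs => rw [f.as_sum]
      rw [map_sum, Finset.mul_sum]
      refine Finset.sum_congr rfl fun α _ => ?_
      rw [eval_monomial, eval_monomial]
      ring
  · intro h
    rw [mem_vanishing]
    intro i hi
    refine MvPolynomial.funext fun x => ?_
    rw [map_zero, ← h (divPow x i) (homogeneousSubmodule_le_lowDegree hi (divPow_mem x i)), map_sum]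
    refine Finset.sum_congr rfl fun y _ => ?_
    rw [smul_eval, divPow, divPow, smul_eval, smul_eval, map_pow, map_pow, eval_linForm_comm]

theorem finrank_vanishing_add (j : ℕ) :
    Module.finrank ℂ (vanishing Y j) + Module.finrank ℂ (lowFun Y j) = Fintype.card Y := by
  classical
  have h : vanishing Y j =
      (lowFun Y j).dualAnnihilator.comap (dotProductEquiv ℂ Y).toLinearMap := by
    ext c
    rw [mem_vanishing_iff, Submodule.mem_comap, Submodule.mem_dualAnnihilator]
    constructor
    · rintro h _ ⟨f, hf, rfl⟩
      simpa [dotProduct] using h f hf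
    · intro h f hf
      simpa [dotProduct] using h _ ⟨f, hf, rfl⟩
  have h' := Subspace.finrank_add_finrank_dualAnnihilator_eq (lowFun Y j)
  rw [Module.finrank_fintype_fun_eq_card] at h'
  rw [h, ← h', add_comm, Submodule.comap_equiv_eq_map_symm, LinearEquiv.finrank_map_eq]

/-- The least space is graded dual to the orbit harmonics ring. -/
theorem finrank_leastSpace (j : ℕ) :
    Module.finrank ℂ (leastSpace Y j) = Module.finrank ℂ (orbPiece Y j) := by
  have h1 := finrank_map_add_finrank_inf_ker (expTerm Y j) (vanishing Y j)
  rw [← vanishing_succ] at h1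
  have h2 := finrank_vanishing_add (Y := Y) j
  have h3 := finrank_vanishing_add (Y := Y) (j + 1)
  have h4 := finrank_orbPiece_add Y j
  rw [leastSpace]
  linarith

end LeastSpace

end GradedEhrhart

namespace GradedEhrhart

/-! ### Vector configurations: rank, contraction and unimodularity -/

section Configuration

variable {K V ι : Type*} [Field K] [AddCommGroup V] [Module K V]

/-- The rank of the subfamily of `v` indexed by `s`. -/
noncomputable def rankOf (K : Type*) {V ι : Type*} [Field K] [AddCommGroup V] [Module K V]
    (v : ι → V) (s : Finset ι) : ℕ :=
  Module.finrank K (Submodule.span K (v '' (s : Set ι)))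

instance finiteDimensional_span_image (v : ι → V) (s : Finset ι) :
    FiniteDimensional K (Submodule.span K (v '' (s : Set ι))) :=
  FiniteDimensional.span_of_finite K (s.finite_toSet.image v)

theorem rankOf_mono (v : ι → V) {s t : Finset ι} (h : s ⊆ t) : rankOf K v s ≤ rankOf K v t :=
  Submodule.finrank_mono (Submodule.span_mono (Set.image_mono (Finset.coe_subset.2 h)))

theorem rankOf_le_card (v : ι → V) (s : Finset ι) : rankOf K v s ≤ s.card := by
  classical
  have h := finrank_span_finset_le_card (R := K) (s.image v)
  rw [Set.finrank, Finset.coe_image] at h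
  exact h.trans Finset.card_image_le

theorem rankOf_empty (v : ι → V) : rankOf K v ∅ = 0 := by
  simp [rankOf]

theorem span_image_insert [DecidableEq ι] (v : ι → V) (e : ι) (s : Finset ι) :
    Submodule.span K (v '' (insert e s : Finset ι)) =
      Submodule.span K {v e} ⊔ Submodule.span K (v '' (s : Set ι)) := by
  rw [Finset.coe_insert, Set.image_insert_eq, Submodule.span_insert]

theorem rankOf_insert_of_mem [DecidableEq ι] (v : ι → V) {e : ι} {s : Finset ι}
    (h : v e ∈ Submodule.span K (v '' (s : Set ι))) : rankOf K v (insert e s) = rankOf K v s := by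
  rw [rankOf, rankOf, span_image_insert, sup_eq_right.2]
  rwa [Submodule.span_singleton_le_iff_mem]

/-- The projection `x ↦ x - φ(x) a` along `a`, for a functional `φ` with `φ(a) = 1`: a model of
the quotient by the line of `a` inside the same space. -/
noncomputable def contraction (φ : Module.Dual K V) (a : V) : V →ₗ[K] V :=
  LinearMap.id - φ.smulRight a

theorem contraction_apply (φ : Module.Dual K V) (a x : V) :
    contraction φ a x = x - φ x • a := by simp [contraction]

theorem contraction_self {φ : Module.Dual K V} {a : V} (h : φ a = 1) : contraction φ a a = 0 := by
  simp [contraction_apply, h]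

theorem ker_contraction {φ : Module.Dual K V} {a : V} (h : φ a = 1) :
    LinearMap.ker (contraction φ a) = Submodule.span K {a} := by
  ext x
  rw [LinearMap.mem_ker, contraction_apply, sub_eq_zero, Submodule.mem_span_singleton]
  refine ⟨fun hx => ⟨φ x, hx.symm⟩, ?_⟩
  rintro ⟨c, rfl⟩
  simp [h]

theorem map_span_insert_contraction [DecidableEq ι] (v : ι → V) {φ : Module.Dual K V} {e : ι}
    (h : φ (v e) = 1) (s : Finset ι) :
    (Submodule.span K (v '' (insert e s : Finset ι))).map (contraction φ (v e)) =
      Submodule.span K ((contraction φ (v e) ∘ v) '' (s : Set ι)) := by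
  rw [span_image_insert, Submodule.map_sup, Submodule.map_span, Submodule.map_span,
    Set.image_singleton, contraction_self h, Submodule.span_zero_singleton, bot_sup_eq,
    ← Set.image_comp]

theorem rankOf_insert_contraction [DecidableEq ι] (v : ι → V) {φ : Module.Dual K V} {e : ι}
    (h : φ (v e) = 1) (s : Finset ι) :
    rankOf K v (insert e s) = rankOf K (contraction φ (v e) ∘ v) s + 1 := by
  have h1 := finrank_map_add_finrank_inf_ker (contraction φ (v e))
    (Submodule.span K (v '' (insert e s : Finset ι)))
  rw [map_span_insert_contraction v h, ker_contraction h, inf_eq_right.2,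
    finrank_span_singleton] at h1
  · exact h1.symm
  · rintro h0
    simp [h0] at h
  · rw [Submodule.span_singleton_le_iff_mem]
    exact Submodule.subset_span ⟨e, by simp, rfl⟩

theorem rankOf_contraction_of_notMem (v : ι → V) {φ : Module.Dual K V} {e : ι} (h : φ (v e) = 1)
    {s t : Finset ι} (hs : v e ∉ Submodule.span K (v '' (s : Set ι))) (hts : t ⊆ s) :
    rankOf K (contraction φ (v e) ∘ v) t = rankOf K v t := by
  have h1 := finrank_map_add_finrank_inf_ker (contraction φ (v e))
    (Submodule.span K (v '' (t : Set ι)))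
  rw [ker_contraction h, Submodule.map_span, ← Set.image_comp] at h1
  have h2 : Submodule.span K (v '' (t : Set ι)) ⊓ Submodule.span K {v e} = ⊥ := by
    rw [← disjoint_iff, Submodule.disjoint_span_singleton' (by rintro h0; simp [h0] at h)]
    exact fun hmem => hs (Submodule.span_mono (Set.image_mono (Finset.coe_subset.2 hts)) hmem)
  rw [h2, finrank_bot, add_zero] at h1
  exact h1

/-- The functionals that take values in `{0, 1, -1}` on the configuration and integer values on
the lattice `Λ`. -/
def unimodularFunctionals (v : ι → V) (Λ : AddSubgroup V) : Set (Module.Dual K V) :=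
  {η | (∀ i, η (v i) = 0 ∨ η (v i) = 1 ∨ η (v i) = -1) ∧ ∀ x ∈ Λ, ∃ z : ℤ, η x = z}

/-- A configuration is unimodular with respect to `Λ` when every vector outside the span of a
subfamily is separated from it by a functional in `unimodularFunctionals`. This form of total
unimodularity is inherited by contractions without any change of coordinates. -/
def IsUnimodularConfig (K : Type*) {V ι : Type*} [Field K] [AddCommGroup V] [Module K V]
    (v : ι → V) (Λ : AddSubgroup V) : Prop :=
  ∀ (s : Finset ι) (e : ι), v e ∉ Submodule.span K (v '' (s : Set ι)) →
    ∃ η : Module.Dual K V, η ∈ unimodularFunctionals v Λ ∧ (∀ i ∈ s, η (v i) = 0) ∧ η (v e) = 1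

theorem IsUnimodularConfig.exists_of_ne_zero {v : ι → V} {Λ : AddSubgroup V}
    (h : IsUnimodularConfig K v Λ) {e : ι} (he : v e ≠ 0) :
    ∃ η : Module.Dual K V, η ∈ unimodularFunctionals v Λ ∧ η (v e) = 1 := by
  obtain ⟨η, h1, -, h2⟩ := h ∅ e (by simpa using he)
  exact ⟨η, h1, h2⟩

/-- A functional that vanishes on `v e` does not see the difference between a vector and its
contraction, so the functionals that separate `v f` from the subfamily `insert e s` also serve for
the contraction. -/
theorem IsUnimodularConfig.contraction [DecidableEq ι] {v : ι → V} {Λ : AddSubgroup V}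
    (h : IsUnimodularConfig K v Λ) {φ : Module.Dual K V} {e : ι} (he : φ (v e) = 1) :
    IsUnimodularConfig K (contraction φ (v e) ∘ v)
      (Λ.map (contraction φ (v e)).toAddMonoidHom) := by
  intro s f hf
  have hf' : v f ∉ Submodule.span K (v '' (insert e s : Finset ι)) := by
    intro hmem
    refine hf ?_
    rw [← map_span_insert_contraction v he]
    exact Submodule.mem_map_of_mem hmem
  obtain ⟨η, ⟨hη1, hη2⟩, hη3, hη4⟩ := h _ _ hf'
  have hp : ∀ x, η (GradedEhrhart.contraction φ (v e) x) = η x := by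
    intro x
    rw [contraction_apply, map_sub, map_smul, hη3 e (by simp), smul_zero, sub_zero]
  refine ⟨η, ⟨fun i => ?_, ?_⟩, fun i hi => ?_, ?_⟩
  · rw [Function.comp_apply, hp]; exact hη1 i
  · rintro _ ⟨x, hx, rfl⟩
    obtain ⟨z, hz⟩ := hη2 x hx
    exact ⟨z, (hp x).trans hz⟩
  · rw [Function.comp_apply, hp]; exact hη3 i (Finset.mem_insert_of_mem hi)
  · rw [Function.comp_apply, hp]; exact hη4

end Configuration

/-! ### The counting polynomials -/

section Polynomials

open Polynomial

variable {ι : Type*}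

/-- The polynomial `[m] = 1 + X + ⋯ + X^(m-1)`. -/
noncomputable def qNat (m : ℕ) : ℤ[X] := ∑ i ∈ Finset.range m, X ^ i

theorem qNat_succ' (m : ℕ) : qNat (m + 1) = X * qNat m + 1 := by
  rw [qNat, qNat, Finset.sum_range_succ', Finset.mul_sum, pow_zero]
  simp_rw [pow_succ']

theorem qNat_succ (m : ℕ) : qNat (m + 1) = qNat m + X ^ m := by
  rw [qNat, qNat, Finset.sum_range_succ]

theorem qNat_mul (m : ℕ) : qNat m * (1 - X) = 1 - X ^ m := by
  rw [qNat, ← neg_sub X 1, mul_neg, geom_sum_mul, neg_sub]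

/-- The corank-nullity sum whose value is the graded lattice point count of the `m`-th dilate of
a zonotope with rank function `r`. -/
noncomputable def extPoly (m : ℕ) (r : Finset ι → ℕ) (s : Finset ι) : ℤ[X] :=
  ∑ S ∈ s.powerset, X ^ (m * (s.card - S.card)) * qNat m ^ S.card * (1 - X) ^ (S.card - r S)

/-- The corank-nullity sum whose value is `X ^ r(s)` times the graded interior lattice point
count of the `m`-th dilate of a zonotope with rank function `r`. -/
noncomputable def intPoly (m : ℕ) (r : Finset ι → ℕ) (s : Finset ι) : ℤ[X] :=
  ∑ S ∈ s.powerset, (-1) ^ (r s - r S) * X ^ r S * X ^ (m * (s.card - S.card)) *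
    qNat m ^ S.card * (1 - X) ^ (S.card - r S)

theorem extPoly_empty (m : ℕ) (r : Finset ι → ℕ) : extPoly m r ∅ = 1 := by
  simp [extPoly]

theorem intPoly_empty (m : ℕ) {r : Finset ι → ℕ} (h : r ∅ = 0) : intPoly m r ∅ = 1 := by
  simp [intPoly, h]

variable {s : Finset ι} {e : ι} {r r' : Finset ι → ℕ} (m : ℕ)

theorem extPoly_congr (h : ∀ S ⊆ s, r S = r' S) : extPoly m r s = extPoly m r' s :=
  Finset.sum_congr rfl fun S hS => by rw [h S (Finset.mem_powerset.1 hS)]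

theorem intPoly_congr (h : ∀ S ⊆ s, r S = r' S) : intPoly m r s = intPoly m r' s :=
  Finset.sum_congr rfl fun S hS => by rw [h S (Finset.mem_powerset.1 hS), h s subset_rfl]

/-- Deletion and contraction of an element `e` that is not a loop; `r'` is the rank function of the
contraction. -/
theorem extPoly_insert [DecidableEq ι] (he : e ∉ s) (h : ∀ S ⊆ s, r (insert e S) = r' S + 1) :
    extPoly m r (insert e s) = X ^ m * extPoly m r s + qNat m * extPoly m r' s := by
  rw [extPoly, Finset.sum_powerset_insert he, extPoly, extPoly, Finset.mul_sum, Finset.mul_sum]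
  refine congrArg₂ (· + ·) (Finset.sum_congr rfl fun S hS => ?_)
    (Finset.sum_congr rfl fun S hS => ?_) <;> rw [Finset.mem_powerset] at hS <;>
    have hc := Finset.card_le_card hS
  · rw [Finset.card_insert_of_notMem he, show m * (s.card + 1 - S.card) =
      m + m * (s.card - S.card) by rw [Nat.sub_add_comm hc]; ring, pow_add]
    ring
  · rw [Finset.card_insert_of_notMem he, Finset.card_insert_of_notMem (fun h => he (hS h)), h S hS,
      Nat.add_sub_add_right, Nat.add_sub_add_right]
    ring

/-- A loop multiplies the sum by `X ^ m + [m] (1 - X) = 1`. -/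
theorem extPoly_insert_loop [DecidableEq ι] (he : e ∉ s) (h : ∀ S ⊆ s, r (insert e S) = r S)
    (hr : ∀ S ⊆ s, r S ≤ S.card) : extPoly m r (insert e s) = extPoly m r s := by
  have key : extPoly m r (insert e s) = (X ^ m + qNat m * (1 - X)) * extPoly m r s := by
    rw [add_mul, extPoly, Finset.sum_powerset_insert he, extPoly, Finset.mul_sum, Finset.mul_sum]
    refine congrArg₂ (· + ·) (Finset.sum_congr rfl fun S hS => ?_)
      (Finset.sum_congr rfl fun S hS => ?_) <;> rw [Finset.mem_powerset] at hS <;>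
      have hc := Finset.card_le_card hS
    · rw [Finset.card_insert_of_notMem he, show m * (s.card + 1 - S.card) =
        m + m * (s.card - S.card) by rw [Nat.sub_add_comm hc]; ring, pow_add]
      ring
    · rw [Finset.card_insert_of_notMem he, Finset.card_insert_of_notMem (fun h => he (hS h)),
        h S hS,
        Nat.add_sub_add_right, Nat.sub_add_comm (hr S hS)]
      ring
  rw [key, qNat_mul, add_sub_cancel, one_mul]

/-- Deletion and contraction of an element `e` that is neither a loop nor a coloop; `r'` is the rank
function of the contraction. -/
theorem intPoly_insert [DecidableEq ι] (he : e ∉ s) (hs : r (insert e s) = r s)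
    (h : ∀ S ⊆ s, r (insert e S) = r' S + 1) :
    intPoly m r (insert e s) = X ^ m * intPoly m r s + X * qNat m * intPoly m r' s := by
  rw [intPoly, Finset.sum_powerset_insert he, intPoly, intPoly, Finset.mul_sum, Finset.mul_sum]
  refine congrArg₂ (· + ·) (Finset.sum_congr rfl fun S hS => ?_)
    (Finset.sum_congr rfl fun S hS => ?_) <;> rw [Finset.mem_powerset] at hS <;>
    have hc := Finset.card_le_card hS
  · rw [hs, Finset.card_insert_of_notMem he, show m * (s.card + 1 - S.card) =
      m + m * (s.card - S.card) by rw [Nat.sub_add_comm hc]; ring, pow_add]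
    ring
  · rw [Finset.card_insert_of_notMem he, Finset.card_insert_of_notMem (fun h => he (hS h)), h S hS,
      h s subset_rfl, Nat.add_sub_add_right, Nat.add_sub_add_right, Nat.add_sub_add_right]
    ring

theorem intPoly_insert_loop [DecidableEq ι] (he : e ∉ s) (h : ∀ S ⊆ s, r (insert e S) = r S)
    (hr : ∀ S ⊆ s, r S ≤ S.card) : intPoly m r (insert e s) = intPoly m r s := by
  have key : intPoly m r (insert e s) = (X ^ m + qNat m * (1 - X)) * intPoly m r s := by
    rw [add_mul, intPoly, Finset.sum_powerset_insert he, intPoly, Finset.mul_sum, Finset.mul_sum]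
    refine congrArg₂ (· + ·) (Finset.sum_congr rfl fun S hS => ?_)
      (Finset.sum_congr rfl fun S hS => ?_) <;> rw [Finset.mem_powerset] at hS <;>
      have hc := Finset.card_le_card hS
    · rw [h s subset_rfl, Finset.card_insert_of_notMem he, show m * (s.card + 1 - S.card) =
        m + m * (s.card - S.card) by rw [Nat.sub_add_comm hc]; ring, pow_add]
      ring
    · rw [Finset.card_insert_of_notMem he, Finset.card_insert_of_notMem (fun h => he (hS h)),
        h S hS,
        h s subset_rfl, Nat.add_sub_add_right, Nat.sub_add_comm (hr S hS)]
      ring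
  rw [key, qNat_mul, add_sub_cancel, one_mul]

/-- A coloop multiplies the sum by `X ([m + 1] - X ^ m) = X [m]`. -/
theorem intPoly_insert_coloop [DecidableEq ι] (he : e ∉ s) (h : ∀ S ⊆ s, r (insert e S) = r S + 1)
    (hr : ∀ S ⊆ s, r S ≤ r s) :
    intPoly (m + 1) r (insert e s) = X * qNat m * intPoly (m + 1) r s := by
  have key : intPoly (m + 1) r (insert e s) =
      -X ^ (m + 1) * intPoly (m + 1) r s + X * qNat (m + 1) * intPoly (m + 1) r s := by
    rw [intPoly, Finset.sum_powerset_insert he, intPoly, Finset.mul_sum, Finset.mul_sum]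
    refine congrArg₂ (· + ·) (Finset.sum_congr rfl fun S hS => ?_)
      (Finset.sum_congr rfl fun S hS => ?_) <;> rw [Finset.mem_powerset] at hS <;>
      have hc := Finset.card_le_card hS
    · rw [h s subset_rfl, Nat.sub_add_comm (hr S hS), Finset.card_insert_of_notMem he,
        show (m + 1) * (s.card + 1 - S.card) =
          (m + 1) + (m + 1) * (s.card - S.card) by rw [Nat.sub_add_comm hc]; ring,
        pow_add X (m + 1)]
      ring
    · rw [Finset.card_insert_of_notMem he, Finset.card_insert_of_notMem (fun h => he (hS h)),
        h S hS,
        h s subset_rfl, Nat.add_sub_add_right, Nat.add_sub_add_right, Nat.add_sub_add_right]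
      ring
  rw [key, qNat_succ]
  ring

end Polynomials

end GradedEhrhart

namespace GradedEhrhart

open MvPolynomial

variable {d : ℕ} {ι : Type*}

/-! ### The lower bound: products of linear forms in the least space -/

/-- The endomorphism of the polynomial ring, viewed as the symmetric algebra of `ℂ^d`, induced by
a linear endomorphism `p` of `ℂ^d`. -/
noncomputable def symMap (p : (Fin d → ℂ) →ₗ[ℂ] (Fin d → ℂ)) :
    MvPolynomial (Fin d) ℂ →ₐ[ℂ] MvPolynomial (Fin d) ℂ :=
  aeval fun s => linForm d (p (Pi.single s 1))

theorem symMap_linForm (p : (Fin d → ℂ) →ₗ[ℂ] (Fin d → ℂ)) (v : Fin d → ℂ) :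
    symMap p (linForm d v) = linForm d (p v) := by
  conv_rhs => rw [pi_eq_sum_univ' v]
  rw [linForm_apply, map_sum, map_sum, map_sum]
  refine Finset.sum_congr rfl fun s _ => ?_
  rw [map_smul, map_smul, map_smul, symMap, aeval_X]

/-- Given a sequence of subspaces `W`, the sequence `j ↦ W_j + a W_{j-1}`. -/
noncomputable def mulShift (a : MvPolynomial (Fin d) ℂ)
    (W : ℕ → Submodule ℂ (MvPolynomial (Fin d) ℂ)) : ℕ → Submodule ℂ (MvPolynomial (Fin d) ℂ)
  | 0 => W 0
  | j + 1 => W (j + 1) ⊔ (W j).map (LinearMap.mulLeft ℂ a)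

theorem finiteDimensional_mulShift (a : MvPolynomial (Fin d) ℂ)
    {W : ℕ → Submodule ℂ (MvPolynomial (Fin d) ℂ)} (hW : ∀ j, FiniteDimensional ℂ (W j)) (j : ℕ) :
    FiniteDimensional ℂ (mulShift a W j) := by
  cases j with
  | zero => exact hW 0
  | succ j =>
    have := hW j
    have := hW (j + 1)
    exact inferInstanceAs (FiniteDimensional ℂ (W (j + 1) ⊔ (W j).map (LinearMap.mulLeft ℂ a) :
      Submodule ℂ (MvPolynomial (Fin d) ℂ)))

theorem map_mulShift {a : MvPolynomial (Fin d) ℂ} (W : ℕ → Submodule ℂ (MvPolynomial (Fin d) ℂ))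
    {π : MvPolynomial (Fin d) ℂ →ₐ[ℂ] MvPolynomial (Fin d) ℂ} (hπ : π a = 0) (j : ℕ) :
    (mulShift a W j).map π.toLinearMap = (W j).map π.toLinearMap := by
  cases j with
  | zero => rfl
  | succ j =>
    rw [mulShift, Submodule.map_sup, sup_eq_left]
    rintro _ ⟨_, ⟨w, -, rfl⟩, rfl⟩
    simp [hπ]

/-- Multiplication by `a` embeds `W_{j-1}` into the kernel of `π` on `W_j + a W_{j-1}`. -/
theorem coeff_le_finrank_mulShift {a : MvPolynomial (Fin d) ℂ} (ha : a ≠ 0)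
    {W : ℕ → Submodule ℂ (MvPolynomial (Fin d) ℂ)} (hW : ∀ j, FiniteDimensional ℂ (W j))
    {π : MvPolynomial (Fin d) ℂ →ₐ[ℂ] MvPolynomial (Fin d) ℂ} (hπ : π a = 0)
    {f g : Polynomial ℤ} (hf : ∀ j, f.coeff j ≤ Module.finrank ℂ (W j))
    (hg : ∀ j, g.coeff j ≤ Module.finrank ℂ ((W j).map π.toLinearMap)) (j : ℕ) :
    (Polynomial.X * f + g).coeff j ≤ (Module.finrank ℂ (mulShift a W j) : ℤ) := by
  have hfin := finiteDimensional_mulShift a hW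
  have key := finrank_map_add_finrank_inf_ker π.toLinearMap (mulShift a W j)
  rw [map_mulShift W hπ] at key
  rw [Polynomial.coeff_add]
  cases j with
  | zero =>
    have := hg 0
    rw [Polynomial.coeff_X_mul_zero]
    push_cast [← key]
    omega
  | succ j =>
    have h1 := hg (j + 1)
    have h2 := hf j
    have h3 : Module.finrank ℂ (W j) ≤ Module.finrank ℂ
        (mulShift a W (j + 1) ⊓ LinearMap.ker π.toLinearMap :
          Submodule ℂ (MvPolynomial (Fin d) ℂ)) := by
      have hinj : Function.Injective (LinearMap.mulLeft ℂ a) :=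
        fun x y hxy => mul_left_cancel₀ ha hxy
      rw [(Submodule.equivMapOfInjective _ hinj (W j)).finrank_eq]
      refine Submodule.finrank_mono (le_inf le_sup_right ?_)
      rintro _ ⟨w, -, rfl⟩
      simp [hπ]
    rw [Polynomial.coeff_X_mul]
    push_cast [← key]
    have h3' : (Module.finrank ℂ (W j) : ℤ) ≤ Module.finrank ℂ
        (mulShift a W (j + 1) ⊓ LinearMap.ker π.toLinearMap :
          Submodule ℂ (MvPolynomial (Fin d) ℂ)) := by exact_mod_cast h3
    linarith

/-- The iterated form of `coeff_le_finrank_mulShift`: adding `k` copies of the factor `a` turns the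
lower bounds `f` and `g` into `X ^ k * f + [k] * g`. -/
theorem coeff_le_finrank_iterate_mulShift {a : MvPolynomial (Fin d) ℂ} (ha : a ≠ 0)
    {W : ℕ → Submodule ℂ (MvPolynomial (Fin d) ℂ)} (hW : ∀ j, FiniteDimensional ℂ (W j))
    {π : MvPolynomial (Fin d) ℂ →ₐ[ℂ] MvPolynomial (Fin d) ℂ} (hπ : π a = 0)
    {f g : Polynomial ℤ} (hf : ∀ j, f.coeff j ≤ Module.finrank ℂ (W j))
    (hg : ∀ j, g.coeff j ≤ Module.finrank ℂ ((W j).map π.toLinearMap)) (k : ℕ) :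
    (∀ j, FiniteDimensional ℂ ((mulShift a)^[k] W j)) ∧
    (∀ j, ((mulShift a)^[k] W j).map π.toLinearMap = (W j).map π.toLinearMap) ∧
    ∀ j, (Polynomial.X ^ k * f + qNat k * g).coeff j ≤
      (Module.finrank ℂ ((mulShift a)^[k] W j) : ℤ) := by
  induction k with
  | zero =>
    refine ⟨hW, fun j => rfl, fun j => ?_⟩
    rw [pow_zero, one_mul, qNat, Finset.range_zero, Finset.sum_empty, zero_mul, add_zero]
    exact hf j
  | succ k ih =>
    obtain ⟨h1, h2, h3⟩ := ih
    rw [Function.iterate_succ_apply']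
    refine ⟨finiteDimensional_mulShift a h1, fun j => (map_mulShift _ hπ j).trans (h2 j),
      fun j => ?_⟩
    have := coeff_le_finrank_mulShift ha h1 hπ h3 (fun j => (hg j).trans_eq (by rw [h2])) j
    rwa [show Polynomial.X ^ (k + 1) * f + qNat (k + 1) * g =
      Polynomial.X * (Polynomial.X ^ k * f + qNat k * g) + g by rw [qNat_succ']; ring]

theorem iterate_mulShift_le {a : MvPolynomial (Fin d) ℂ} {k : ℕ}
    {T : ℕ → Submodule ℂ (MvPolynomial (Fin d) ℂ)} :
    ∀ {W : ℕ → Submodule ℂ (MvPolynomial (Fin d) ℂ)},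
      (∀ i ≤ k, ∀ l, ∀ w ∈ W l, a ^ i * w ∈ T (i + l)) → ∀ j, (mulShift a)^[k] W j ≤ T j := by
  induction k with
  | zero => intro W h j w hw; simpa using h 0 le_rfl j w hw
  | succ k ih =>
    intro W h
    rw [Function.iterate_succ_apply]
    refine ih fun i hi l w hw => ?_
    cases l with
    | zero => exact h i (by omega) 0 w hw
    | succ l =>
      obtain ⟨x, hx, _, ⟨y, hy, rfl⟩, rfl⟩ := Submodule.mem_sup.1 hw
      rw [mul_add]
      refine add_mem (h i (by omega) _ x hx) ?_
      have := h (i + 1) (by omega) l y hy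
      rw [LinearMap.mulLeft_apply, ← mul_assoc, ← pow_succ]
      rwa [show i + (l + 1) = i + 1 + l by ring]

/-- The span of the products `∏ ℓ(v_i)^{k_i}` of degree `j` with all exponents at most `m`. -/
noncomputable def prodSpace (m : ℕ) (v : ι → Fin d → ℂ) (s : Finset ι) (j : ℕ) :
    Submodule ℂ (MvPolynomial (Fin d) ℂ) :=
  Submodule.span ℂ {p | ∃ k : ι → ℕ, (∀ i ∈ s, k i ≤ m) ∧ ∑ i ∈ s, k i = j ∧
    p = ∏ i ∈ s, linForm d (v i) ^ k i}

theorem prodSpace_le (m : ℕ) (v : ι → Fin d → ℂ) (s : Finset ι) (j : ℕ) :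
    prodSpace m v s j ≤ homogeneousSubmodule (Fin d) ℂ j := by
  rw [prodSpace, Submodule.span_le]
  rintro _ ⟨k, -, rfl, rfl⟩
  refine IsHomogeneous.prod s _ _ fun i _ => ?_
  simpa using IsHomogeneous.pow (linForm_mem (v i)) (k i)

theorem map_prodSpace (m : ℕ) (v : ι → Fin d → ℂ) (s : Finset ι) (j : ℕ)
    (p : (Fin d → ℂ) →ₗ[ℂ] (Fin d → ℂ)) :
    (prodSpace m v s j).map (symMap p).toLinearMap = prodSpace m (p ∘ v) s j := by
  rw [prodSpace, prodSpace, Submodule.map_span]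
  congr 1
  ext f
  constructor
  · rintro ⟨_, ⟨k, hk, hj, rfl⟩, rfl⟩
    exact ⟨k, hk, hj, by simp [map_prod, symMap_linForm]⟩
  · rintro ⟨k, hk, hj, rfl⟩
    exact ⟨_, ⟨k, hk, hj, rfl⟩, by simp [map_prod, symMap_linForm]⟩

theorem pow_mul_mem_prodSpace_insert [DecidableEq ι] {m : ℕ} {v : ι → Fin d → ℂ} {s : Finset ι}
    {e : ι} (he : e ∉ s) {i : ℕ} (hi : i ≤ m) (l : ℕ) (w : MvPolynomial (Fin d) ℂ)
    (hw : w ∈ prodSpace m v s l) :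
    linForm d (v e) ^ i * w ∈ prodSpace m v (insert e s) (i + l) := by
  have : prodSpace m v s l ≤ (prodSpace m v (insert e s) (i + l)).comap
      (LinearMap.mulLeft ℂ (linForm d (v e) ^ i)) := by
    rw [prodSpace, Submodule.span_le]
    rintro _ ⟨k, hk, rfl, rfl⟩
    have hne : ∀ x ∈ s, Function.update k e i x = k x := fun x hx =>
      Function.update_of_ne (by rintro rfl; exact he hx) _ _
    refine Submodule.subset_span ⟨Function.update k e i, fun x hx => ?_, ?_, ?_⟩
    · rcases Finset.mem_insert.1 hx with rfl | hx
      · simpa using hi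
      · rw [hne x hx]; exact hk x hx
    · rw [Finset.sum_insert he, Function.update_self, Finset.sum_congr rfl hne]
    · rw [Finset.prod_insert he, Function.update_self, LinearMap.mulLeft_apply]
      congr 1
      exact Finset.prod_congr rfl fun x hx => by rw [hne x hx]
  exact this hw

theorem exists_dual_apply_eq_one {K : Type*} [Field K] {v : Fin d → K} (hv : v ≠ 0) :
    ∃ φ : Module.Dual K (Fin d → K), φ v = 1 := by
  obtain ⟨s, hs⟩ := Function.ne_iff.1 hv
  exact ⟨(v s)⁻¹ • LinearMap.proj s, by simpa using inv_mul_cancel₀ hs⟩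

/-- The dimensions of the spaces of products dominate the corank-nullity polynomial, by deletion
and contraction. -/
theorem coeff_extPoly_le_finrank_prodSpace [DecidableEq ι] (m : ℕ) (s : Finset ι) :
    ∀ (v : ι → Fin d → ℂ) (j : ℕ),
      (extPoly m (rankOf ℂ v) s).coeff j ≤ Module.finrank ℂ (prodSpace m v s j) := by
  have hfin : ∀ (v : ι → Fin d → ℂ) (s : Finset ι) (j : ℕ),
      FiniteDimensional ℂ (prodSpace m v s j) :=
    fun v s j => Submodule.finiteDimensional_of_le (prodSpace_le m v s j)
  induction s using Finset.induction_on with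
  | empty =>
    intro v j
    rw [extPoly_empty, Polynomial.coeff_one]
    split_ifs with hj
    · subst hj
      have h1 : (1 : MvPolynomial (Fin d) ℂ) ∈ prodSpace m v ∅ 0 :=
        Submodule.subset_span ⟨0, by simp, by simp, by simp⟩
      have := hfin v ∅ 0
      have : Nontrivial (prodSpace m v ∅ 0) :=
        ⟨⟨1, h1⟩, 0, fun h => one_ne_zero (congrArg Subtype.val h)⟩
      exact_mod_cast Module.finrank_pos (R := ℂ) (M := prodSpace m v ∅ 0)
    · positivity
  | insert e s he ih =>
    intro v j
    by_cases hv : v e = 0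
    · rw [extPoly_insert_loop m he (fun S _ => rankOf_insert_of_mem v (by simp [hv]))
        fun S _ => rankOf_le_card v S]
      refine (ih v j).trans ?_
      have := hfin v (insert e s) j
      have hle : prodSpace m v s j ≤ prodSpace m v (insert e s) j := fun w hw => by
        simpa using pow_mul_mem_prodSpace_insert he (Nat.zero_le m) j w hw
      exact_mod_cast Submodule.finrank_mono hle
    · obtain ⟨φ, hφ⟩ := exists_dual_apply_eq_one hv
      rw [extPoly_insert m he fun S _ => rankOf_insert_contraction v hφ S]
      have ha : linForm d (v e) ≠ 0 := by
        rw [← map_zero (linForm d)]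
        exact linForm_injective.ne hv
      obtain ⟨h1, -, h3⟩ := coeff_le_finrank_iterate_mulShift ha (hfin v s)
        (π := symMap (contraction φ (v e)))
        (by rw [symMap_linForm, contraction_self hφ, map_zero]) (ih v)
        (fun j => (ih (contraction φ (v e) ∘ v) j).trans_eq (by rw [map_prodSpace])) m
      refine (h3 j).trans ?_
      have := hfin v (insert e s) j
      exact_mod_cast Submodule.finrank_mono (iterate_mulShift_le
        (fun i hi l w hw => pow_mul_mem_prodSpace_insert he hi l w hw) j)

/-- The formal exponential `e^{t ℓ(y)}`, as a power series in `t`. -/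
noncomputable def formalExp (y : Fin d → ℂ) : PowerSeries (MvPolynomial (Fin d) ℂ) :=
  PowerSeries.rescale (linForm d y) (PowerSeries.exp (MvPolynomial (Fin d) ℂ))

theorem coeff_formalExp (y : Fin d → ℂ) (n : ℕ) :
    PowerSeries.coeff n (formalExp y) = divPow y n := by
  rw [formalExp, PowerSeries.coeff_rescale, PowerSeries.coeff_exp, divPow, one_div,
    IsScalarTower.algebraMap_apply ℚ ℂ (MvPolynomial (Fin d) ℂ), mul_comm, ← Algebra.smul_def]
  simp

theorem formalExp_zero : formalExp (0 : Fin d → ℂ) = 1 := by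
  ext n : 1
  rw [coeff_formalExp, PowerSeries.coeff_one, divPow, map_zero]
  split_ifs with h
  · simp [h]
  · simp [h]

theorem formalExp_add (x y : Fin d → ℂ) : formalExp (x + y) = formalExp x * formalExp y := by
  rw [formalExp, map_add, ← PowerSeries.exp_mul_exp_eq_exp_add]
  rfl

theorem formalExp_nsmul (n : ℕ) (x : Fin d → ℂ) : formalExp (n • x) = formalExp x ^ n := by
  induction n with
  | zero => simp [formalExp_zero]
  | succ n ih => rw [succ_nsmul, formalExp_add, ih, pow_succ]

theorem prod_formalExp_sub_one_mem_span (v : ι → Fin d → ℂ) (k : ι → ℕ) (s : Finset ι) :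
    ∏ i ∈ s, (formalExp (v i) - 1) ^ k i ∈ Submodule.span ℂ
      {f | ∃ t : ι → ℕ, (∀ i, t i ≤ k i) ∧ f = formalExp (∑ i ∈ s, t i • v i)} := by
  classical
  induction s using Finset.induction_on with
  | empty =>
    exact Submodule.subset_span ⟨0, by simp, by simp [formalExp_zero]⟩
  | insert e s he ih =>
    rw [Finset.prod_insert he, sub_eq_add_neg, add_pow, Finset.sum_mul]
    refine Submodule.sum_mem _ fun n hn => ?_
    have hn' : n ≤ k e := Nat.lt_succ_iff.1 (Finset.mem_range.1 hn)
    rw [show formalExp (v e) ^ n * (-1) ^ (k e - n) * ((k e).choose n : PowerSeries _) *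
        ∏ i ∈ s, (formalExp (v i) - 1) ^ k i =
        ((-1) ^ (k e - n) * ((k e).choose n : ℂ)) • (formalExp (n • v e) *
          ∏ i ∈ s, (formalExp (v i) - 1) ^ k i) by
      rw [formalExp_nsmul, Algebra.smul_def]
      simp only [map_mul, map_pow, map_neg, map_one, map_natCast]
      ring]
    refine Submodule.smul_mem _ _ ?_
    have hle : Submodule.span ℂ
        {f | ∃ t : ι → ℕ, (∀ i, t i ≤ k i) ∧ f = formalExp (∑ i ∈ s, t i • v i)} ≤
        (Submodule.span ℂ {f | ∃ t : ι → ℕ, (∀ i, t i ≤ k i) ∧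
          f = formalExp (∑ i ∈ insert e s, t i • v i)}).comap
          (LinearMap.mulLeft ℂ (formalExp (n • v e))) := by
      rw [Submodule.span_le]
      rintro _ ⟨t, ht, rfl⟩
      refine Submodule.subset_span ⟨Function.update t e n, fun i => ?_, ?_⟩
      · rcases eq_or_ne i e with rfl | hi
        · simpa using hn'
        · rw [Function.update_of_ne hi]; exact ht i
      · rw [Finset.sum_insert he, Function.update_self, LinearMap.mulLeft_apply, formalExp_add]
        congr 2
        refine Finset.sum_congr rfl fun i hi => ?_
        rw [Function.update_of_ne (by rintro rfl; exact he hi)]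
    exact hle ih

/-- The product of the factors `e^{t ℓ(v_i)} - 1` is an exponential sum with frequencies in `Y`
whose initial term is the corresponding product of linear forms. -/
theorem prodSpace_le_leastSpace {Y : Set (Fin d → ℂ)} [Fintype Y] {m : ℕ} {v : ι → Fin d → ℂ}
    {s : Finset ι} (hY : ∀ t : ι → ℕ, (∀ i ∈ s, t i ≤ m) → ∑ i ∈ s, t i • v i ∈ Y) (j : ℕ) :
    prodSpace m v s j ≤ leastSpace Y j := by
  rw [prodSpace, Submodule.span_le]
  rintro _ ⟨k, hk, rfl, rfl⟩
  have hmem := prod_formalExp_sub_one_mem_span v k s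
  have hle : Submodule.span ℂ
      {f | ∃ t : ι → ℕ, (∀ i, t i ≤ k i) ∧ f = formalExp (∑ i ∈ s, t i • v i)} ≤
      Submodule.span ℂ (Set.range fun y : Y => formalExp (y : Fin d → ℂ)) := by
    refine Submodule.span_mono ?_
    rintro _ ⟨t, ht, rfl⟩
    exact ⟨⟨_, hY t fun i hi => (ht i).trans (hk i hi)⟩, rfl⟩
  obtain ⟨c, hc⟩ := (Submodule.mem_span_range_iff_exists_fun ℂ).1 (hle hmem)
  have hcoeff : ∀ n, PowerSeries.coeff n (∏ i ∈ s, (formalExp (v i) - 1) ^ k i) =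
      expTerm Y n c := by
    intro n
    rw [← hc, map_sum, expTerm_apply]
    refine Finset.sum_congr rfl fun y _ => ?_
    rw [← coeff_formalExp]
    rfl
  have hU : ∀ i, ∃ U : PowerSeries (MvPolynomial (Fin d) ℂ),
      formalExp (v i) - 1 = PowerSeries.X * U ∧ PowerSeries.constantCoeff U = linForm d (v i) := by
    intro i
    obtain ⟨U, hU⟩ := PowerSeries.X_dvd_iff.2 (show
      PowerSeries.constantCoeff (formalExp (v i) - 1) = 0 by
        rw [map_sub, ← PowerSeries.coeff_zero_eq_constantCoeff_apply, coeff_formalExp, divPow_zero]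
        simp)
    refine ⟨U, hU, ?_⟩
    have h1 := congrArg (PowerSeries.coeff 1) hU
    rw [map_sub, coeff_formalExp, PowerSeries.coeff_one, if_neg one_ne_zero, sub_zero,
      ← zero_add 1, PowerSeries.coeff_succ_X_mul,
      PowerSeries.coeff_zero_eq_constantCoeff_apply] at h1
    rw [← h1]
    simp [divPow]
  choose U hU1 hU2 using hU
  have hprod : ∏ i ∈ s, (formalExp (v i) - 1) ^ k i =
      PowerSeries.X ^ (∑ i ∈ s, k i) * ∏ i ∈ s, U i ^ k i := by
    rw [← Finset.prod_pow_eq_pow_sum, ← Finset.prod_mul_distrib]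
    exact Finset.prod_congr rfl fun i _ => by rw [hU1, mul_pow]
  refine ⟨c, ?_, ?_⟩
  · refine mem_vanishing.2 fun i hi => ?_
    rw [← expTerm_apply, ← hcoeff, hprod, PowerSeries.coeff_X_pow_mul', if_neg (by omega)]
  · rw [← hcoeff, hprod, PowerSeries.coeff_X_pow_mul', if_pos le_rfl, Nat.sub_self,
      PowerSeries.coeff_zero_eq_constantCoeff_apply, map_prod]
    exact Finset.prod_congr rfl fun i _ => by rw [map_pow, hU2]

end GradedEhrhart

namespace GradedEhrhart

open MvPolynomial

variable {d : ℕ} {ι : Type*}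

/-! ### The upper bound: power ideals and their inverse systems -/

theorem dirDeriv_X (η : Module.Dual ℂ (Fin d → ℂ)) (s : Fin d) :
    dirDeriv η (X s) = C (η (Pi.single s 1)) := mkDerivation_X ..

theorem sum_derivation_apply (D : Fin d → Derivation ℂ (MvPolynomial (Fin d) ℂ)
    (MvPolynomial (Fin d) ℂ)) (f : MvPolynomial (Fin d) ℂ) : (∑ s, D s) f = ∑ s, D s f := by
  have := congrFun (map_sum (Derivation.coeFnAddMonoidHom (R := ℂ) (A := MvPolynomial (Fin d) ℂ)
    (M := MvPolynomial (Fin d) ℂ)) D Finset.univ) f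
  rw [Finset.sum_apply] at this
  exact this

theorem dirDeriv_eq_sum (η : Module.Dual ℂ (Fin d → ℂ)) (f : MvPolynomial (Fin d) ℂ) :
    dirDeriv η f = ∑ s, η (Pi.single s 1) • pderiv s f := by
  have h : dirDeriv η = ∑ s, η (Pi.single s 1) • pderiv (R := ℂ) s := by
    refine derivation_ext fun t => ?_
    rw [dirDeriv_X, sum_derivation_apply, Finset.sum_eq_single t]
    · simp [smul_eq_C_mul]
    · intro s _ hs
      simp [pderiv_X_of_ne hs.symm]
    · simp
  rw [h, sum_derivation_apply]
  rfl

theorem dirDeriv_proj (s : Fin d) (f : MvPolynomial (Fin d) ℂ) :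
    dirDeriv (LinearMap.proj s) f = pderiv s f := by
  rw [dirDeriv_eq_sum, Finset.sum_eq_single s]
  · simp
  · intro t _ ht
    simp [ht.symm]
  · simp

theorem dirDeriv_mem {j : ℕ} (η : Module.Dual ℂ (Fin d → ℂ)) {f : MvPolynomial (Fin d) ℂ}
    (hf : f ∈ homogeneousSubmodule (Fin d) ℂ j) :
    dirDeriv η f ∈ homogeneousSubmodule (Fin d) ℂ (j - 1) := by
  rw [dirDeriv_eq_sum]
  exact Submodule.sum_mem _ fun s _ => Submodule.smul_mem _ _ (IsHomogeneous.pderiv hf)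

/-- The `k`-th power of the operator `dirDeriv η`. -/
noncomputable def dirDerivPow (η : Module.Dual ℂ (Fin d → ℂ)) (k : ℕ) :
    MvPolynomial (Fin d) ℂ →ₗ[ℂ] MvPolynomial (Fin d) ℂ :=
  (dirDeriv η : MvPolynomial (Fin d) ℂ →ₗ[ℂ] MvPolynomial (Fin d) ℂ) ^ k

theorem dirDerivPow_zero (η : Module.Dual ℂ (Fin d → ℂ)) (f : MvPolynomial (Fin d) ℂ) :
    dirDerivPow η 0 f = f := by simp [dirDerivPow]

theorem dirDerivPow_one (η : Module.Dual ℂ (Fin d → ℂ)) (f : MvPolynomial (Fin d) ℂ) :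
    dirDerivPow η 1 f = dirDeriv η f := by simp [dirDerivPow]

theorem dirDerivPow_succ (η : Module.Dual ℂ (Fin d → ℂ)) (k : ℕ) (f : MvPolynomial (Fin d) ℂ) :
    dirDerivPow η (k + 1) f = dirDeriv η (dirDerivPow η k f) := by
  rw [dirDerivPow, pow_succ']
  rfl

theorem dirDerivPow_mem {j : ℕ} (η : Module.Dual ℂ (Fin d → ℂ)) {f : MvPolynomial (Fin d) ℂ}
    (hf : f ∈ homogeneousSubmodule (Fin d) ℂ j) (k : ℕ) :
    dirDerivPow η k f ∈ homogeneousSubmodule (Fin d) ℂ (j - k) := by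
  induction k with
  | zero => rwa [dirDerivPow_zero]
  | succ k ih =>
    rw [dirDerivPow_succ, ← Nat.sub_sub]
    exact dirDeriv_mem η ih

theorem dirDerivPow_eq_zero_of_lt {j : ℕ} (η : Module.Dual ℂ (Fin d → ℂ))
    {f : MvPolynomial (Fin d) ℂ} (hf : f ∈ homogeneousSubmodule (Fin d) ℂ j) {k : ℕ} (hk : j < k) :
    dirDerivPow η k f = 0 := by
  obtain ⟨k, rfl⟩ := Nat.exists_eq_succ_of_ne_zero (Nat.ne_zero_of_lt hk)
  have h := dirDerivPow_mem η hf k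
  rw [Nat.sub_eq_zero_of_le (by omega), homogeneousSubmodule_zero, Submodule.mem_one] at h
  obtain ⟨c, hc⟩ := h
  rw [Nat.succ_eq_add_one, dirDerivPow_succ, ← hc, Derivation.map_algebraMap]

/-- The powers of `dirDeriv η` on a product with a linear form. -/
theorem dirDerivPow_succ_linForm_mul (η : Module.Dual ℂ (Fin d → ℂ)) (a : Fin d → ℂ)
    (f : MvPolynomial (Fin d) ℂ) (k : ℕ) :
    dirDerivPow η (k + 1) (linForm d a * f) =
      linForm d a * dirDerivPow η (k + 1) f + C ((k + 1) * η a) * dirDerivPow η k f := by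
  induction k with
  | zero =>
    rw [zero_add, dirDerivPow_one, dirDerivPow_one, dirDerivPow_zero, Derivation.leibniz,
      dirDeriv_linForm, smul_eq_mul, smul_eq_mul]
    simp [mul_comm]
  | succ k ih =>
    rw [dirDerivPow_succ, ih, map_add, Derivation.leibniz, Derivation.leibniz, dirDeriv_linForm,
      dirDerivPow_succ η (k + 1), ← dirDerivPow_succ η k]
    rw [← algebraMap_eq, Derivation.map_algebraMap]
    simp only [algebraMap_eq, smul_eq_mul, C_mul, C_add, C_1, map_natCast, Nat.cast_add,
      Nat.cast_one]
    ring

theorem dirDerivPow_linForm_mul_of_eq_zero {η : Module.Dual ℂ (Fin d → ℂ)} {a : Fin d → ℂ}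
    (ha : η a = 0) (f : MvPolynomial (Fin d) ℂ) (k : ℕ) :
    dirDerivPow η k (linForm d a * f) = linForm d a * dirDerivPow η k f := by
  cases k with
  | zero => simp [dirDerivPow_zero]
  | succ k => simp [dirDerivPow_succ_linForm_mul, ha]

/-- If `η(a) ≠ 0`, then a power of `dirDeriv η` that kills `a f` kills `f` with one factor fewer. -/
theorem dirDerivPow_eq_zero_of_linForm_mul {η : Module.Dual ℂ (Fin d → ℂ)} {a : Fin d → ℂ}
    (ha : η a ≠ 0) {f : MvPolynomial (Fin d) ℂ} {j k : ℕ}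
    (hf : f ∈ homogeneousSubmodule (Fin d) ℂ j)
    (h : dirDerivPow η (k + 1) (linForm d a * f) = 0) : dirDerivPow η k f = 0 := by
  have hall : ∀ n, dirDerivPow η (k + n + 1) (linForm d a * f) = 0 := by
    intro n
    induction n with
    | zero => exact h
    | succ n ih => rw [← add_assoc, dirDerivPow_succ, ih, map_zero]
  -- descending induction from a power that kills `f` for degree reasons
  have hdesc : ∀ i, dirDerivPow η (k + (j + 1 - i)) f = 0 := by
    intro i
    induction i with
    | zero => exact dirDerivPow_eq_zero_of_lt η hf (by omega)
    | succ i ih =>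
      rcases Nat.lt_or_ge i (j + 1) with hi | hi
      · have h1 := hall (j + 1 - (i + 1))
        rw [dirDerivPow_succ_linForm_mul,
          show k + (j + 1 - (i + 1)) + 1 = k + (j + 1 - i) by omega, ih, mul_zero, zero_add] at h1
        refine (mul_eq_zero.1 h1).resolve_left ?_
        exact (map_ne_zero_iff C (C_injective _ _)).2
          (mul_ne_zero (Nat.cast_add_one_ne_zero _) ha)
      · rwa [show j + 1 - (i + 1) = j + 1 - i by omega]
  simpa using hdesc (j + 1)

theorem dirDeriv_symMap (η : Module.Dual ℂ (Fin d → ℂ)) (p : (Fin d → ℂ) →ₗ[ℂ] (Fin d → ℂ))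
    (f : MvPolynomial (Fin d) ℂ) :
    dirDeriv η (symMap p f) = symMap p (dirDeriv (η ∘ₗ p) f) := by
  induction f using MvPolynomial.induction_on with
  | C a => simp [← algebraMap_eq]
  | add f g hf hg => rw [map_add, map_add, hf, hg, map_add, map_add]
  | mul_X f s hf =>
    rw [map_mul, Derivation.leibniz, Derivation.leibniz, hf, map_add, smul_eq_mul, smul_eq_mul,
      smul_eq_mul, smul_eq_mul, map_mul, map_mul, dirDeriv_X, ← linForm_single, symMap_linForm,
      dirDeriv_linForm]
    simp [← algebraMap_eq]

theorem dirDerivPow_symMap (η : Module.Dual ℂ (Fin d → ℂ)) (p : (Fin d → ℂ) →ₗ[ℂ] (Fin d → ℂ))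
    (f : MvPolynomial (Fin d) ℂ) (k : ℕ) :
    dirDerivPow η k (symMap p f) = symMap p (dirDerivPow (η ∘ₗ p) k f) := by
  induction k with
  | zero => simp [dirDerivPow_zero]
  | succ k ih => rw [dirDerivPow_succ, ih, dirDeriv_symMap, dirDerivPow_succ]

theorem symMap_mem {j : ℕ} (p : (Fin d → ℂ) →ₗ[ℂ] (Fin d → ℂ)) {f : MvPolynomial (Fin d) ℂ}
    (hf : f ∈ homogeneousSubmodule (Fin d) ℂ j) :
    symMap p f ∈ homogeneousSubmodule (Fin d) ℂ j := by
  have := IsHomogeneous.aeval (n := 1) hf (fun s => linForm d (p (Pi.single s 1)))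
    fun s => linForm_mem _
  rwa [one_mul] at this

theorem linForm_dvd_of_symMap_eq_zero {φ : Module.Dual ℂ (Fin d → ℂ)} {a : Fin d → ℂ}
    {f : MvPolynomial (Fin d) ℂ} (hf : symMap (contraction φ a) f = 0) : linForm d a ∣ f := by
  have h : (Ideal.Quotient.mkₐ ℂ (Ideal.span {linForm d a})).comp (symMap (contraction φ a)) =
      Ideal.Quotient.mkₐ ℂ (Ideal.span {linForm d a}) := by
    refine algHom_ext fun s => ?_
    rw [AlgHom.comp_apply, ← linForm_single, symMap_linForm, contraction_apply, map_sub, map_smul,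
      map_sub, map_smul, sub_eq_self, Ideal.Quotient.mkₐ_eq_mk,
      Ideal.Quotient.eq_zero_iff_mem.2 (Ideal.mem_span_singleton_self _), smul_zero]
  have h' := DFunLike.congr_fun h f
  rw [AlgHom.comp_apply, hf, map_zero] at h'
  exact Ideal.mem_span_singleton.1 (Ideal.Quotient.eq_zero_iff_mem.1 h'.symm)

/-- A homogeneous multiple of a linear form has a homogeneous cofactor. -/
theorem exists_homogeneous_of_linForm_dvd {a : Fin d → ℂ} {f : MvPolynomial (Fin d) ℂ} {j : ℕ}
    (hf : f ∈ homogeneousSubmodule (Fin d) ℂ j) (h : linForm d a ∣ f) :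
    f = 0 ∨ ∃ i, j = i + 1 ∧ ∃ g ∈ homogeneousSubmodule (Fin d) ℂ i, f = linForm d a * g := by
  obtain ⟨g, rfl⟩ := h
  have hcomp : ∀ i, linForm d a * homogeneousComponent i g ∈
      homogeneousSubmodule (Fin d) ℂ (i + 1) := fun i => by
    rw [add_comm]
    exact IsHomogeneous.mul (linForm_mem a) (homogeneousComponent_isHomogeneous i g)
  have hsum : linForm d a * g = ∑ i ∈ Finset.range (g.totalDegree + 1),
      if i + 1 = j then linForm d a * homogeneousComponent i g else 0 := by
    rw [← homogeneousComponent_eq_self hf]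
    conv_lhs => rw [← sum_homogeneousComponent g, Finset.mul_sum, map_sum]
    refine Finset.sum_congr rfl fun i _ => ?_
    rw [homogeneousComponent_of_mem (hcomp i)]
    simp [eq_comm]
  cases j with
  | zero => left; rw [hsum]; simp
  | succ i =>
    right
    refine ⟨i, rfl, homogeneousComponent i g, homogeneousComponent_mem _ _, ?_⟩
    rw [hsum]
    simp only [Nat.add_right_cancel_iff]
    rw [Finset.sum_ite_eq']
    split_ifs with h
    · rfl
    · rw [homogeneousComponent_eq_zero, mul_zero]
      simpa [Nat.lt_succ_iff] using h

/-- The polynomials of degree `j` killed by the powers `(dirDeriv η) ^ k` for `(η, k)` in `T`: the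
inverse system of the ideal generated by the powers `η ^ k`. -/
noncomputable def powKer (T : Set (Module.Dual ℂ (Fin d → ℂ) × ℕ)) (j : ℕ) :
    Submodule ℂ (MvPolynomial (Fin d) ℂ) :=
  homogeneousSubmodule (Fin d) ℂ j ⊓ ⨅ t ∈ T, LinearMap.ker (dirDerivPow t.1 t.2)

theorem mem_powKer {T : Set (Module.Dual ℂ (Fin d → ℂ) × ℕ)} {j : ℕ}
    {f : MvPolynomial (Fin d) ℂ} :
    f ∈ powKer T j ↔ f ∈ homogeneousSubmodule (Fin d) ℂ j ∧ ∀ t ∈ T, dirDerivPow t.1 t.2 f = 0 := by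
  simp [powKer]

theorem powKer_anti {T T' : Set (Module.Dual ℂ (Fin d → ℂ) × ℕ)} (h : T ⊆ T') (j : ℕ) :
    powKer T' j ≤ powKer T j := by
  intro f hf
  rw [mem_powKer] at *
  exact ⟨hf.1, fun t ht => hf.2 t (h ht)⟩

instance finiteDimensional_powKer (T : Set (Module.Dual ℂ (Fin d → ℂ) × ℕ)) (j : ℕ) :
    FiniteDimensional ℂ (powKer T j) :=
  Submodule.finiteDimensional_of_le (inf_le_left : _ ≤ homogeneousSubmodule (Fin d) ℂ j)

/-- Deletion of one copy of the vector `a` and contraction of `a` bound an inverse system: the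
multiples of `a` come from the deletion `T'`, the others are seen in the contraction `T''`. -/
theorem finrank_powKer_le_coeff {T T' T'' : Set (Module.Dual ℂ (Fin d → ℂ) × ℕ)}
    {φ : Module.Dual ℂ (Fin d → ℂ)} {a : Fin d → ℂ} (hφ : φ a = 1)
    (h' : ∀ η k, (η, k) ∈ T' → (η a = 0 ∧ (η, k) ∈ T) ∨ (η a ≠ 0 ∧ (η, k + 1) ∈ T))
    (h'' : ∀ η k, (η, k) ∈ T'' → (η ∘ₗ contraction φ a, k) ∈ T)
    {f g : Polynomial ℤ} (hf : ∀ j, (Module.finrank ℂ (powKer T' j) : ℤ) ≤ f.coeff j)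
    (hg : ∀ j, (Module.finrank ℂ (powKer T'' j) : ℤ) ≤ g.coeff j) (j : ℕ) :
    (Module.finrank ℂ (powKer T j) : ℤ) ≤ (Polynomial.X * f + g).coeff j := by
  have ha : linForm d a ≠ 0 := by
    rw [← map_zero (linForm d)]
    refine linForm_injective.ne ?_
    rintro rfl
    simp at hφ
  set π := (symMap (contraction φ a)).toLinearMap with hπ
  have key := finrank_map_add_finrank_inf_ker π (powKer T j)
  have h1 : Module.finrank ℂ ((powKer T j).map π) ≤ Module.finrank ℂ (powKer T'' j) := by
    refine Submodule.finrank_mono ?_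
    rintro _ ⟨p, hp, rfl⟩
    obtain ⟨hp1, hp2⟩ := mem_powKer.1 hp
    refine mem_powKer.2 ⟨symMap_mem _ hp1, fun t ht => ?_⟩
    rw [hπ, AlgHom.toLinearMap_apply, dirDerivPow_symMap, hp2 _ (h'' t.1 t.2 ht), map_zero]
  have hdiv : ∀ p ∈ powKer T j ⊓ LinearMap.ker π, p = 0 ∨ ∃ i, j = i + 1 ∧
      ∃ u ∈ powKer T' i, p = linForm d a * u := by
    rintro p ⟨hp, hp0⟩
    obtain ⟨hp1, hp2⟩ := mem_powKer.1 hp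
    rcases exists_homogeneous_of_linForm_dvd hp1 (linForm_dvd_of_symMap_eq_zero hp0) with
      h0 | ⟨i, rfl, u, hu, rfl⟩
    · exact Or.inl h0
    · refine Or.inr ⟨i, rfl, u, mem_powKer.2 ⟨hu, fun t ht => ?_⟩, rfl⟩
      rcases h' t.1 t.2 ht with ⟨h0, hT⟩ | ⟨h0, hT⟩
      · have := hp2 _ hT
        rw [dirDerivPow_linForm_mul_of_eq_zero h0] at this
        exact (mul_eq_zero.1 this).resolve_left ha
      · exact dirDerivPow_eq_zero_of_linForm_mul h0 hu (hp2 _ hT)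
  have h2 : (Module.finrank ℂ (powKer T j ⊓ LinearMap.ker π :
      Submodule ℂ (MvPolynomial (Fin d) ℂ)) : ℤ) ≤ (Polynomial.X * f).coeff j := by
    cases j with
    | zero =>
      have : powKer T 0 ⊓ LinearMap.ker π = ⊥ := by
        rw [eq_bot_iff]
        intro p hp
        rcases hdiv p hp with h0 | ⟨i, hi, -⟩
        · exact h0
        · omega
      rw [this, Polynomial.coeff_X_mul_zero]
      simp
    | succ j =>
      rw [Polynomial.coeff_X_mul]
      refine le_trans ?_ (hf j)
      have hle : powKer T (j + 1) ⊓ LinearMap.ker π ≤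
          (powKer T' j).map (LinearMap.mulLeft ℂ (linForm d a)) := by
        intro p hp
        rcases hdiv p hp with rfl | ⟨i, hi, u, hu, rfl⟩
        · exact zero_mem _
        · obtain rfl : j = i := by omega
          exact ⟨u, hu, rfl⟩
      exact_mod_cast (Submodule.finrank_mono hle).trans (Submodule.finrank_map_le _ _)
  rw [Polynomial.coeff_add]
  have h3 := hg j
  have h1' : (Module.finrank ℂ ((powKer T j).map π) : ℤ) ≤ Module.finrank ℂ (powKer T'' j) := by
    exact_mod_cast h1
  have key' : (Module.finrank ℂ ((powKer T j).map π) : ℤ) + Module.finrank ℂ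
    (powKer T j ⊓ LinearMap.ker π : Submodule ℂ (MvPolynomial (Fin d) ℂ)) =
      Module.finrank ℂ (powKer T j) := by exact_mod_cast key
  linarith

/-- The number of vectors of the subfamily `s`, each counted `m` times, on which `η` does not
vanish. -/
noncomputable def weight (m : ℕ) (v : ι → Fin d → ℂ) (s : Finset ι)
    (η : Module.Dual ℂ (Fin d → ℂ)) : ℕ := ∑ i ∈ s, if η (v i) = 0 then 0 else m

/-- The exponents for the internal power ideal of the subfamily `s`, with every vector of `s`
counted `m` times and one more vector `a` counted `k` times. The functionals that vanish on all
these vectors confine the inverse system to the symmetric algebra of their span. The exponent of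
`η` is one less than the number of vectors, with multiplicity, on which `η` does not vanish; when
there are none, `η` imposes no condition of the first kind. -/
def internalExponents (m : ℕ) (v : ι → Fin d → ℂ) (Λ : AddSubgroup (Fin d → ℂ)) (s : Finset ι)
    (a : Fin d → ℂ) (k : ℕ) : Set (Module.Dual ℂ (Fin d → ℂ) × ℕ) :=
  {t | (t.1 ∈ unimodularFunctionals v Λ ∧
      t.2 + 1 = (if t.1 a = 0 then 0 else k) + weight m v s t.1) ∨
    (t.2 = 1 ∧ t.1 a = 0 ∧ ∀ i ∈ s, t.1 (v i) = 0)}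

theorem internalExponents_zero_subset (m : ℕ) (v : ι → Fin d → ℂ) (Λ : AddSubgroup (Fin d → ℂ))
    (s : Finset ι) {a : Fin d → ℂ} (ha : a ∈ Submodule.span ℂ (v '' (s : Set ι))) :
    internalExponents m v Λ s 0 0 ⊆ internalExponents m v Λ s a 0 := by
  rintro ⟨η, k⟩ (⟨h1, h2⟩ | ⟨h1, h2, h3⟩)
  · exact Or.inl ⟨h1, by simpa using h2⟩
  · refine Or.inr ⟨h1, ?_, h3⟩
    have : Submodule.span ℂ (v '' (s : Set ι)) ≤ LinearMap.ker η := by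
      rw [Submodule.span_le]
      rintro _ ⟨i, hi, rfl⟩
      exact h3 i hi
    exact this ha

theorem internalExponents_insert [DecidableEq ι] (m : ℕ) (v : ι → Fin d → ℂ)
    (Λ : AddSubgroup (Fin d → ℂ)) {s : Finset ι} {e : ι} (he : e ∉ s) :
    internalExponents m v Λ s (v e) m ⊆ internalExponents m v Λ (insert e s) 0 0 := by
  rintro ⟨η, k⟩ (⟨h1, h2⟩ | ⟨h1, h2, h3⟩)
  · refine Or.inl ⟨h1, ?_⟩
    rw [weight, Finset.sum_insert he, if_pos (map_zero _), zero_add]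
    exact h2
  · exact Or.inr ⟨h1, map_zero η, by simpa using ⟨h2, h3⟩⟩

/-- One step of deletion and contraction, for one of the `k + 1` copies of the vector `v e`. -/
theorem finrank_powKer_internalExponents_succ {m : ℕ} {v : ι → Fin d → ℂ}
    {Λ : AddSubgroup (Fin d → ℂ)} {s : Finset ι} {e : ι} {φ : Module.Dual ℂ (Fin d → ℂ)}
    (hφ : φ (v e) = 1) {k : ℕ} {f g : Polynomial ℤ}
    (hf : ∀ j, (Module.finrank ℂ (powKer (internalExponents m v Λ s (v e) k) j) : ℤ) ≤ f.coeff j)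
    (hg : ∀ j, (Module.finrank ℂ (powKer (internalExponents m (contraction φ (v e) ∘ v)
      (Λ.map (contraction φ (v e)).toAddMonoidHom) s 0 0) j) : ℤ) ≤ g.coeff j) (j : ℕ) :
    (Module.finrank ℂ (powKer (internalExponents m v Λ s (v e) (k + 1)) j) : ℤ) ≤
      (Polynomial.X * f + g).coeff j := by
  refine finrank_powKer_le_coeff hφ ?_ ?_ hf hg j
  · rintro η k' (⟨h1, h2⟩ | ⟨h1, h2, h3⟩)
    · by_cases h0 : η (v e) = 0
      · exact Or.inl ⟨h0, Or.inl ⟨h1, by simpa [h0] using h2⟩⟩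
      · refine Or.inr ⟨h0, Or.inl ⟨h1, ?_⟩⟩
        simp only [h0, if_false] at h2 ⊢
        omega
    · exact Or.inl ⟨h2, Or.inr ⟨h1, h2, h3⟩⟩
  · have h0 : ∀ η : Module.Dual ℂ (Fin d → ℂ), (η ∘ₗ contraction φ (v e)) (v e) = 0 := fun η => by
      rw [LinearMap.comp_apply, contraction_self hφ, map_zero]
    rintro η k' (⟨⟨h1, h1'⟩, h2⟩ | ⟨h1, h2, h3⟩)
    · refine Or.inl ⟨⟨h1, fun x hx => h1' _ ⟨x, hx, rfl⟩⟩, ?_⟩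
      rw [if_pos (map_zero _)] at h2
      rw [if_pos (h0 η)]
      exact h2
    · exact Or.inr ⟨h1, h0 η, h3⟩

theorem finrank_powKer_empty (m : ℕ) (v : ι → Fin d → ℂ) (Λ : AddSubgroup (Fin d → ℂ)) (j : ℕ) :
    (Module.finrank ℂ (powKer (internalExponents m v Λ ∅ 0 0) j) : ℤ) ≤
      (1 : Polynomial ℤ).coeff j := by
  rw [Polynomial.coeff_one]
  split_ifs with hj
  · subst hj
    have h1 : powKer (internalExponents m v Λ ∅ 0 0) 0 ≤ Submodule.span ℂ {1} := by
      rw [← Submodule.one_eq_span, ← homogeneousSubmodule_zero]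
      exact inf_le_left
    exact_mod_cast (Submodule.finrank_mono h1).trans (finrank_span_singleton one_ne_zero).le
  · have h1 : powKer (internalExponents m v Λ ∅ 0 0) j = ⊥ := by
      rw [eq_bot_iff]
      intro f hf
      obtain ⟨hf1, hf2⟩ := mem_powKer.1 hf
      -- Euler's identity
      have h := IsHomogeneous.sum_X_mul_pderiv hf1
      rw [Finset.sum_eq_zero] at h
      · rw [← Nat.cast_smul_eq_nsmul ℂ] at h
        exact (smul_eq_zero.1 h.symm).resolve_left (by exact_mod_cast hj)
      · intro s _
        have := hf2 (LinearMap.proj s, 1) (Or.inr ⟨rfl, by simp, by simp⟩)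
        rw [dirDerivPow_one, dirDeriv_proj] at this
        rw [this, mul_zero]
    rw [h1]
    simp

/-- The dimensions of the internal inverse systems are bounded by the interior corank-nullity
polynomial, by deletion and contraction. -/
theorem exists_finrank_powKer_le [DecidableEq ι] (m : ℕ) (s : Finset ι) :
    ∀ (v : ι → Fin d → ℂ) (Λ : AddSubgroup (Fin d → ℂ)), IsUnimodularConfig ℂ v Λ →
      ∃ g : Polynomial ℤ,
        Polynomial.X ^ rankOf ℂ v s * g = intPoly (m + 1) (rankOf ℂ v) s ∧
        ∀ j, (Module.finrank ℂ (powKer (internalExponents (m + 1) v Λ s 0 0) j) : ℤ) ≤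
          g.coeff j := by
  induction s using Finset.induction_on with
  | empty =>
    intro v Λ _
    exact ⟨1, by rw [intPoly_empty _ (rankOf_empty v), rankOf_empty]; simp,
      finrank_powKer_empty _ v Λ⟩
  | insert e s he ih =>
    intro v Λ hv
    have hins : ∀ j, (Module.finrank ℂ (powKer (internalExponents (m + 1) v Λ (insert e s) 0 0) j)
        : ℤ) ≤ Module.finrank ℂ (powKer (internalExponents (m + 1) v Λ s (v e) (m + 1)) j) :=
      fun j => by
        exact_mod_cast Submodule.finrank_mono (powKer_anti (internalExponents_insert _ v Λ he) j)
    by_cases h0 : v e = 0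
    · obtain ⟨g, hg1, hg2⟩ := ih v Λ hv
      have hloop : ∀ S ⊆ s, rankOf ℂ v (insert e S) = rankOf ℂ v S :=
        fun S _ => rankOf_insert_of_mem v (by simp [h0])
      refine ⟨g, ?_, fun j => (hins j).trans (le_trans ?_ (hg2 j))⟩
      · rw [intPoly_insert_loop _ he hloop fun S _ => rankOf_le_card v S, hloop s subset_rfl, hg1]
      · refine Int.ofNat_le.2 (Submodule.finrank_mono (powKer_anti ?_ j))
        rw [h0]
        rintro ⟨η, k⟩ (⟨h1, h2⟩ | h)
        · exact Or.inl ⟨h1, by simpa using h2⟩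
        · exact Or.inr h
    obtain ⟨φ, -, hφ⟩ := hv.exists_of_ne_zero h0
    have hr := rankOf_insert_contraction v hφ
    obtain ⟨g', hg1', hg2'⟩ := ih _ _ (hv.contraction hφ)
    by_cases hmem : v e ∈ Submodule.span ℂ (v '' (s : Set ι))
    · obtain ⟨g, hg1, hg2⟩ := ih v Λ hv
      have hrs := rankOf_insert_of_mem v hmem
      refine ⟨Polynomial.X ^ (m + 1) * g + qNat (m + 1) * g', ?_, fun j => (hins j).trans ?_⟩
      · rw [intPoly_insert _ he hrs fun S _ => hr S, ← hg1, ← hg1', mul_add, ← hrs, hr s]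
        ring
      · have : ∀ k j, (Module.finrank ℂ (powKer (internalExponents (m + 1) v Λ s (v e) k) j) : ℤ) ≤
            (Polynomial.X ^ k * g + qNat k * g').coeff j := by
          intro k
          induction k with
          | zero =>
            intro j
            rw [pow_zero, one_mul, qNat, Finset.range_zero, Finset.sum_empty, zero_mul, add_zero]
            exact (Int.ofNat_le.2 (Submodule.finrank_mono
              (powKer_anti (internalExponents_zero_subset _ v Λ s hmem) j))).trans (hg2 j)
          | succ k ihk =>
            intro j
            rw [show Polynomial.X ^ (k + 1) * g + qNat (k + 1) * g' =
              Polynomial.X * (Polynomial.X ^ k * g + qNat k * g') + g' by rw [qNat_succ']; ring]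
            exact finrank_powKer_internalExponents_succ hφ ihk hg2' j
        exact this (m + 1) j
    · refine ⟨qNat m * g', ?_, fun j => (hins j).trans ?_⟩
      · have hc : ∀ S ⊆ s, rankOf ℂ (contraction φ (v e) ∘ v) S = rankOf ℂ v S :=
          fun S hS => rankOf_contraction_of_notMem v hφ hmem hS
        rw [intPoly_insert_coloop m he (fun S hS => by rw [hr, hc S hS])
          (fun S hS => rankOf_mono v hS), ← intPoly_congr _ hc, ← hg1', hr]
        ring
      · have : ∀ k j,
            (Module.finrank ℂ (powKer (internalExponents (m + 1) v Λ s (v e) (k + 1)) j) : ℤ) ≤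
            (qNat k * g').coeff j := by
          intro k
          induction k with
          | zero =>
            intro j
            obtain ⟨η, hη1, hη2, hη3⟩ := hv s e hmem
            -- the zeroth power of `η` is among the conditions
            have hbot : powKer (internalExponents (m + 1) v Λ s (v e) (0 + 1)) j = ⊥ := by
              rw [eq_bot_iff]
              intro f hf
              have := (mem_powKer.1 hf).2 (η, 0) (Or.inl ⟨hη1, by
                simp only [hη3, one_ne_zero, if_false]
                rw [weight, Finset.sum_eq_zero fun i hi => by rw [if_pos (hη2 i hi)]]; rfl⟩)
              rwa [dirDerivPow_zero] at this
            rw [hbot, qNat, Finset.range_zero, Finset.sum_empty, zero_mul, Polynomial.coeff_zero]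
            simp
          | succ k ihk =>
            intro j
            rw [show qNat (k + 1) * g' = Polynomial.X * (qNat k * g') + g' by
              rw [qNat_succ']; ring]
            exact finrank_powKer_internalExponents_succ hφ ihk hg2' j
        exact this m j

section LeastSpace

variable {Y : Set (Fin d → ℂ)} [Fintype Y]

theorem sum_pow_smul_divPow_eq_zero (η : Module.Dual ℂ (Fin d → ℂ)) {j : ℕ} {c : Y → ℂ}
    (hc : c ∈ vanishing Y j) (i : ℕ) : ∀ n, i + n < j →
      ∑ y : Y, (c y * η y ^ i) • divPow (y : Fin d → ℂ) n = 0 := by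
  induction i with
  | zero => intro n hn; simpa using mem_vanishing.1 hc n (by omega)
  | succ i ih =>
    intro n hn
    have := sum_smul_divPow_eq_zero_of_succ η (ih (n + 1) (by omega))
    simpa [pow_succ, mul_assoc] using this

theorem dirDerivPow_expTerm (η : Module.Dual ℂ (Fin d → ℂ)) (c : Y → ℂ) (n k : ℕ) :
    dirDerivPow η k (expTerm Y (n + k) c) =
      ∑ y : Y, (c y * η y ^ k) • divPow (y : Fin d → ℂ) n := by
  induction k generalizing n with
  | zero => simp [dirDerivPow_zero, expTerm_apply]
  | succ k ih =>
    rw [dirDerivPow_succ, show n + (k + 1) = n + 1 + k by ring, ih, map_sum]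
    refine Finset.sum_congr rfl fun y _ => ?_
    rw [Derivation.map_smul, dirDeriv_divPow_succ, smul_smul, pow_succ, mul_assoc]

/-- A functional with at most `k` values on `Y` satisfies a polynomial equation of degree `k`
there, whose top degree part `η ^ k` annihilates the least space. -/
theorem leastSpace_le_powKer {T : Set (Module.Dual ℂ (Fin d → ℂ) × ℕ)}
    (hT : ∀ η k, (η, k) ∈ T → ∃ Z : Finset ℂ, Z.card = k ∧ ∀ y ∈ Y, η y ∈ Z) (j : ℕ) :
    leastSpace Y j ≤ powKer T j := by
  rintro p hp
  refine mem_powKer.2 ⟨leastSpace_le j hp, ?_⟩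
  rintro ⟨η, k⟩ ht
  obtain ⟨Z, hZ, hY⟩ := hT η k ht
  rcases Nat.lt_or_ge j k with hk | hk
  · exact dirDerivPow_eq_zero_of_lt η (leastSpace_le j hp) hk
  obtain ⟨c, hc, rfl⟩ := hp
  obtain ⟨n, rfl⟩ := Nat.exists_eq_add_of_le' hk
  rw [dirDerivPow_expTerm]
  set Q : Polynomial ℂ := ∏ z ∈ Z, (Polynomial.X - Polynomial.C z) with hQ
  have hmonic : Q.Monic := Polynomial.monic_prod_of_monic _ _ fun z _ => Polynomial.monic_X_sub_C z
  have hdeg : Q.natDegree = k := by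
    rw [hQ, Polynomial.natDegree_prod_of_monic _ _ fun z _ => Polynomial.monic_X_sub_C z]
    simp [hZ]
  have hroot : ∀ y : Y, Q.eval (η y) = 0 := fun y => by
    rw [hQ, Polynomial.eval_prod]
    exact Finset.prod_eq_zero (hY y y.2) (by simp)
  have h0 : ∑ y : Y, (c y * Q.eval (η y)) • divPow (y : Fin d → ℂ) n = 0 := by simp [hroot]
  have hexp : ∑ y : Y, (c y * Q.eval (η y)) • divPow (y : Fin d → ℂ) n =
      ∑ i ∈ Finset.range (k + 1), Q.coeff i •
        ∑ y : Y, (c y * η y ^ i) • divPow (y : Fin d → ℂ) n := by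
    simp_rw [Finset.smul_sum]
    rw [Finset.sum_comm]
    refine Finset.sum_congr rfl fun y _ => ?_
    rw [Polynomial.eval_eq_sum_range, hdeg, Finset.mul_sum, Finset.sum_smul]
    refine Finset.sum_congr rfl fun i _ => ?_
    rw [smul_smul]
    congr 1
    ring
  rw [hexp, Finset.sum_range_succ, Finset.sum_eq_zero, zero_add,
    show Q.coeff k = 1 by rw [← hdeg]; exact hmonic, one_smul] at h0
  · exact h0
  · intro i hi
    rw [sum_pow_smul_divPow_eq_zero η hc i n (by have := Finset.mem_range.1 hi; omega), smul_zero]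

end LeastSpace

end GradedEhrhart

namespace GradedEhrhart

/-! ### Counting lattice points by deletion and contraction -/

section Thicken

variable {V : Type*} [AddCommGroup V] [Module ℝ V]

/-- The Minkowski sum of `Q` and the segment `[0, c] a`. -/
def thicken (Q : Set V) (a : V) (c : ℝ) : Set V :=
  {x | ∃ y ∈ Q, ∃ t : ℝ, 0 ≤ t ∧ t ≤ c ∧ x = y + t • a}

theorem subset_thicken (Q : Set V) (a : V) {c : ℝ} (hc : 0 ≤ c) : Q ⊆ thicken Q a c :=
  fun x hx => ⟨x, hx, 0, le_rfl, hc, by simp⟩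

theorem thicken_zero (Q : Set V) (a : V) : thicken Q a 0 = Q := by
  refine Set.Subset.antisymm ?_ (subset_thicken Q a le_rfl)
  rintro x ⟨y, hy, t, h0, h1, rfl⟩
  rwa [le_antisymm h1 h0, zero_smul, add_zero]

theorem thicken_thicken (Q : Set V) (a : V) {b c : ℝ} (hb : 0 ≤ b) (hc : 0 ≤ c) :
    thicken (thicken Q a b) a c = thicken Q a (b + c) := by
  ext x
  constructor
  · rintro ⟨_, ⟨y, hy, t, ht0, ht1, rfl⟩, u, hu0, hu1, rfl⟩
    exact ⟨y, hy, t + u, by linarith, by linarith, by rw [add_smul, add_assoc]⟩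
  · rintro ⟨y, hy, t, ht0, ht1, rfl⟩
    refine ⟨y + min t b • a, ⟨y, hy, min t b, le_min ht0 hb, min_le_right _ _, rfl⟩,
      t - min t b, sub_nonneg.2 (min_le_left _ _), ?_, ?_⟩
    · rcases min_choice t b with h | h <;> rw [h] <;> linarith
    · rw [add_assoc, ← add_smul, add_sub_cancel]

theorem convex_thicken {Q : Set V} (hQ : Convex ℝ Q) (a : V) (c : ℝ) :
    Convex ℝ (thicken Q a c) := by
  rintro _ ⟨y, hy, t, ht0, ht1, rfl⟩ _ ⟨y', hy', t', ht0', ht1', rfl⟩ α β hα hβ hαβ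
  refine ⟨α • y + β • y', hQ hy hy' hα hβ hαβ, α * t + β * t', by positivity, ?_, ?_⟩
  · calc α * t + β * t' ≤ α * c + β * c := by gcongr
      _ = c := by rw [← add_mul, hαβ, one_mul]
  · simp only [smul_add, add_smul, mul_smul]
    abel

/-- A convex set meets a line in an interval. -/
theorem mem_of_convex_line {Q : Set V} (hQ : Convex ℝ Q) {x a : V} {α β : ℝ}
    (hα : x + α • a ∈ Q) (hβ : x + β • a ∈ Q) (h0 : α ≤ 0) (h1 : 0 ≤ β) : x ∈ Q := by
  rcases h0.eq_or_lt with rfl | hneg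
  · simpa using hα
  have hpos : 0 < β - α := by linarith
  have := hQ hα hβ (a := β / (β - α)) (b := -α / (β - α)) (by positivity)
    (div_nonneg (by linarith) hpos.le) (by rw [← add_div, ← sub_eq_add_neg, div_self hpos.ne'])
  convert this using 1
  have e1 : β / (β - α) + -α / (β - α) = 1 := by
    rw [← add_div, ← sub_eq_add_neg, div_self hpos.ne']
  have e2 : β / (β - α) * α + -α / (β - α) * β = 0 := by ring
  rw [smul_add, smul_add, add_add_add_comm, ← add_smul, e1, one_smul, smul_smul, smul_smul,
    ← add_smul, e2, zero_smul, add_zero]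

theorem map_thicken {φ : Module.Dual ℝ V} {a : V} (hφ : φ a = 1) (Q : Set V) {c : ℝ}
    (hc : 0 ≤ c) : contraction φ a '' thicken Q a c = contraction φ a '' Q := by
  refine Set.Subset.antisymm ?_ (Set.image_mono (subset_thicken Q a hc))
  rintro _ ⟨_, ⟨y, hy, t, -, -, rfl⟩, rfl⟩
  exact ⟨y, hy, by rw [map_add, map_smul, contraction_self hφ, smul_zero, add_zero]⟩

theorem eq_add_smul_of_contraction_eq {φ : Module.Dual ℝ V} {a x y : V}
    (h : contraction φ a x = contraction φ a y) : y = x + (φ y - φ x) • a := by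
  rw [contraction_apply, contraction_apply] at h
  have : y = x - φ x • a + φ y • a := by rw [h, sub_add_cancel]
  rw [sub_smul]
  conv_lhs => rw [this]
  abel

/-- The lattice points of `Q + [0, a]` that are not in `Q` are, on each line in direction `a`, the
last ones; so their number is at most the number of lattice points of the projection of `Q`. -/
theorem ncard_thicken_one_le {φ : Module.Dual ℝ V} {a : V} (hφ : φ a = 1) {Λ : AddSubgroup V}
    (ha : a ∈ Λ) (hΛ : ∀ x ∈ Λ, ∃ z : ℤ, φ x = z) {Q : Set V} (hQ : Convex ℝ Q)
    (hS : ((Λ : Set V) ∩ Q).Finite)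
    (hB : ((Λ.map (contraction φ a).toAddMonoidHom : Set V) ∩ contraction φ a '' Q).Finite) :
    ((Λ : Set V) ∩ thicken Q a 1).Finite ∧
    ((Λ : Set V) ∩ thicken Q a 1).ncard ≤ ((Λ : Set V) ∩ Q).ncard +
      ((Λ.map (contraction φ a).toAddMonoidHom : Set V) ∩ contraction φ a '' Q).ncard := by
  set S := (Λ : Set V) ∩ Q
  set S' := (Λ : Set V) ∩ thicken Q a 1
  set B := (Λ.map (contraction φ a).toAddMonoidHom : Set V) ∩ contraction φ a '' Q
  set M := {x ∈ S' | x + a ∉ S'}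
  have hMB : Set.MapsTo (contraction φ a) M B := by
    rintro x ⟨⟨hx1, hx2⟩, -⟩
    refine ⟨⟨x, hx1, rfl⟩, ?_⟩
    rw [← map_thicken hφ Q zero_le_one]
    exact ⟨x, hx2, rfl⟩
  have key : ∀ x ∈ M, ∀ x' ∈ M, ∀ k : ℤ, 0 ≤ k → x' = x + (k : ℝ) • a → x = x' := by
    rintro x ⟨⟨hx1, y, hy, t, ht0, ht1, hxy⟩, hx3⟩ x' ⟨⟨hx1', y', hy', t', ht0', ht1', hxy'⟩, hx3'⟩
      k hk0 hk
    rcases hk0.eq_or_lt with rfl | hk0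
    · simpa using hk.symm
    exfalso
    rcases (show (1 : ℤ) ≤ k from hk0).eq_or_lt with rfl | hk1
    · refine hx3 ?_
      rw [show x + a = x' by simpa using hk.symm]
      exact ⟨hx1', y', hy', t', ht0', ht1', hxy'⟩
    · refine hx3 ⟨Λ.add_mem hx1 ha, subset_thicken Q a zero_le_one ?_⟩
      have hk2 : (2 : ℝ) ≤ k := by exact_mod_cast hk1
      refine mem_of_convex_line hQ (a := a) (α := -1 - t) (β := k - 1 - t') ?_ ?_
        (by linarith) (by linarith)
      · have : x + a + (-1 - t) • a = y := by rw [hxy]; module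
        rwa [this]
      · have : x + a + ((k : ℝ) - 1 - t') • a = y' := by
          rw [show x + a + ((k : ℝ) - 1 - t') • a = (x + (k : ℝ) • a) - t' • a by module,
            ← hk, hxy']
          module
        rwa [this]
  have hinj : Set.InjOn (contraction φ a) M := by
    intro x hx x' hx' h
    obtain ⟨z, hz⟩ := hΛ x hx.1.1
    obtain ⟨z', hz'⟩ := hΛ x' hx'.1.1
    rcases le_total z z' with hle | hle
    · refine key x hx x' hx' (z' - z) (by omega) ?_
      rw [Int.cast_sub, ← hz, ← hz']
      exact eq_add_smul_of_contraction_eq h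
    · refine (key x' hx' x hx (z - z') (by omega) ?_).symm
      rw [Int.cast_sub, ← hz, ← hz']
      exact eq_add_smul_of_contraction_eq h.symm
  have hMfin : M.Finite := Set.Finite.of_injOn hMB hinj hB
  have hsub : S' ⊆ S ∪ M := by
    intro x hx
    by_cases hxa : x + a ∈ S'
    · left
      obtain ⟨hx1, y, hy, t, ht0, ht1, hxy⟩ := hx
      obtain ⟨-, y', hy', t', ht0', ht1', hxy'⟩ := hxa
      refine ⟨hx1, mem_of_convex_line hQ (a := a) (α := -t) (β := 1 - t') ?_ ?_
        (by linarith) (by linarith)⟩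
      · have : x + (-t) • a = y := by rw [hxy]; module
        rwa [this]
      · have : x + (1 - t') • a = y' := by
          rw [show x + (1 - t') • a = x + a - t' • a by module, hxy']
          module
        rwa [this]
    · exact Or.inr ⟨hx, hxa⟩
  refine ⟨(hS.union hMfin).subset hsub, ?_⟩
  calc S'.ncard ≤ (S ∪ M).ncard := Set.ncard_le_ncard hsub (hS.union hMfin)
    _ ≤ S.ncard + M.ncard := Set.ncard_union_le _ _
    _ ≤ S.ncard + B.ncard := by
      have := Set.ncard_le_ncard_of_injOn _ hMB hinj hB
      omega

theorem ncard_thicken_le {φ : Module.Dual ℝ V} {a : V} (hφ : φ a = 1) {Λ : AddSubgroup V}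
    (ha : a ∈ Λ) (hΛ : ∀ x ∈ Λ, ∃ z : ℤ, φ x = z) {Q : Set V} (hQ : Convex ℝ Q)
    (hS : ((Λ : Set V) ∩ Q).Finite)
    (hB : ((Λ.map (contraction φ a).toAddMonoidHom : Set V) ∩ contraction φ a '' Q).Finite)
    (m : ℕ) : ((Λ : Set V) ∩ thicken Q a m).Finite ∧
    ((Λ : Set V) ∩ thicken Q a m).ncard ≤ ((Λ : Set V) ∩ Q).ncard +
      m * ((Λ.map (contraction φ a).toAddMonoidHom : Set V) ∩ contraction φ a '' Q).ncard := by
  induction m with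
  | zero => simpa [thicken_zero] using hS
  | succ m ih =>
    obtain ⟨h1, h2⟩ := ih
    have := ncard_thicken_one_le hφ ha hΛ (convex_thicken hQ a m) h1
      (by rwa [map_thicken hφ Q m.cast_nonneg])
    rw [map_thicken hφ Q m.cast_nonneg, thicken_thicken Q a m.cast_nonneg zero_le_one] at this
    push_cast
    refine ⟨this.1, this.2.trans ?_⟩
    linarith

/-- On every line in direction `a` that meets `Q` and contains lattice points, `Q + [0, a]` has at
least one lattice point more than `Q`. -/
theorem le_ncard_thicken_one {φ : Module.Dual ℝ V} {a : V} (hφ : φ a = 1) {Λ : AddSubgroup V}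
    (ha : a ∈ Λ) {Q : Set V} (hS : ((Λ : Set V) ∩ thicken Q a 1).Finite) :
    ((Λ : Set V) ∩ Q).ncard +
      ((Λ.map (contraction φ a).toAddMonoidHom : Set V) ∩ contraction φ a '' Q).ncard ≤
    ((Λ : Set V) ∩ thicken Q a 1).ncard := by
  set S := (Λ : Set V) ∩ Q
  set S' := (Λ : Set V) ∩ thicken Q a 1
  set B := (Λ.map (contraction φ a).toAddMonoidHom : Set V) ∩ contraction φ a '' Q
  have hsub : S ⊆ S' := Set.inter_subset_inter_right _ (subset_thicken Q a zero_le_one)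
  have hpadd : ∀ (x : V) (c : ℝ), contraction φ a (x + c • a) = contraction φ a x := fun x c => by
    rw [map_add, map_smul, contraction_self hφ, smul_zero, add_zero]
  have hcover : B ⊆ contraction φ a '' (S' \ S) := by
    rintro w ⟨⟨x, hx, rfl⟩, y, hy, hxy⟩
    change contraction φ a y = contraction φ a x at hxy
    change contraction φ a x ∈ _
    by_cases hex : ∃ z ∈ S, contraction φ a z = contraction φ a x
    · -- a lattice point of `Q` on the line, moved in direction `a` until it leaves `Q`
      obtain ⟨z, hz, hzx⟩ := hex
      have hleave : ∃ k : ℕ, z + ((k : ℕ) : ℝ) • a ∉ S := by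
        by_contra! hall
        have hinf : Set.Infinite S := by
          refine Set.infinite_of_injective_forall_mem (f := fun k : ℕ => z + (k : ℝ) • a) ?_ hall
          intro k l hkl
          have := congrArg φ (add_left_cancel hkl)
          simpa [hφ] using this
        exact hinf (hS.subset hsub)
      classical
      have hk := Nat.find_spec hleave
      have hmin := fun l => Nat.find_min hleave (m := l)
      set k := Nat.find hleave
      have hk0 : k ≠ 0 := by
        intro h0
        rw [h0] at hk
        exact hk (by simpa using hz)
      obtain ⟨l, hl⟩ := Nat.exists_eq_succ_of_ne_zero hk0
      have hl' : z + (l : ℝ) • a ∈ S := not_not.1 (hmin l (by omega))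
      refine ⟨z + (k : ℝ) • a, ⟨?_, hk⟩, by rw [hpadd, hzx]⟩
      have he : z + (k : ℝ) • a = z + (l : ℝ) • a + (1 : ℝ) • a := by
        rw [hl]; push_cast; module
      rw [he]
      exact ⟨Λ.add_mem hl'.1 (by simpa using ha), _, hl'.2, 1, zero_le_one, le_rfl, rfl⟩
    · have hxy' := eq_add_smul_of_contraction_eq hxy
      set c := φ x - φ y
      have hmem : x + ((-⌊c⌋ : ℤ) : ℝ) • a ∈ S' := by
        refine ⟨Λ.add_mem hx ?_, y, hy, Int.fract c, Int.fract_nonneg c, (Int.fract_lt_one c).le,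
          ?_⟩
        · rw [Int.cast_smul_eq_zsmul]
          exact Λ.zsmul_mem ha _
        · rw [hxy', ← Int.self_sub_floor]
          push_cast
          module
      refine ⟨_, ⟨hmem, fun h => hex ⟨_, h, hpadd _ _⟩⟩, hpadd _ _⟩
  have h1 : B.ncard ≤ (S' \ S).ncard :=
    (Set.ncard_le_ncard hcover ((hS.subset Set.sdiff_subset).image _)).trans
      (Set.ncard_image_le (hS.subset Set.sdiff_subset))
  have h2 := Set.ncard_sdiff_add_ncard_of_subset hsub hS
  omega

theorem le_ncard_thicken {φ : Module.Dual ℝ V} {a : V} (hφ : φ a = 1) {Λ : AddSubgroup V}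
    (ha : a ∈ Λ) {Q : Set V} {m : ℕ} (hS : ((Λ : Set V) ∩ thicken Q a m).Finite) :
    ((Λ : Set V) ∩ Q).ncard +
      m * ((Λ.map (contraction φ a).toAddMonoidHom : Set V) ∩ contraction φ a '' Q).ncard ≤
    ((Λ : Set V) ∩ thicken Q a m).ncard := by
  induction m with
  | zero => simp [thicken_zero]
  | succ m ih =>
    have he : thicken Q a ((m + 1 : ℕ) : ℝ) = thicken (thicken Q a m) a 1 := by
      rw [thicken_thicken Q a m.cast_nonneg zero_le_one]; push_cast; rfl
    rw [he] at hS ⊢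
    have h1 := le_ncard_thicken_one hφ ha hS
    rw [map_thicken hφ Q m.cast_nonneg] at h1
    have h2 := ih (hS.subset (Set.inter_subset_inter_right _ (subset_thicken _ a zero_le_one)))
    linarith

end Thicken

section BoxSum

variable {V ι : Type*} [AddCommGroup V] [Module ℝ V]

/-- The zonotope `∑_{i ∈ s} [0, c] v_i`. -/
def closedBoxSum (c : ℝ) (v : ι → V) (s : Finset ι) : Set V :=
  {x | ∃ t : ι → ℝ, (∀ i ∈ s, 0 ≤ t i ∧ t i ≤ c) ∧ x = ∑ i ∈ s, t i • v i}

/-- The relatively open zonotope `∑_{i ∈ s} (0, c) v_i`. -/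
def openBoxSum (c : ℝ) (v : ι → V) (s : Finset ι) : Set V :=
  {x | ∃ t : ι → ℝ, (∀ i ∈ s, 0 < t i ∧ t i < c) ∧ x = ∑ i ∈ s, t i • v i}

theorem openBoxSum_subset (c : ℝ) (v : ι → V) (s : Finset ι) :
    openBoxSum c v s ⊆ closedBoxSum c v s := by
  rintro x ⟨t, ht, rfl⟩
  exact ⟨t, fun i hi => ⟨(ht i hi).1.le, (ht i hi).2.le⟩, rfl⟩

theorem image_closedBoxSum (p : V →ₗ[ℝ] V) (c : ℝ) (v : ι → V) (s : Finset ι) :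
    p '' closedBoxSum c v s = closedBoxSum c (p ∘ v) s := by
  ext x
  constructor
  · rintro ⟨_, ⟨t, ht, rfl⟩, rfl⟩
    exact ⟨t, ht, by simp⟩
  · rintro ⟨t, ht, rfl⟩
    exact ⟨_, ⟨t, ht, rfl⟩, by simp⟩

theorem image_openBoxSum (p : V →ₗ[ℝ] V) (c : ℝ) (v : ι → V) (s : Finset ι) :
    p '' openBoxSum c v s = openBoxSum c (p ∘ v) s := by
  ext x
  constructor
  · rintro ⟨_, ⟨t, ht, rfl⟩, rfl⟩
    exact ⟨t, ht, by simp⟩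
  · rintro ⟨t, ht, rfl⟩
    exact ⟨_, ⟨t, ht, rfl⟩, by simp⟩

theorem convex_closedBoxSum (c : ℝ) (v : ι → V) (s : Finset ι) :
    Convex ℝ (closedBoxSum c v s) := by
  rintro _ ⟨t, ht, rfl⟩ _ ⟨u, hu, rfl⟩ α β hα hβ hαβ
  refine ⟨fun i => α * t i + β * u i, fun i hi => ⟨?_, ?_⟩, ?_⟩
  · have := (ht i hi).1
    have := (hu i hi).1
    positivity
  · calc α * t i + β * u i ≤ α * c + β * c := by
          have := (ht i hi).2
          have := (hu i hi).2
          gcongr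
      _ = c := by rw [← add_mul, hαβ, one_mul]
  · simp only [Finset.smul_sum, add_smul, mul_smul, Finset.sum_add_distrib]

variable [DecidableEq ι] {v : ι → V} {s : Finset ι} {e : ι}

theorem closedBoxSum_insert_subset (c : ℝ) (he : e ∉ s) :
    closedBoxSum c v (insert e s) ⊆ thicken (closedBoxSum c v s) (v e) c := by
  rintro _ ⟨t, ht, rfl⟩
  refine ⟨∑ i ∈ s, t i • v i, ⟨t, fun i hi => ht i (Finset.mem_insert_of_mem hi), rfl⟩, t e,
    (ht e (Finset.mem_insert_self e s)).1, (ht e (Finset.mem_insert_self e s)).2, ?_⟩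
  rw [Finset.sum_insert he, add_comm]

theorem add_smul_mem_openBoxSum_insert {c : ℝ} (he : e ∉ s) {y : V} (hy : y ∈ openBoxSum c v s)
    {u : ℝ} (hu0 : 0 < u) (hu1 : u < c) : y + u • v e ∈ openBoxSum c v (insert e s) := by
  obtain ⟨t, ht, rfl⟩ := hy
  have hne : ∀ x ∈ s, Function.update t e u x = t x := fun x hx =>
    Function.update_of_ne (by rintro rfl; exact he hx) _ _
  refine ⟨Function.update t e u, fun i hi => ?_, ?_⟩
  · rcases Finset.mem_insert.1 hi with rfl | hi
    · simpa using ⟨hu0, hu1⟩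
    · rw [hne i hi]; exact ht i hi
  · rw [Finset.sum_insert he, Function.update_self, add_comm]
    congr 1
    exact Finset.sum_congr rfl fun i hi => by rw [hne i hi]

/-- The open zonotope is open in its span. -/
theorem exists_add_smul_mem_openBoxSum {c : ℝ} {a y : V}
    (ha : a ∈ Submodule.span ℝ (v '' (s : Set ι))) (hy : y ∈ openBoxSum c v s) :
    ∃ ε > 0, ∀ δ : ℝ, |δ| < ε → y + δ • a ∈ openBoxSum c v s := by
  obtain ⟨u, rfl⟩ : ∃ u : ι → ℝ, ∑ i ∈ s, u i • v i = a := by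
    obtain ⟨u, hu⟩ := (Submodule.mem_span_image_finset_iff_exists_fun ℝ).1 ha
    refine ⟨fun i => if h : i ∈ s then u ⟨i, h⟩ else 0, ?_⟩
    rw [← hu, ← Finset.sum_coe_sort]
    exact Finset.sum_congr rfl fun i _ => by simp
  obtain ⟨t, ht, rfl⟩ := hy
  have hcont : ∀ i ∈ s, ∀ᶠ δ : ℝ in nhds 0, 0 < t i + δ * u i ∧ t i + δ * u i < c := by
    intro i hi
    have hc : Continuous fun δ : ℝ => t i + δ * u i := by fun_prop
    have ht0 : Filter.Tendsto (fun δ : ℝ => t i + δ * u i) (nhds 0) (nhds (t i)) := by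
      simpa using hc.tendsto 0
    exact (ht0.eventually (lt_mem_nhds (ht i hi).1)).and (ht0.eventually (gt_mem_nhds (ht i hi).2))
  obtain ⟨ε, hε, hall⟩ := Metric.eventually_nhds_iff.1 ((Finset.eventually_all s).2 hcont)
  refine ⟨ε, hε, fun δ hδ => ⟨fun i => t i + δ * u i, fun i hi => hall (by simpa using hδ) i hi,
    ?_⟩⟩
  simp only [add_smul, Finset.sum_add_distrib, Finset.smul_sum, mul_smul]

theorem thicken_openBoxSum_subset {c : ℝ} (hc : 0 < c) (he : e ∉ s)
    (ha : v e ∈ Submodule.span ℝ (v '' (s : Set ι))) :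
    thicken (openBoxSum c v s) (v e) c ⊆ openBoxSum c v (insert e s) := by
  rintro _ ⟨y, hy, t, ht0, ht1, rfl⟩
  obtain ⟨ε, hε, hall⟩ := exists_add_smul_mem_openBoxSum ha hy
  -- move the coefficient of `v e` into the open interval and compensate inside the span
  obtain ⟨u, hu0, hu1, hu⟩ : ∃ u, 0 < u ∧ u < c ∧ |t - u| < ε := by
    rcases ht0.eq_or_lt with rfl | ht0
    · refine ⟨min (ε / 2) (c / 2), by positivity, (min_le_right _ _).trans_lt (by linarith), ?_⟩
      rw [zero_sub, abs_neg, abs_of_pos (by positivity)]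
      exact (min_le_left _ _).trans_lt (by linarith)
    · refine ⟨max (t - ε / 2) (t / 2), lt_max_of_lt_right (by linarith),
        max_lt (by linarith) (by linarith), ?_⟩
      rw [abs_lt]
      constructor
      · have : max (t - ε / 2) (t / 2) < t + ε := max_lt (by linarith) (by linarith)
        linarith
      · have := le_max_left (t - ε / 2) (t / 2)
        linarith
  have := add_smul_mem_openBoxSum_insert he (hall _ hu) hu0 hu1
  rwa [add_assoc, ← add_smul, sub_add_cancel] at this

end BoxSum

section Count

variable {V ι : Type*} [AddCommGroup V] [Module ℝ V] [DecidableEq ι]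

theorem eval_one_qNat (m : ℕ) : (qNat m).eval 1 = m := by
  simp [qNat, Polynomial.eval_finsetSum]

/-- The lattice points of the `m`-th dilate of a unimodular zonotope are at most as many as
predicted by the corank-nullity polynomial. -/
theorem ncard_closedBoxSum_le (m : ℕ) (s : Finset ι) :
    ∀ (v : ι → V) (Λ : AddSubgroup V), IsUnimodularConfig ℝ v Λ → (∀ i, v i ∈ Λ) →
      ((Λ : Set V) ∩ closedBoxSum m v s).Finite ∧
      (((Λ : Set V) ∩ closedBoxSum m v s).ncard : ℤ) ≤ (extPoly m (rankOf ℝ v) s).eval 1 := by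
  induction s using Finset.induction_on with
  | empty =>
    intro v Λ _ _
    have h : (Λ : Set V) ∩ closedBoxSum m v ∅ ⊆ {0} := by
      rintro _ ⟨-, t, -, rfl⟩
      simp
    refine ⟨(Set.finite_singleton 0).subset h, ?_⟩
    rw [extPoly_empty, Polynomial.eval_one]
    have := Set.ncard_le_ncard h (Set.finite_singleton 0)
    rw [Set.ncard_singleton] at this
    exact_mod_cast this
  | insert e s he ih =>
    intro v Λ hv hΛ
    have hsub := closedBoxSum_insert_subset (v := v) (m : ℝ) he
    obtain ⟨h1, h2⟩ := ih v Λ hv hΛ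
    by_cases h0 : v e = 0
    · have hsub' : (Λ : Set V) ∩ closedBoxSum m v (insert e s) ⊆ Λ ∩ closedBoxSum m v s := by
        refine Set.inter_subset_inter_right _ (hsub.trans ?_)
        rintro _ ⟨y, hy, t, -, -, rfl⟩
        rwa [h0, smul_zero, add_zero]
      refine ⟨h1.subset hsub', le_trans ?_ (h2.trans_eq ?_)⟩
      · exact_mod_cast Set.ncard_le_ncard hsub' h1
      · rw [extPoly_insert_loop m he (fun S _ => rankOf_insert_of_mem v (by simp [h0]))
          fun S _ => rankOf_le_card v S]
    · obtain ⟨φ, hφ, hφe⟩ := hv.exists_of_ne_zero h0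
      obtain ⟨h3, h4⟩ := ih _ _ (hv.contraction hφe) fun i => ⟨v i, hΛ i, rfl⟩
      rw [← image_closedBoxSum] at h3 h4
      obtain ⟨h5, h6⟩ := ncard_thicken_le hφe (hΛ e) hφ.2 (convex_closedBoxSum m v s) h1 h3 m
      have hsub' := Set.inter_subset_inter_right (Λ : Set V) hsub
      refine ⟨h5.subset hsub', ?_⟩
      rw [extPoly_insert m he fun S _ => rankOf_insert_contraction v hφe S, Polynomial.eval_add,
        Polynomial.eval_mul, Polynomial.eval_mul, eval_one_qNat]
      have h7 := (Set.ncard_le_ncard hsub' h5).trans h6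
      have h8 : (m : ℤ) * _ ≤ m * _ := mul_le_mul_of_nonneg_left h4 (Int.natCast_nonneg m)
      zify at h7
      simp only [Polynomial.eval_pow, Polynomial.eval_X, one_pow, one_mul]
      linarith

/-- The relatively interior lattice points of the `(m + 1)`-st dilate of a unimodular zonotope are
at least as many as predicted by the interior corank-nullity polynomial. -/
theorem le_ncard_openBoxSum (m : ℕ) (s : Finset ι) :
    ∀ (v : ι → V) (Λ : AddSubgroup V), IsUnimodularConfig ℝ v Λ → (∀ i, v i ∈ Λ) →
      (intPoly (m + 1) (rankOf ℝ v) s).eval 1 ≤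
        (((Λ : Set V) ∩ openBoxSum ((m + 1 : ℕ) : ℝ) v s).ncard : ℤ) := by
  have hfin : ∀ (s : Finset ι) (v : ι → V) (Λ : AddSubgroup V), IsUnimodularConfig ℝ v Λ →
      (∀ i, v i ∈ Λ) → ((Λ : Set V) ∩ openBoxSum ((m + 1 : ℕ) : ℝ) v s).Finite :=
    fun s v Λ hv hΛ => (ncard_closedBoxSum_le (m + 1) s v Λ hv hΛ).1.subset
      (Set.inter_subset_inter_right _ (openBoxSum_subset _ v s))
  have hpos : (0 : ℝ) < ((m + 1 : ℕ) : ℝ) := by positivity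
  induction s using Finset.induction_on with
  | empty =>
    intro v Λ hv hΛ
    rw [intPoly_empty _ (rankOf_empty v), Polynomial.eval_one]
    have h0 : (0 : V) ∈ (Λ : Set V) ∩ openBoxSum ((m + 1 : ℕ) : ℝ) v ∅ :=
      ⟨Λ.zero_mem, 0, by simp, by simp⟩
    have := (Set.ncard_pos (hfin ∅ v Λ hv hΛ)).2 ⟨0, h0⟩
    exact_mod_cast this
  | insert e s he ih =>
    intro v Λ hv hΛ
    have hfi := hfin (insert e s) v Λ hv hΛ
    have h2 := ih v Λ hv hΛ
    by_cases h0 : v e = 0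
    · have hloop : ∀ S ⊆ s, rankOf ℝ v (insert e S) = rankOf ℝ v S :=
        fun S _ => rankOf_insert_of_mem v (by simp [h0])
      rw [intPoly_insert_loop _ he hloop fun S _ => rankOf_le_card v S]
      refine h2.trans ?_
      have hsub : (Λ : Set V) ∩ openBoxSum ((m + 1 : ℕ) : ℝ) v s ⊆
          Λ ∩ openBoxSum ((m + 1 : ℕ) : ℝ) v (insert e s) := by
        rintro y ⟨hy1, hy2⟩
        refine ⟨hy1, ?_⟩
        have := add_smul_mem_openBoxSum_insert he hy2 (half_pos hpos) (half_lt_self hpos)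
        rwa [h0, smul_zero, add_zero] at this
      exact_mod_cast Set.ncard_le_ncard hsub hfi
    obtain ⟨φ, hφ, hφe⟩ := hv.exists_of_ne_zero h0
    have h4 := ih _ _ (hv.contraction hφe) fun i => ⟨v i, hΛ i, rfl⟩
    rw [← image_openBoxSum] at h4
    have hr := rankOf_insert_contraction v hφe
    by_cases hmem : v e ∈ Submodule.span ℝ (v '' (s : Set ι))
    · have hsub := Set.inter_subset_inter_right (Λ : Set V)
        (thicken_openBoxSum_subset hpos he hmem)
      have h6 := (le_ncard_thicken hφe (hΛ e) (hfi.subset hsub)).trans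
        (Set.ncard_le_ncard hsub hfi)
      rw [intPoly_insert _ he (rankOf_insert_of_mem v hmem) fun S _ => hr S, Polynomial.eval_add,
        Polynomial.eval_mul, Polynomial.eval_mul, Polynomial.eval_mul, eval_one_qNat]
      have h8 : ((m + 1 : ℕ) : ℤ) * _ ≤ ((m + 1 : ℕ) : ℤ) * _ :=
        mul_le_mul_of_nonneg_left h4 (Int.natCast_nonneg _)
      zify at h6
      simp only [Polynomial.eval_pow, Polynomial.eval_X, one_pow, one_mul]
      push_cast at *
      linarith
    · -- `(0, m + 1) = (0, 1) + [0, m]`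
      set Q : Set V := {x | ∃ y ∈ openBoxSum ((m + 1 : ℕ) : ℝ) v s, ∃ t : ℝ, 0 < t ∧ t < 1 ∧
        x = y + t • v e}
      have hpQ : contraction φ (v e) '' openBoxSum ((m + 1 : ℕ) : ℝ) v s ⊆
          contraction φ (v e) '' Q := by
        rintro _ ⟨y, hy, rfl⟩
        refine ⟨y + (1 / 2 : ℝ) • v e, ⟨y, hy, 1 / 2, by norm_num, by norm_num, rfl⟩, ?_⟩
        rw [map_add, map_smul, contraction_self hφe, smul_zero, add_zero]
      have hpQ' : contraction φ (v e) '' Q ⊆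
          contraction φ (v e) '' openBoxSum ((m + 1 : ℕ) : ℝ) v s := by
        rintro _ ⟨_, ⟨y, hy, t, -, -, rfl⟩, rfl⟩
        exact ⟨y, hy, by rw [map_add, map_smul, contraction_self hφe, smul_zero, add_zero]⟩
      have hsub : (Λ : Set V) ∩ thicken Q (v e) m ⊆
          Λ ∩ openBoxSum ((m + 1 : ℕ) : ℝ) v (insert e s) := by
        refine Set.inter_subset_inter_right _ ?_
        rintro _ ⟨_, ⟨y, hy, t, ht0, ht1, rfl⟩, u, hu0, hu1, rfl⟩
        rw [add_assoc, ← add_smul]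
        exact add_smul_mem_openBoxSum_insert he hy (by linarith) (by push_cast; linarith)
      have h6 := (le_ncard_thicken hφe (hΛ e) (hfi.subset hsub)).trans
        (Set.ncard_le_ncard hsub hfi)
      rw [hpQ'.antisymm hpQ] at h6
      have hc : ∀ S ⊆ s, rankOf ℝ (contraction φ (v e) ∘ v) S = rankOf ℝ v S :=
        fun S hS => rankOf_contraction_of_notMem v hφe hmem hS
      rw [intPoly_insert_coloop m he (fun S hS => by rw [hr, hc S hS])
        (fun S hS => rankOf_mono v hS), ← intPoly_congr _ hc, Polynomial.eval_mul,
        Polynomial.eval_mul, eval_one_qNat, Polynomial.eval_X, one_mul]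
      have h8 : (m : ℤ) * _ ≤ m * _ := mul_le_mul_of_nonneg_left h4 (Int.natCast_nonneg m)
      refine h8.trans ?_
      exact_mod_cast le_of_add_le_right h6

end Count

end GradedEhrhart

namespace GradedEhrhart

/-! ### Unimodular matrices -/

section Columns

variable {d n : ℕ}

/-- The columns of an integer matrix as vectors over a field. -/
def colVec (K : Type*) [Field K] (A : Matrix (Fin d) (Fin n) ℤ) : Fin n → Fin d → K :=
  fun i s => (A s i : K)

/-- The integer vectors in `K^d`. -/
def intLattice (K : Type*) [Field K] (d : ℕ) : AddSubgroup (Fin d → K) :=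
  (AddMonoidHom.compLeft (Int.castAddHom K) (Fin d)).range

theorem colVec_mem_intLattice (K : Type*) [Field K] (A : Matrix (Fin d) (Fin n) ℤ) (i : Fin n) :
    colVec K A i ∈ intLattice K d := ⟨fun s => A s i, rfl⟩

theorem finrank_span_image_eq_ncard {K V ι : Type*} [Field K] [AddCommGroup V] [Module K V]
    [Finite ι] {v : ι → V} {b : Set ι} (hb : LinearIndepOn K v b) :
    Module.finrank K (Submodule.span K (v '' b)) = b.ncard := by
  have : Fintype b := Fintype.ofFinite b
  have h := finrank_span_eq_card hb
  rw [← Nat.card_eq_fintype_card, Nat.card_coe_set_eq] at h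
  rw [← h, Set.image_eq_range]

/-- Every subfamily has an independent part with the same span. -/
theorem exists_linearIndepOn_span_eq {K V ι : Type*} [Field K] [AddCommGroup V] [Module K V]
    [Finite ι] (v : ι → V) {a s : Set ι} (ha : LinearIndepOn K v a) (has : a ⊆ s) :
    ∃ b, a ⊆ b ∧ b ⊆ s ∧ LinearIndepOn K v b ∧
      Submodule.span K (v '' b) = Submodule.span K (v '' s) ∧
      b.ncard = Module.finrank K (Submodule.span K (v '' s)) := by
  obtain ⟨b, hbs, hab, hspan, hb⟩ := exists_linearIndepOn_extension ha has
  have heq : Submodule.span K (v '' b) = Submodule.span K (v '' s) :=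
    le_antisymm (Submodule.span_mono (Set.image_mono hbs)) (Submodule.span_le.2 hspan)
  exact ⟨b, hab, hbs, hb, heq, by rw [← heq, finrank_span_image_eq_ncard hb]⟩

theorem linearIndepOn_colVec_iff (K : Type*) [Field K] [CharZero K] (A : Matrix (Fin d) (Fin n) ℤ)
    (b : Set (Fin n)) :
    LinearIndepOn K (colVec K A) b ↔ LinearIndepOn ℤ (fun i s => A s i) b := by
  have := linearIndependent_algebraMap_comp_iff (R := ℤ) (S := K)
    (v := fun (i : b) (s : Fin d) => A s i)
  exact this

/-- The rank function of an integer matrix does not depend on the field of characteristic zero. -/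
theorem rankOf_colVec_le (K L : Type*) [Field K] [CharZero K] [Field L] [CharZero L]
    (A : Matrix (Fin d) (Fin n) ℤ) (s : Finset (Fin n)) :
    rankOf K (colVec K A) s ≤ rankOf L (colVec L A) s := by
  obtain ⟨b, -, hbs, hb, -, hcard⟩ := exists_linearIndepOn_span_eq (colVec K A) (s := s)
    (linearIndepOn_empty K _) (Set.empty_subset _)
  rw [rankOf, ← hcard]
  rw [linearIndepOn_colVec_iff, ← linearIndepOn_colVec_iff L] at hb
  rw [← finrank_span_image_eq_ncard hb]
  exact Submodule.finrank_mono (Submodule.span_mono (Set.image_mono hbs))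

theorem rankOf_colVec (K L : Type*) [Field K] [CharZero K] [Field L] [CharZero L]
    (A : Matrix (Fin d) (Fin n) ℤ) (s : Finset (Fin n)) :
    rankOf K (colVec K A) s = rankOf L (colVec L A) s :=
  le_antisymm (rankOf_colVec_le K L A s) (rankOf_colVec_le L K A s)

variable {A : Matrix (Fin d) (Fin n) ℤ}

theorem rankOf_colVec_univ (K : Type*) [Field K] [CharZero K] (hA : IsUnimodular A) :
    rankOf K (colVec K A) Finset.univ = d := by
  rw [rankOf_colVec K ℝ]
  have := hA.1
  rw [Matrix.rank_eq_finrank_span_cols] at this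
  rw [rankOf, Finset.coe_univ, Set.image_univ]
  exact this

theorem span_colVec_univ (K : Type*) [Field K] [CharZero K] (hA : IsUnimodular A) :
    Submodule.span K (Set.range (colVec K A)) = ⊤ := by
  apply Submodule.eq_top_of_finrank_eq
  have := rankOf_colVec_univ K hA
  rw [rankOf, Finset.coe_univ, Set.image_univ] at this
  rw [this, Module.finrank_fin_fun]

/-- The minors with columns in any order, and possibly repeated, are `0` or `±1` too. -/
theorem IsUnimodular.det_submatrix (hA : IsUnimodular A) (c : Fin d → Fin n) :
    (A.submatrix id c).det = 0 ∨ (A.submatrix id c).det = 1 ∨ (A.submatrix id c).det = -1 := by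
  by_cases hc : Function.Injective c
  · have hmono : StrictMono (c ∘ Tuple.sort c) :=
      (Tuple.monotone_sort c).strictMono_of_injective (hc.comp (Tuple.sort c).injective)
    have h := hA.2 (OrderEmbedding.ofStrictMono _ hmono)
    have h' : A.submatrix id (OrderEmbedding.ofStrictMono _ hmono) =
        (A.submatrix id c).submatrix id (Tuple.sort c) := rfl
    rw [h', Matrix.det_permute'] at h
    rcases Int.units_eq_one_or (Equiv.Perm.sign (Tuple.sort c)) with hs | hs <;> rw [hs] at h <;>
      simp only [Set.mem_insert_iff, Set.mem_singleton_iff, Units.val_neg, Units.val_one,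
        Int.cast_one, Int.cast_neg, one_mul, neg_mul] at h <;> omega
  · left
    rw [Function.Injective] at hc
    push Not at hc
    obtain ⟨i, j, hij, hne⟩ := hc
    exact Matrix.det_zero_of_column_eq hne fun k => by simp [hij]

/-- The coordinate functionals of bases of columns have values in `{0, 1, -1}` on all columns, by
Cramer's rule. -/
theorem isUnimodularConfig_colVec (K : Type*) [Field K] [CharZero K] (hA : IsUnimodular A) :
    IsUnimodularConfig K (colVec K A) (intLattice K d) := by
  classical
  intro s e he
  obtain ⟨b₀, -, hb₀s, hb₀, hspan₀, -⟩ := exists_linearIndepOn_span_eq (colVec K A) (s := s)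
    (linearIndepOn_empty K _) (Set.empty_subset _)
  rw [← hspan₀] at he
  have heb : e ∉ b₀ := fun h => he (Submodule.subset_span ⟨e, h, rfl⟩)
  obtain ⟨b, hib, -, hb, -, hcard⟩ := exists_linearIndepOn_span_eq (colVec K A) (s := Set.univ)
    ((linearIndepOn_insert heb).2 ⟨hb₀, he⟩) (Set.subset_univ _)
  have hbd : b.ncard = d := by
    rw [hcard, ← Finset.coe_univ]
    exact rankOf_colVec_univ K hA
  -- a basis of columns of `A` that contains `e` and spans the columns of `s` without `e`
  let c : Fin d ≃ b := (Finite.equivFinOfCardEq (by rw [Nat.card_coe_set_eq, hbd])).symm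
  have heb' : e ∈ b := hib (Set.mem_insert _ _)
  set k₀ := c.symm ⟨e, heb'⟩ with hk₀
  have hck₀ : (c k₀ : Fin n) = e := by simp [hk₀]
  set M : Matrix (Fin d) (Fin d) ℤ := A.submatrix id (fun k => (c k : Fin n)) with hM
  set MK : Matrix (Fin d) (Fin d) K := M.map (Int.castRingHom K)
  have hdetK : MK.det = (M.det : K) := ((Int.castRingHom K).map_det M).symm
  have hdet0 : MK.det ≠ 0 := by
    have hli : LinearIndependent K MK.col := by
      have := hb.linearIndependent.comp c c.injective
      exact this
    exact ((Matrix.isUnit_iff_isUnit_det _).1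
      (Matrix.linearIndependent_cols_iff_isUnit.1 hli)).ne_zero
  have hdet : M.det = 1 ∨ M.det = -1 := by
    rcases hA.det_submatrix (fun k => (c k : Fin n)) with h | h
    · exact absurd (by rw [hdetK, hM, h, Int.cast_zero]) hdet0
    · exact h
  have hsq : MK.det * MK.det = 1 := by
    rw [hdetK]
    rcases hdet with h | h <;> simp [h]
  -- the coordinate functional of `e` in this basis, by Cramer's rule
  let η : Module.Dual K (Fin d → K) := MK.det • (LinearMap.proj k₀ ∘ₗ Matrix.cramer MK)
  have hη : ∀ z : Fin d → ℤ, η (fun s => (z s : K)) =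
      ((M.det * (M.updateCol k₀ z).det : ℤ) : K) := by
    intro z
    have : MK.updateCol k₀ (fun s => (z s : K)) = (M.updateCol k₀ z).map (Int.castRingHom K) := by
      rw [Matrix.map_updateCol]
      rfl
    change MK.det * Matrix.cramer MK _ k₀ = _
    rw [Matrix.cramer_apply, this, hdetK, Int.cast_mul]
    congr 1
    exact ((Int.castRingHom K).map_det _).symm
  have hcol : ∀ i, M.updateCol k₀ (fun s => A s i) =
      A.submatrix id (Function.update (fun k => (c k : Fin n)) k₀ i) := by
    intro i
    ext s k
    rcases eq_or_ne k k₀ with rfl | hk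
    · simp
    · simp [hk, hM]
  have hηb : ∀ i ∈ b₀, η (colVec K A i) = 0 := by
    intro i hi
    have hib' : i ∈ b := hib (Set.mem_insert_of_mem _ hi)
    have hne : c.symm ⟨i, hib'⟩ ≠ k₀ := by
      rw [hk₀]
      intro h
      have := congrArg Subtype.val (c.symm.injective h)
      exact heb ((show i = e from this) ▸ hi)
    change η (fun s => (A s i : K)) = 0
    have h0 : (A.submatrix id (Function.update (fun k => (c k : Fin n)) k₀ i)).det = 0 :=
      Matrix.det_zero_of_column_eq hne fun s => by simp [hne]
    rw [hη, hcol, h0, mul_zero, Int.cast_zero]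
  refine ⟨η, ⟨fun i => ?_, ?_⟩, ?_, ?_⟩
  · change η (fun s => (A s i : K)) = 0 ∨ η (fun s => (A s i : K)) = 1 ∨
      η (fun s => (A s i : K)) = -1
    rw [hη, hcol]
    rcases hdet with h | h <;> rcases hA.det_submatrix
      (Function.update (fun k => (c k : Fin n)) k₀ i) with h' | h' | h' <;> simp [h, h']
  · rintro _ ⟨z, rfl⟩
    exact ⟨_, hη z⟩
  · have hle : Submodule.span K (colVec K A '' b₀) ≤ LinearMap.ker η := by
      rw [Submodule.span_le]
      rintro _ ⟨i, hi, rfl⟩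
      exact hηb i hi
    intro i hi
    refine hle ?_
    rw [hspan₀]
    exact Submodule.subset_span ⟨i, hi, rfl⟩
  · change η (fun s => (A s e : K)) = 1
    rw [hη, hcol]
    have : Function.update (fun k => (c k : Fin n)) k₀ e = fun k => (c k : Fin n) := by
      rw [← hck₀, Function.update_eq_self_iff.2 rfl]
    rw [this, ← hM, Int.cast_mul, ← hdetK, hsq]

end Columns

/-! ### Zonotopes and their interiors -/

section Zonotope

variable {d n : ℕ} {A : Matrix (Fin d) (Fin n) ℤ}

theorem realMatrix_mulVec (A : Matrix (Fin d) (Fin n) ℤ) (t : Fin n → ℝ) :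
    (realMatrix A).mulVec t = ∑ i, t i • colVec ℝ A i := by
  ext s
  simp [Matrix.mulVec, dotProduct, realMatrix, colVec, mul_comm]

theorem smul_zonotope (A : Matrix (Fin d) (Fin n) ℤ) {m : ℕ} (hm : 1 ≤ m) :
    (m : ℝ) • zonotope A = closedBoxSum m (colVec ℝ A) Finset.univ := by
  have hm0 : (0 : ℝ) < m := by exact_mod_cast hm
  ext x
  constructor
  · rintro ⟨_, ⟨t, ht, rfl⟩, rfl⟩
    refine ⟨fun i => m * t i, fun i _ => ⟨mul_nonneg hm0.le (ht.1 i), ?_⟩, ?_⟩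
    · simpa using mul_le_mul_of_nonneg_left (ht.2 i) hm0.le
    · simp only [realMatrix_mulVec, Finset.smul_sum, mul_smul]
  · rintro ⟨t, ht, rfl⟩
    refine ⟨_, ⟨fun i => (m : ℝ)⁻¹ * t i, ⟨fun i => ?_, fun i => ?_⟩, rfl⟩, ?_⟩
    · exact mul_nonneg (inv_nonneg.2 hm0.le) (ht i (Finset.mem_univ i)).1
    · have := mul_le_mul_of_nonneg_left (ht i (Finset.mem_univ i)).2 (inv_nonneg.2 hm0.le)
      rwa [inv_mul_cancel₀ hm0.ne'] at this
    · simp only [realMatrix_mulVec, Finset.smul_sum, smul_smul, mul_inv_cancel_left₀ hm0.ne']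

/-- A full-dimensional closed zonotope has the open one as its interior. -/
theorem interior_closedBoxSum {v : Fin n → Fin d → ℝ} (hv : Submodule.span ℝ (Set.range v) = ⊤)
    {c : ℝ} (hc : 0 < c) :
    interior (closedBoxSum c v Finset.univ) = openBoxSum c v Finset.univ := by
  apply Set.Subset.antisymm
  · -- an interior point stays in the zonotope when pushed slightly away from the centre
    intro y hy
    set p : Fin d → ℝ := ∑ i, (c / 2) • v i with hp
    have hcont : Continuous fun ε : ℝ => y + ε • (y - p) := by fun_prop
    have hev : ∀ᶠ ε : ℝ in nhds 0, y + ε • (y - p) ∈ closedBoxSum c v Finset.univ := by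
      refine (hcont.tendsto 0).eventually ?_
      rw [zero_smul, add_zero]
      exact mem_interior_iff_mem_nhds.1 hy
    obtain ⟨δ, hδ, hall⟩ := Metric.eventually_nhds_iff.1 hev
    obtain ⟨t, ht, hty⟩ := hall (y := δ / 2) (by
      rw [Real.dist_eq, sub_zero, abs_of_pos (half_pos hδ)]; exact half_lt_self hδ)
    set ε := δ / 2
    have hε0 : 0 < ε := half_pos hδ
    have h1 : 0 < 1 + ε := by linarith
    have hy' : y = (1 + ε)⁻¹ • ∑ i, t i • v i + (ε / (1 + ε)) • p := by
      rw [← hty, eq_comm, div_eq_inv_mul, mul_smul, ← smul_add, inv_smul_eq_iff₀ h1.ne']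
      module
    refine ⟨fun i => (1 + ε)⁻¹ * t i + ε / (1 + ε) * (c / 2), fun i hi => ⟨?_, ?_⟩, ?_⟩
    · have := (ht i hi).1
      positivity
    · have := (ht i hi).2
      have e : (1 + ε)⁻¹ * t i + ε / (1 + ε) * (c / 2) = (t i + ε * (c / 2)) / (1 + ε) := by
        field_simp
      change (1 + ε)⁻¹ * t i + ε / (1 + ε) * (c / 2) < c
      rw [e, div_lt_iff₀ h1]
      nlinarith
    · rw [hy', hp]
      simp only [Finset.smul_sum, add_smul, mul_smul, Finset.sum_add_distrib]
  · -- the open zonotope is the image of an open box under a surjective linear map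
    refine interior_maximal (openBoxSum_subset c v _) ?_
    let L : (Fin n → ℝ) →L[ℝ] (Fin d → ℝ) := LinearMap.toContinuousLinearMap
      (Fintype.linearCombination ℝ v)
    have hsurj : Function.Surjective L := by
      rw [← Set.range_eq_univ]
      have := Fintype.range_linearCombination ℝ v
      rw [hv] at this
      exact LinearMap.coe_range (Fintype.linearCombination ℝ v) ▸ by rw [this]; rfl
    have hopen := L.isOpenMap hsurj
    have : openBoxSum c v Finset.univ = L '' (Set.univ.pi fun _ => Set.Ioo 0 c) := by
      ext x
      constructor
      · rintro ⟨t, ht, rfl⟩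
        exact ⟨t, fun i _ => ht i (Finset.mem_univ i), rfl⟩
      · rintro ⟨t, ht, rfl⟩
        exact ⟨t, fun i _ => ht i (Set.mem_univ i), rfl⟩
    rw [this]
    exact hopen _ (isOpen_set_pi Set.finite_univ fun _ _ => isOpen_Ioo)

theorem interior_smul_zonotope (hA : IsUnimodular A) {m : ℕ} (hm : 1 ≤ m) :
    interior ((m : ℝ) • zonotope A) = openBoxSum m (colVec ℝ A) Finset.univ := by
  rw [smul_zonotope A hm, interior_closedBoxSum (span_colVec_univ ℝ hA) (by exact_mod_cast hm)]

theorem image_latticePoints (P : Set (Fin d → ℝ)) :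
    (fun (z : Fin d → ℤ) s => (z s : ℝ)) '' latticePoints P = (intLattice ℝ d : Set _) ∩ P := by
  ext x
  constructor
  · rintro ⟨z, hz, rfl⟩
    exact ⟨⟨z, rfl⟩, hz⟩
  · rintro ⟨⟨z, rfl⟩, hz⟩
    exact ⟨z, hz, rfl⟩

theorem intCast_comp_injective (K : Type*) [Field K] [CharZero K] :
    Function.Injective fun (z : Fin d → ℤ) s => (z s : K) :=
  fun _ _ h => funext fun s => Int.cast_injective (congrFun h s)

theorem ncard_inter_intLattice (P : Set (Fin d → ℝ)) :
    ((intLattice ℝ d : Set _) ∩ P).ncard = (latticePoints P).ncard := by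
  rw [← image_latticePoints, Set.ncard_image_of_injective _ (intCast_comp_injective ℝ)]

theorem ncard_toComplex (S : Set (Fin d → ℤ)) : (toComplex S).ncard = S.ncard :=
  Set.ncard_image_of_injective _ (intCast_comp_injective ℂ)

theorem latticePoints_finite_iff (P : Set (Fin d → ℝ)) :
    (latticePoints P).Finite ↔ ((intLattice ℝ d : Set _) ∩ P).Finite := by
  rw [← image_latticePoints, Set.finite_image_iff (intCast_comp_injective ℝ).injOn]

end Zonotope

end GradedEhrhart

namespace GradedEhrhart

/-! ### The Hilbert series -/

section HilbertSeries

variable {d n : ℕ} {A : Matrix (Fin d) (Fin n) ℤ}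

theorem eval_one_eq_sum_range (f : Polynomial ℤ) {J : ℕ} (hJ : f.natDegree < J) :
    f.eval 1 = ∑ j ∈ Finset.range J, f.coeff j := by
  rw [Polynomial.eval_eq_sum_range' hJ]
  simp

/-- Coefficientwise bounds are equalities when the total bound goes the other way. -/
theorem eq_of_coeff_le {f : Polynomial ℤ} {a : ℕ → ℕ} {N : ℕ} (h1 : ∀ j, f.coeff j ≤ a j)
    (h2 : ∀ J, ∑ j ∈ Finset.range J, a j ≤ N) (h3 : (N : ℤ) ≤ f.eval 1) :
    (∀ j, f.coeff j = a j) ∧ f.eval 1 = N := by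
  have hle : ∀ J, f.natDegree < J → f.eval 1 ≤ ∑ j ∈ Finset.range J, (a j : ℤ) := fun J hJ => by
    rw [eval_one_eq_sum_range f hJ]
    exact Finset.sum_le_sum fun j _ => h1 j
  have h2' : ∀ J, ∑ j ∈ Finset.range J, (a j : ℤ) ≤ N := fun J => by exact_mod_cast h2 J
  refine ⟨fun j => ?_, le_antisymm ((hle _ (Nat.lt_succ_self _)).trans (h2' _)) h3⟩
  set J := max f.natDegree j + 1 with hJ
  have hJ1 : f.natDegree < J := by omega
  have hsum : ∑ j ∈ Finset.range J, f.coeff j = ∑ j ∈ Finset.range J, (a j : ℤ) := by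
    refine le_antisymm (Finset.sum_le_sum fun j _ => h1 j) ?_
    rw [← eval_one_eq_sum_range f hJ1]
    exact (h2' J).trans h3
  exact (Finset.sum_eq_sum_iff_of_le fun j _ => h1 j).1 hsum j (Finset.mem_range.2 (by omega))

theorem eq_of_le_coeff {f : Polynomial ℤ} {a : ℕ → ℕ} {N : ℕ} (h1 : ∀ j, a j ≤ f.coeff j)
    (h2 : ∃ J₀, ∀ J, J₀ ≤ J → ∑ j ∈ Finset.range J, a j = N) (h3 : f.eval 1 ≤ N) :
    (∀ j, f.coeff j = a j) ∧ f.eval 1 = N := by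
  obtain ⟨J₀, hJ₀⟩ := h2
  have hle : ∀ J, f.natDegree < J → ∑ j ∈ Finset.range J, (a j : ℤ) ≤ f.eval 1 := fun J hJ => by
    rw [eval_one_eq_sum_range f hJ]
    exact Finset.sum_le_sum fun j _ => h1 j
  have h2' : ∀ J, J₀ ≤ J → ∑ j ∈ Finset.range J, (a j : ℤ) = N := fun J hJ => by
    exact_mod_cast hJ₀ J hJ
  refine ⟨fun j => ?_, le_antisymm h3 ?_⟩
  · set J := max (max f.natDegree j + 1) J₀ with hJ
    have hJ1 : f.natDegree < J := by omega
    have hsum : ∑ j ∈ Finset.range J, (a j : ℤ) = ∑ j ∈ Finset.range J, f.coeff j := by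
      refine le_antisymm (Finset.sum_le_sum fun j _ => h1 j) ?_
      rw [← eval_one_eq_sum_range f hJ1, h2' J (by omega)]
      exact h3
    exact ((Finset.sum_eq_sum_iff_of_le fun j _ => h1 j).1 hsum j
      (Finset.mem_range.2 (by omega))).symm
  · rw [← h2' (max (f.natDegree + 1) J₀) (by omega)]
    exact hle _ (by omega)

theorem finite_latticePoints_smul_zonotope (hA : IsUnimodular A) {m : ℕ} (hm : 1 ≤ m) :
    (latticePoints ((m : ℝ) • zonotope A)).Finite := by
  rw [latticePoints_finite_iff, smul_zonotope A hm]
  exact (ncard_closedBoxSum_le m _ _ _ (isUnimodularConfig_colVec ℝ hA)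
    (colVec_mem_intLattice ℝ A)).1

theorem latticePoints_mono {P Q : Set (Fin d → ℝ)} (h : P ⊆ Q) :
    latticePoints P ⊆ latticePoints Q := fun _ hz => h hz

/-- The coefficients of `extPoly` bound the Hilbert function from below, and its value at `1` bounds
the number of lattice points from above; so both bounds are sharp. -/
theorem gradedCount_eq (hA : IsUnimodular A) {m : ℕ} (hm : 1 ≤ m) :
    (extPoly m (rankOf ℝ (colVec ℝ A)) Finset.univ : PowerSeries ℤ) =
      gradedCount (zonotope A) m ∧
    (extPoly m (rankOf ℝ (colVec ℝ A)) Finset.univ).eval 1 =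
      ((latticePoints ((m : ℝ) • zonotope A)).ncard : ℤ) := by
  set S := latticePoints ((m : ℝ) • zonotope A) with hS
  have hfin : (toComplex S).Finite := (finite_latticePoints_smul_zonotope hA hm).image _
  have := hfin.to_subtype
  have := Fintype.ofFinite (toComplex S)
  have hpts : ∀ t : Fin n → ℕ, (∀ i ∈ Finset.univ, t i ≤ m) →
      ∑ i, t i • colVec ℂ A i ∈ toComplex S := by
    intro t ht
    refine ⟨fun s => ∑ i, t i * A s i, ?_, ?_⟩
    · rw [hS, latticePoints, Set.mem_ofPred_eq, smul_zonotope A hm]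
      refine ⟨fun i => t i, fun i hi => ⟨Nat.cast_nonneg _, Nat.cast_le.2 (ht i hi)⟩, ?_⟩
      ext s
      simp [colVec]
    · ext s
      simp [colVec]
  have h := eq_of_coeff_le (f := extPoly m (rankOf ℝ (colVec ℝ A)) Finset.univ)
    (a := fun j => Module.finrank ℂ (orbPiece (toComplex S) j)) (N := S.ncard) (fun j => by
      rw [← extPoly_congr (r := rankOf ℂ (colVec ℂ A)) m fun T _ => rankOf_colVec ℂ ℝ A T,
        ← finrank_leastSpace]
      refine (coeff_extPoly_le_finrank_prodSpace m Finset.univ (colVec ℂ A) j).trans ?_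
      have : FiniteDimensional ℂ (leastSpace (toComplex S) j) :=
        Submodule.finiteDimensional_of_le (leastSpace_le j)
      exact_mod_cast Submodule.finrank_mono (prodSpace_le_leastSpace hpts j))
    (fun J => by rw [← ncard_toComplex]; exact sum_finrank_orbPiece_le _ J)
    (by
      have := (ncard_closedBoxSum_le m Finset.univ _ _ (isUnimodularConfig_colVec ℝ hA)
        (colVec_mem_intLattice ℝ A)).2
      rwa [← smul_zonotope A hm, ncard_inter_intLattice] at this)
  refine ⟨?_, h.2⟩
  ext j
  rw [Polynomial.coeff_coe, h.1 j, gradedCount, orbHilb, PowerSeries.coeff_mk]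

/-- On the interior lattice points, a functional with values in `{0, 1, -1}` on the columns takes
integer values strictly between its extreme values on the zonotope. -/
theorem exists_card_eq_of_mem_internalExponents (hA : IsUnimodular A) {m : ℕ} (hm : 1 ≤ m)
    {η : Module.Dual ℂ (Fin d → ℂ)} {k : ℕ}
    (h : (η, k) ∈ internalExponents m (colVec ℂ A) (intLattice ℂ d) Finset.univ 0 0) :
    ∃ Z : Finset ℂ, Z.card = k ∧
      ∀ y ∈ toComplex (latticePoints (interior ((m : ℝ) • zonotope A))), η y ∈ Z := by
  rcases h with ⟨⟨hη1, hη2⟩, hk⟩ | ⟨hk, -, h0⟩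
  · have hsingle : ∀ s : Fin d, ∃ z : ℤ, η (Pi.single s 1) = z := fun s =>
      hη2 _ ⟨Pi.single s 1, by ext t; simp [Pi.single_apply]⟩
    choose h hh using hsingle
    have hval : ∀ z : Fin d → ℤ, η (fun s => (z s : ℂ)) = ((∑ s, z s * h s : ℤ) : ℂ) := by
      intro z
      rw [pi_eq_sum_univ' (fun s => (z s : ℂ)), map_sum]
      push_cast
      refine Finset.sum_congr rfl fun s _ => ?_
      rw [map_smul, hh, smul_eq_mul]
    set w : Fin n → ℤ := fun i => ∑ s, A s i * h s with hw
    have hηw : ∀ i, η (colVec ℂ A i) = (w i : ℂ) := fun i => hval fun s => A s i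
    have hw1 : ∀ i, w i = 0 ∨ w i = 1 ∨ w i = -1 := by
      intro i
      have := hη1 i
      rw [hηw] at this
      exact_mod_cast this
    set P : ℤ := ∑ i, if w i = 1 then (m : ℤ) else 0 with hP
    set N : ℤ := ∑ i, if w i = -1 then (m : ℤ) else 0 with hN
    have hm0 : (0 : ℤ) < m := by exact_mod_cast hm
    have hk' : (k : ℤ) + 1 = P + N := by
      have h1 : (k : ℤ) + 1 = ((k + 1 : ℕ) : ℤ) := by push_cast; rfl
      change k + 1 = (if η 0 = 0 then 0 else 0) + weight m (colVec ℂ A) Finset.univ η at hk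
      rw [h1, hk, if_pos (map_zero η), zero_add, weight, hP, hN, ← Finset.sum_add_distrib]
      push_cast
      refine Finset.sum_congr rfl fun i _ => ?_
      rw [hηw]
      rcases hw1 i with h | h | h <;> simp [h]
    have hex : ∃ i, w i ≠ 0 := by
      by_contra! hall
      have : P + N = 0 := by simp [hP, hN, hall]
      omega
    refine ⟨(Finset.Ioo (-N) P).image fun z : ℤ => (z : ℂ), ?_, ?_⟩
    · rw [Finset.card_image_of_injective _ Int.cast_injective, Int.card_Ioo]
      omega
    · rintro _ ⟨z, hz, rfl⟩
      rw [latticePoints, Set.mem_ofPred_eq, interior_smul_zonotope hA hm] at hz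
      obtain ⟨t, ht, htz⟩ := hz
      have hsum : ((∑ s, z s * h s : ℤ) : ℝ) = ∑ i, t i * w i := by
        have hz' : ∀ s, (z s : ℝ) = ∑ i, t i * A s i := fun s => by
          have := congrFun htz s
          simpa [colVec] using this
        push_cast [hw]
        simp_rw [hz', Finset.sum_mul, Finset.mul_sum]
        rw [Finset.sum_comm]
        exact Finset.sum_congr rfl fun i _ => Finset.sum_congr rfl fun s _ => by ring
      obtain ⟨i₀, hi₀⟩ := hex
      have hup : ((∑ s, z s * h s : ℤ) : ℝ) < (P : ℝ) := by
        rw [hsum, hP]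
        push_cast
        refine Finset.sum_lt_sum (fun i hi => ?_) ⟨i₀, Finset.mem_univ _, ?_⟩
        · have := ht i hi
          rcases hw1 i with h | h | h <;> simp [h] <;> linarith
        · have := ht i₀ (Finset.mem_univ _)
          rcases hw1 i₀ with h | h | h
          · exact absurd h hi₀
          all_goals simp [h]; linarith
      have hlow : (((-N : ℤ)) : ℝ) < ((∑ s, z s * h s : ℤ) : ℝ) := by
        rw [hsum, hN, ← Finset.sum_neg_distrib]
        push_cast
        refine Finset.sum_lt_sum (fun i hi => ?_) ⟨i₀, Finset.mem_univ _, ?_⟩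
        · have := ht i hi
          rcases hw1 i with h | h | h <;> simp [h] <;> linarith
        · have := ht i₀ (Finset.mem_univ _)
          rcases hw1 i₀ with h | h | h
          · exact absurd h hi₀
          all_goals simp [h]; linarith
      change η (fun s => (z s : ℂ)) ∈ _
      rw [hval]
      exact Finset.mem_image_of_mem _
        (Finset.mem_Ioo.2 ⟨Int.cast_lt.1 hlow, Int.cast_lt.1 hup⟩)
  · refine ⟨{0}, by rw [Finset.card_singleton]; exact hk.symm, fun y _ => ?_⟩
    have hle : Submodule.span ℂ (Set.range (colVec ℂ A)) ≤ LinearMap.ker η := by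
      rw [Submodule.span_le]
      rintro _ ⟨i, rfl⟩
      exact h0 i (Finset.mem_univ i)
    rw [span_colVec_univ ℂ hA] at hle
    rw [Finset.mem_singleton]
    exact hle Submodule.mem_top

/-- The coefficients of `g = X ^ (-d) * intPoly` bound the Hilbert function from above, and its
value at `1` bounds the number of interior lattice points from below; so both bounds are sharp. -/
theorem exists_gradedInteriorCount_eq (hA : IsUnimodular A) {m : ℕ} (hm : 1 ≤ m) :
    ∃ g : Polynomial ℤ, (g : PowerSeries ℤ) = gradedInteriorCount (zonotope A) m ∧
      g.eval 1 = ((latticePoints (interior ((m : ℝ) • zonotope A))).ncard : ℤ) ∧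
      Polynomial.X ^ d * g = intPoly m (rankOf ℝ (colVec ℝ A)) Finset.univ := by
  set S := latticePoints (interior ((m : ℝ) • zonotope A))
  have hfin : (toComplex S).Finite :=
    ((finite_latticePoints_smul_zonotope hA hm).subset (latticePoints_mono interior_subset)).image _
  have := hfin.to_subtype
  have := Fintype.ofFinite (toComplex S)
  obtain ⟨m, rfl⟩ := Nat.exists_eq_add_of_le' hm
  obtain ⟨g, hg1, hg2⟩ := exists_finrank_powKer_le m Finset.univ (colVec ℂ A) (intLattice ℂ d)
    (isUnimodularConfig_colVec ℂ hA)
  rw [rankOf_colVec_univ ℂ hA, intPoly_congr (r' := rankOf ℝ (colVec ℝ A)) _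
    fun T _ => rankOf_colVec ℂ ℝ A T] at hg1
  have h := eq_of_le_coeff (f := g)
    (a := fun j => Module.finrank ℂ (orbPiece (toComplex S) j)) (N := S.ncard) (fun j => by
      rw [← finrank_leastSpace]
      refine le_trans ?_ (hg2 j)
      exact_mod_cast Submodule.finrank_mono (leastSpace_le_powKer
        (fun η k ht => exists_card_eq_of_mem_internalExponents hA hm ht) j))
    (by rw [← ncard_toComplex]; exact exists_sum_finrank_orbPiece_eq _)
    (by
      have h1 := le_ncard_openBoxSum m Finset.univ _ _ (isUnimodularConfig_colVec ℝ hA)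
        (colVec_mem_intLattice ℝ A)
      rw [← interior_smul_zonotope hA hm, ncard_inter_intLattice, ← hg1,
        Polynomial.eval_mul, Polynomial.eval_pow, Polynomial.eval_X, one_pow, one_mul] at h1
      exact h1)
  refine ⟨g, ?_, h.2, hg1⟩
  ext j
  rw [Polynomial.coeff_coe, h.1 j, gradedInteriorCount, orbHilb, PowerSeries.coeff_mk]

end HilbertSeries

/-! ### The Tutte polynomial -/

section Tutte

variable {d n : ℕ} {A : Matrix (Fin d) (Fin n) ℤ}

theorem columnMatroid_indep_iff (A : Matrix (Fin d) (Fin n) ℤ) (I : Set (Fin n)) :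
    (columnMatroid (realMatrix A)).Indep I ↔ LinearIndepOn ℝ (colVec ℝ A) I := Iff.rfl

theorem rk_columnMatroid (A : Matrix (Fin d) (Fin n) ℤ) (S : Finset (Fin n)) :
    rk (columnMatroid (realMatrix A)) (S : Set (Fin n)) = rankOf ℝ (colVec ℝ A) S := by
  obtain ⟨b, -, hbS, hb, -, hcard⟩ := exists_linearIndepOn_span_eq (colVec ℝ A) (s := S)
    (linearIndepOn_empty ℝ _) (Set.empty_subset _)
  obtain ⟨I, hI⟩ := (columnMatroid (realMatrix A)).exists_isBasis' (S : Set (Fin n))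
  have hIi := (columnMatroid_indep_iff A I).1 hI.indep
  have hIle : I.ncard ≤ rankOf ℝ (colVec ℝ A) S := by
    rw [← finrank_span_image_eq_ncard hIi]
    exact Submodule.finrank_mono (Submodule.span_mono (Set.image_mono hI.subset))
  have hle : b.encard ≤ I.encard := by
    rw [hI.encard_eq_eRk]
    exact ((columnMatroid_indep_iff A b).2 hb).encard_le_eRk_of_subset hbS
  have hrk : rk (columnMatroid (realMatrix A)) (S : Set (Fin n)) = I.ncard := by
    rw [rk, ← hI.encard_eq_eRk]
    rfl
  rw [← (Set.toFinite b).cast_ncard_eq, ← (Set.toFinite I).cast_ncard_eq, Nat.cast_le, hcard] at hle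
  rw [hrk]
  exact le_antisymm hIle hle

theorem tutteEval_columnMatroid {R : Type*} [CommRing R] (hA : IsUnimodular A) (x y : R) :
    tutteEval (columnMatroid (realMatrix A)) x y =
      ∑ S : Finset (Fin n), (x - 1) ^ (d - rankOf ℝ (colVec ℝ A) S) *
        (y - 1) ^ (S.card - rankOf ℝ (colVec ℝ A) S) := by
  classical
  have hE : (columnMatroid (realMatrix A)).E = ((Finset.univ : Finset (Fin n)) : Set (Fin n)) := by
    rw [Finset.coe_univ]; rfl
  rw [tutteEval, tuttePoly, map_sum, hE, rk_columnMatroid, rankOf_colVec_univ ℝ hA]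
  rw [Finset.filter_true_of_mem fun S _ => Finset.coe_subset.2 (Finset.subset_univ S)]
  refine Finset.sum_congr rfl fun S _ => ?_
  rw [rk_columnMatroid]
  simp

theorem rankOf_colVec_le_dim (hA : IsUnimodular A) (S : Finset (Fin n)) :
    rankOf ℝ (colVec ℝ A) S ≤ d :=
  (rankOf_mono _ (Finset.subset_univ S)).trans_eq (rankOf_colVec_univ ℝ hA)

variable {F : Type*} [Field F] {q : F}

theorem pow_mul_neg_pow_div_pow (hq : q ≠ 0) (m : ℕ) {r d : ℕ} (hr : r ≤ d) :
    q ^ d * (-q ^ m / q ^ (m + 1)) ^ (d - r) = (-1) ^ (d - r) * q ^ r := by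
  obtain ⟨a, rfl⟩ := Nat.exists_eq_add_of_le hr
  have h : -q ^ m / q ^ (m + 1) = -1 * q⁻¹ := by
    rw [pow_succ]
    field_simp
  rw [h, Nat.add_sub_cancel_left, mul_pow, pow_add, inv_pow]
  field_simp

/-- Comparison of one term of the corank-nullity sums; here `p` is `q ^ m`, `Q` is `[m]`, and `x`
is the numerator of the first argument of the Tutte polynomial minus `1`. -/
theorem tutte_term {p Q x u : F} (hp : p ≠ 0) (hQ : Q ≠ 0) {n d r k : ℕ} (hrd : r ≤ d)
    (hrk : r ≤ k) (hkn : k ≤ n) :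
    p ^ ((n : ℤ) - d) * Q ^ d * ((x / Q) ^ (d - r) * (p⁻¹ * (Q * u)) ^ (k - r)) =
      (x / p) ^ (d - r) * p ^ (n - k) * Q ^ k * u ^ (k - r) := by
  obtain ⟨a, rfl⟩ := Nat.exists_eq_add_of_le hrd
  obtain ⟨b, rfl⟩ := Nat.exists_eq_add_of_le hrk
  obtain ⟨c, rfl⟩ := Nat.exists_eq_add_of_le hkn
  have h : ((r + b + c : ℕ) : ℤ) - ((r + a : ℕ) : ℤ) = (b : ℤ) + c - a := by push_cast; ring
  rw [h, zpow_sub₀ hp, zpow_add₀ hp, zpow_natCast, zpow_natCast, zpow_natCast,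
    Nat.add_sub_cancel_left, Nat.add_sub_cancel_left, Nat.add_sub_cancel_left]
  simp only [mul_pow, div_pow, inv_pow, pow_add]
  field_simp

variable [Algebra ℤ F]

theorem aeval_qNat_mul (q : F) (m : ℕ) :
    Polynomial.aeval q (qNat m) * (1 - q) = 1 - q ^ m := by
  have := congrArg (Polynomial.aeval q) (qNat_mul m)
  simpa using this

/-- The Tutte polynomial at `y = q ^ (-m)`, expanded with `y - 1 = q ^ (-m) [m] (1 - q)`. -/
theorem zpow_mul_tutteEval (hA : IsUnimodular A) (hq : q ≠ 0) {m : ℕ}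
    (hQ : Polynomial.aeval q (qNat m) ≠ 0) (x : F) :
    q ^ (((n : ℤ) - d) * m) * Polynomial.aeval q (qNat m) ^ d *
        tutteEval (columnMatroid (realMatrix A)) (x / Polynomial.aeval q (qNat m) + 1)
          (q ^ (-(m : ℤ))) =
      ∑ S : Finset (Fin n), (x / q ^ m) ^ (d - rankOf ℝ (colVec ℝ A) S) *
        q ^ (m * (n - S.card)) * Polynomial.aeval q (qNat m) ^ S.card *
          (1 - q) ^ (S.card - rankOf ℝ (colVec ℝ A) S) := by
  rw [tutteEval_columnMatroid hA, Finset.mul_sum]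
  refine Finset.sum_congr rfl fun S _ => ?_
  have hpm : q ^ m ≠ 0 := pow_ne_zero m hq
  have hy : q ^ (-(m : ℤ)) - 1 = (q ^ m)⁻¹ * (Polynomial.aeval q (qNat m) * (1 - q)) := by
    rw [aeval_qNat_mul, zpow_neg, zpow_natCast, mul_sub, mul_one, inv_mul_cancel₀ hpm]
  have hz : q ^ (((n : ℤ) - d) * m) = (q ^ m) ^ ((n : ℤ) - d) := by
    rw [mul_comm, zpow_mul, zpow_natCast]
  have hrd : rankOf ℝ (colVec ℝ A) S ≤ d := rankOf_colVec_le_dim hA S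
  have hcard : S.card ≤ n := by simpa using Finset.card_le_univ S
  rw [add_sub_cancel_right, hy, hz, pow_mul]
  exact tutte_term hpm hQ hrd (rankOf_le_card _ S) hcard

theorem aeval_extPoly_eq (hA : IsUnimodular A) (hq : q ≠ 0) {m : ℕ}
    (hQ : Polynomial.aeval q (qNat m) ≠ 0) :
    Polynomial.aeval q (extPoly m (rankOf ℝ (colVec ℝ A)) Finset.univ) =
      q ^ (((n : ℤ) - d) * m) * Polynomial.aeval q (qNat m) ^ d *
        tutteEval (columnMatroid (realMatrix A))
          (Polynomial.aeval q (qNat (m + 1)) / Polynomial.aeval q (qNat m)) (q ^ (-(m : ℤ))) := by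
  have hx : Polynomial.aeval q (qNat (m + 1)) / Polynomial.aeval q (qNat m) =
      q ^ m / Polynomial.aeval q (qNat m) + 1 := by
    rw [qNat_succ, map_add, add_div, div_self hQ, add_comm]
    simp
  rw [hx, zpow_mul_tutteEval hA hq hQ, extPoly, map_sum, Finset.powerset_univ]
  refine Finset.sum_congr rfl fun S _ => ?_
  rw [div_self (pow_ne_zero m hq)]
  simp

theorem aeval_eq_of_intPoly (hA : IsUnimodular A) (hq : q ≠ 0) {m : ℕ}
    (hQ : Polynomial.aeval q (qNat (m + 1)) ≠ 0) {g : Polynomial ℤ}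
    (hg : Polynomial.X ^ d * g = intPoly (m + 1) (rankOf ℝ (colVec ℝ A)) Finset.univ) :
    Polynomial.aeval q g =
      q ^ (((n : ℤ) - d) * (m + 1 : ℕ)) * Polynomial.aeval q (qNat (m + 1)) ^ d *
        tutteEval (columnMatroid (realMatrix A))
          (Polynomial.aeval q (qNat m) / Polynomial.aeval q (qNat (m + 1)))
          (q ^ (-((m + 1 : ℕ) : ℤ))) := by
  have hx : Polynomial.aeval q (qNat m) / Polynomial.aeval q (qNat (m + 1)) =
      -q ^ m / Polynomial.aeval q (qNat (m + 1)) + 1 := by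
    rw [div_add_one hQ, qNat_succ]
    simp
  rw [hx, zpow_mul_tutteEval hA hq hQ]
  refine mul_left_cancel₀ (pow_ne_zero d hq) ?_
  have h := congrArg (Polynomial.aeval q) hg
  rw [map_mul, map_pow, Polynomial.aeval_X] at h
  rw [h, intPoly, map_sum, Finset.powerset_univ, Finset.mul_sum]
  refine Finset.sum_congr rfl fun S _ => ?_
  have hrd : rankOf ℝ (colVec ℝ A) S ≤ d := rankOf_colVec_le_dim hA S
  rw [rankOf_colVec_univ ℝ hA]
  rw [← mul_assoc, ← mul_assoc, ← mul_assoc, pow_mul_neg_pow_div_pow hq m hrd]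
  simp

theorem q_pow_ne_one {m : ℕ} (hm : 1 ≤ m) : GradedEhrhart.q ^ m ≠ 1 := by
  intro h
  have h' : algebraMap (Polynomial ℚ) (RatFunc ℚ) (Polynomial.X ^ m) =
      algebraMap (Polynomial ℚ) (RatFunc ℚ) 1 := by
    rw [map_pow, RatFunc.algebraMap_X, map_one]
    exact h
  have h'' := congrArg (Polynomial.eval 0) (RatFunc.algebraMap_injective ℚ h')
  rw [Polynomial.eval_pow, Polynomial.eval_X, Polynomial.eval_one, zero_pow (by omega)] at h''
  exact zero_ne_one h''

theorem qInt_natCast (m : ℕ) : qInt m = Polynomial.aeval GradedEhrhart.q (qNat m) := by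
  have h1 : 1 - GradedEhrhart.q ≠ 0 := by
    have := q_pow_ne_one le_rfl
    rw [pow_one] at this
    exact sub_ne_zero.2 this.symm
  rw [qInt, zpow_natCast, ← aeval_qNat_mul, mul_div_cancel_right₀ _ h1]

theorem aeval_q_qNat_ne_zero {m : ℕ} (hm : 1 ≤ m) :
    Polynomial.aeval GradedEhrhart.q (qNat m) ≠ 0 := by
  intro h
  have := aeval_qNat_mul GradedEhrhart.q m
  rw [h, zero_mul] at this
  exact q_pow_ne_one hm (sub_eq_zero.1 this.symm).symm

theorem aeval_one_eq (f : Polynomial ℤ) : Polynomial.aeval (1 : ℚ) f = ((f.eval 1 : ℤ) : ℚ) := by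
  have := Polynomial.aeval_algebraMap_apply ℚ (1 : ℤ) f
  rw [map_one] at this
  rw [this, Polynomial.coe_aeval_eq_eval]
  rfl

theorem aeval_one_qNat (m : ℕ) : Polynomial.aeval (1 : ℚ) (qNat m) = m := by
  rw [aeval_one_eq, eval_one_qNat, Int.cast_natCast]

end Tutte

end GradedEhrhart

theorem mainTheorem1 (d n : ℕ) (A : Matrix (Fin d) (Fin n) ℤ) (hA : IsUnimodular A)
    (m : ℕ) (hm : 1 ≤ m) :
    -- the two graded counts are polynomials `f`, `g` in `ℤ[q]`
    ∃ f g : Polynomial ℤ,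
      (f : PowerSeries ℤ) = gradedCount (zonotope A) m ∧
      (g : PowerSeries ℤ) = gradedInteriorCount (zonotope A) m ∧
      -- the evaluations of the Tutte polynomial, in `ℚ(q)`
      Polynomial.aeval q f =
        q ^ (((n : ℤ) - d) * m) * qInt m ^ d *
          tutteEval (columnMatroid (realMatrix A)) (qInt (m + 1) / qInt m) (q ^ (-(m : ℤ))) ∧
      Polynomial.aeval q g =
        q ^ (((n : ℤ) - d) * m) * qInt m ^ d *
          tutteEval (columnMatroid (realMatrix A)) (qInt (m - 1) / qInt m) (q ^ (-(m : ℤ))) ∧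
      -- at `q = 1`: the ordinary lattice point counts and their formulas
      f.eval 1 = ((latticePoints ((m : ℝ) • zonotope A)).ncard : ℤ) ∧
      g.eval 1 = ((latticePoints (interior ((m : ℝ) • zonotope A))).ncard : ℤ) ∧
      ((latticePoints ((m : ℝ) • zonotope A)).ncard : ℚ) =
        (m : ℚ) ^ d * tutteEval (columnMatroid (realMatrix A)) (((m : ℚ) + 1) / m) 1 ∧
      ((latticePoints (interior ((m : ℝ) • zonotope A))).ncard : ℚ) =
        (m : ℚ) ^ d * tutteEval (columnMatroid (realMatrix A)) (((m : ℚ) - 1) / m) 1 := by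
  obtain ⟨hf, hf1⟩ := gradedCount_eq hA hm
  obtain ⟨g, hg, hg1, hgX⟩ := exists_gradedInteriorCount_eq hA hm
  obtain ⟨m, rfl⟩ := Nat.exists_eq_add_of_le' hm
  have hq0 : q ≠ 0 := RatFunc.X_ne_zero
  have hm0 : ((m + 1 : ℕ) : ℚ) ≠ 0 := by exact_mod_cast Nat.succ_ne_zero m
  refine ⟨_, g, hf, hg, ?_, ?_, hf1, hg1, ?_, ?_⟩
  · have h := aeval_extPoly_eq hA hq0 (aeval_q_qNat_ne_zero hm)
    rwa [← qInt_natCast, ← qInt_natCast, Nat.cast_succ (m + 1)] at h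
  · have h := aeval_eq_of_intPoly hA hq0 (aeval_q_qNat_ne_zero hm) hgX
    rwa [← qInt_natCast, ← qInt_natCast,
      show ((m : ℕ) : ℤ) = ((m + 1 : ℕ) : ℤ) - 1 by push_cast; ring] at h
  · have h := aeval_extPoly_eq (q := (1 : ℚ)) hA one_ne_zero
      (by rw [aeval_one_qNat]; exact hm0)
    rw [aeval_one_eq, hf1, aeval_one_qNat, aeval_one_qNat, one_zpow, one_zpow, one_mul,
      Nat.cast_succ (m + 1)] at h
    exact_mod_cast h
  · have h := aeval_eq_of_intPoly (q := (1 : ℚ)) hA one_ne_zero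
      (by rw [aeval_one_qNat]; exact hm0) hgX
    rw [aeval_one_eq, hg1, aeval_one_qNat, aeval_one_qNat, one_zpow, one_zpow, one_mul,
      show ((m : ℕ) : ℚ) = ((m + 1 : ℕ) : ℚ) - 1 by push_cast; ring] at h
    exact_mod_cast h
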